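/- Write $\int_{\mathbb S^2}$ for integration with respect to the normalized surface measure. A curve is a closed, continuous, piecewise smooth map $\gamma:[0,L]\to\mathbb S^2$, $L>0$, with $\int_\gamma p=\int_0^L p(\gamma(\alpha))\|\dot\gamma(\alpha)\|\,d\alpha$ and $\ell(\gamma)=\int_\gamma 1$. For a finite set $X\subseteq\mathbb S^2$, the pair $(\gamma,X)$ is a hybrid $s$-design with balancing factor $\beta\in[0,1]$ if $$\frac{\beta}{|X|}\sum_{x\in X}p(x)+\frac{1-\beta}{\ell(\gamma)}\int_\gamma p=\int_{\mathbb S^2}p$$ for all real polynomials $p$ in three variables of total degree at most $s$. For a convex polytope $\mathcal P\subseteq\mathbb R^3$ with the origin as its center, let $\mathcal P_{\mathrm{dual}}$ be the convex hull of the centers (vertex averages) of its facets. An Euler cycle of $\mathcal P$ is a closed walk along edges of $\mathcal P$ that traverses every edge exactly once if every vertex is incident with an even number of edges, and exactly twice (all edges being doubled) otherwise. Replacing each step of the walk by the geodesic arc that is the outward projection of the edge onto $\mathbb S^2$ gives a closed curve, the geodesic cycle induced by the Euler cycle. Theorem. Let $\mathcal P$ be one of the first-named polytopes below, centered at the origin,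 of any size and in any orthogonal position. Then $\mathcal P_{\mathrm{dual}}$ is a polytope of the second-named type centered at the origin, $\mathcal P$ has an Euler cycle, and, for every Euler cycle of $\mathcal P$, the induced geodesic cycle $\gamma$ and the set $X$ of the vertices of $\mathcal P_{\mathrm{dual}}$, projected outward onto $\mathbb S^2$, form a hybrid $s$-design with the balancing factor $\beta$, where $s$ and $\beta$ are: - tetrahedron/tetrahedron: $s=3$, $\beta=\frac{4}{4+3\sqrt2\arccos(-\frac13)}$; - octahedron/cube: $s=5$, $\beta=\frac{9}{25}$; - cube/octahedron: $s=5$, $\beta=\frac{10\sqrt2+3\arccos(\frac13)}{10\sqrt2+35\arccos(\frac13)}$; - rhombic dodecahedron/cuboctahedron: $s=5$, $\beta=\frac{10-3\sqrt2\arccos(\frac1{\sqrt3})}{10+5\sqrt2\arccos(\frac1{\sqrt3})}$; - dodecahedron/icosahedron: $s=9$, $\beta=\frac{1190\sqrt5-675\arccos(\frac{\sqrt5}{3})}{1190\sqrt5+6237\arccos(\frac{\sqrt5}{3})}$; - icosahedron/dodecahedron: $s=9$, $\beta=\frac{126+45\arccos(\frac1{\sqrt5})}{126+301\arccos(\frac1{\sqrt5})}$;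 - rhombic triacontahedron/icosidodecahedron: $s=9$, $\beta=\frac{7(17\sqrt5-27)+135\arccos\sqrt{\frac13+\frac2{3\sqrt5}}}{7(17\sqrt5-27)+567\arccos\sqrt{\frac13+\frac2{3\sqrt5}}}$. Here tetrahedron, cube, octahedron, dodecahedron and icosahedron are the regular ones. -/

import Mathlib

open scoped RealInnerProductSpace ContDiff

noncomputable section

namespace HybridDesigns

/-- Euclidean three-space; the two-sphere is `Metric.sphere (0 : E3) 1`. -/
abbrev E3 : Type := EuclideanSpace ℝ (Fin 3)

/-- Outward projection onto the unit sphere. -/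
def proj (x : E3) : E3 := ‖x‖⁻¹ • x

/-! ### Curves on the sphere and hybrid designs -/

/-- Closed, continuous, piecewise smooth curves `γ : [0, L] → 𝕊²` with `L > 0`. Only the values of
`γ` on `[0, L]` matter. -/
structure IsSphericalCurve (L : ℝ) (γ : ℝ → E3) : Prop where
  pos : 0 < L
  mem_sphere : ∀ α ∈ Set.Icc 0 L, γ α ∈ Metric.sphere (0 : E3) 1
  continuousOn : ContinuousOn γ (Set.Icc 0 L)
  closed : γ 0 = γ L
  piecewise_smooth : ∃ (n : ℕ) (τ : Fin (n + 1) → ℝ), StrictMono τ ∧ τ 0 = 0 ∧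
    τ (Fin.last n) = L ∧ ∀ i : Fin n, ContDiffOn ℝ ∞ γ (Set.Icc (τ i.castSucc) (τ i.succ))

/-- The path integral `∫_γ f = ∫_0^L f(γ(α)) ‖γ'(α)‖ dα`. -/
def pathIntegral (L : ℝ) (γ : ℝ → E3) (f : E3 → ℝ) : ℝ :=
  ∫ α in (0 : ℝ)..L, f (γ α) * ‖deriv γ α‖

/-- The arc-length `ℓ(γ) = ∫_γ 1`. -/
def arcLength (L : ℝ) (γ : ℝ → E3) : ℝ := pathIntegral L γ fun _ => 1

/-- Evaluation of a polynomial in three variables. -/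
def evalPoly (p : MvPolynomial (Fin 3) ℝ) (x : E3) : ℝ := MvPolynomial.eval (fun i => x i) p

/-- The integral over `𝕊²` with respect to the normalized surface measure. -/
def sphereMean (f : E3 → ℝ) : ℝ :=
  ⨍ x : Metric.sphere (0 : E3) 1, f x ∂(MeasureTheory.volume : MeasureTheory.Measure E3).toSphere

/-- The curve `γ : [0, L] → 𝕊²` and the finite set `X ⊆ 𝕊²` form a hybrid `s`-design with
balancing factor `β`. -/
structure IsHybridDesign (s : ℕ) (β L : ℝ) (γ : ℝ → E3) (X : Set E3) : Prop where
  curve : IsSphericalCurve L γ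
  finite : X.Finite
  subset_sphere : X ⊆ Metric.sphere (0 : E3) 1
  nonneg : 0 ≤ β
  le_one : β ≤ 1
  exact_integration : ∀ p : MvPolynomial (Fin 3) ℝ, p.totalDegree ≤ s →
    β / (X.ncard : ℝ) * (∑ᶠ x ∈ X, evalPoly p x) +
      (1 - β) / arcLength L γ * pathIntegral L γ (evalPoly p) = sphereMean (evalPoly p)

/-! ### Geodesic arcs and chains -/

/-- The geodesic distance of two points of the sphere. -/
def sphDist (x y : E3) : ℝ := Real.arccos ⟪x, y⟫

/-- The geodesic arc from `x` to `y`, for `x, y` on the sphere with `y ≠ ± x`, parametrized by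
arc-length on `[0, sphDist x y]`. -/
def geodesicArc (x y : E3) (t : ℝ) : E3 :=
  (Real.sin (sphDist x y - t) / Real.sin (sphDist x y)) • x +
    (Real.sin t / Real.sin (sphDist x y)) • y

/-- The length of the geodesic chain through the listed points. -/
def chainLength : List E3 → ℝ
  | [] => 0
  | [_] => 0
  | x :: y :: l => sphDist x y + chainLength (y :: l)

/-- The geodesic chain through the listed points, parametrized by arc-length on
`[0, chainLength l]`: the concatenation of the successive geodesic arcs. -/
def geodesicChain : List E3 → ℝ → E3
  | [], _ => 0
  | [x], _ => x
  | x :: y :: l, t =>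
      if t ≤ sphDist x y then geodesicArc x y t else geodesicChain (y :: l) (t - sphDist x y)

/-! ### Vertices, edges, facets and duals of convex polytopes in three-space -/

/-- The vertices of a convex polytope: the points `v` such that `{v}` is a face (the intersection
with a supporting plane). -/
def vertices (P : Set E3) : Set E3 := P.exposedPoints ℝ

/-- The vertex-edge graph of a convex polytope: two distinct points are joined when the segment
between them is a face. -/
def edgeGraph (P : Set E3) : SimpleGraph E3 where
  Adj v w := v ≠ w ∧ IsExposed ℝ P (segment ℝ v w)
  symm := ⟨fun v w h => ⟨h.1.symm, by rw [segment_symm]; exact h.2⟩⟩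
  loopless := ⟨fun _ h => h.1 rfl⟩

/-- The facets of a convex polytope: its faces of dimension two. -/
def facets (P : Set E3) : Set (Set E3) :=
  {F | IsExposed ℝ P F ∧ Module.finrank ℝ (vectorSpan ℝ F) = 2}

/-- The center of a facet: the average of its vertices. -/
def center (F : Set E3) : E3 := ((vertices F).ncard : ℝ)⁻¹ • ∑ᶠ v ∈ vertices F, v

/-- The dual polytope: the convex hull of the centers of the facets. -/
def dualPolytope (P : Set E3) : Set E3 := convexHull ℝ (center '' facets P)

/-! ### Euler cycles -/

open Classical in
/-- How often an Euler cycle runs through each edge: once if every vertex is incident with an even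
number of edges, and otherwise twice, since then all edges are doubled. -/
def edgeMultiplicity (P : Set E3) : ℕ :=
  if ∀ v ∈ vertices P, Even ((edgeGraph P).neighborSet v).ncard then 1 else 2

open Classical in
/-- A closed walk in the vertex-edge graph is an Euler cycle (of the graph with all edges doubled
if there is a vertex of odd degree). -/
def IsEulerCycle (P : Set E3) {v : E3} (w : (edgeGraph P).Walk v v) : Prop :=
  ∀ e ∈ (edgeGraph P).edgeSet, w.edges.count e = edgeMultiplicity P

/-- The edges of `P` and the vertices of `Q`, projected onto the sphere, form a hybrid `s`-design
with balancing factor `β`: there is an Euler cycle of `P`, and for every Euler cycle, the geodesic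
cycle that it induces on the sphere and the projected vertices of `Q` are a hybrid `s`-design. -/
def EdgesVerticesHybrid (P Q : Set E3) (s : ℕ) (β : ℝ) : Prop :=
  (∃ (v : E3) (w : (edgeGraph P).Walk v v), IsEulerCycle P w) ∧
    ∀ (v : E3) (w : (edgeGraph P).Walk v v), IsEulerCycle P w →
      IsHybridDesign s β (chainLength (w.support.map proj)) (geodesicChain (w.support.map proj))
        (proj '' vertices Q)

/-! ### The polytopes -/

/-- All points that arise from `(a, b, c)`, with `a, b, c ≥ 0`, by cyclic permutations of the
coordinates and arbitrary sign changes. -/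
def cyclicSigned (a b c : ℝ) : Set E3 :=
  {x | (|x 0| = a ∧ |x 1| = b ∧ |x 2| = c) ∨ (|x 0| = b ∧ |x 1| = c ∧ |x 2| = a) ∨
    (|x 0| = c ∧ |x 1| = a ∧ |x 2| = b)}

/-- `P` is an origin-centered copy of `S`: the image under an orthogonal map and a scaling. -/
def IsCopyOf (S P : Set E3) : Prop :=
  ∃ (r : ℝ) (O : E3 ≃ₗᵢ[ℝ] E3), 0 < r ∧ P = (fun x => r • O x) '' S

def IsTetrahedron (P : Set E3) : Prop :=
  IsCopyOf (convexHull ℝ {!₂[1, 1, 1], !₂[1, -1, -1], !₂[-1, 1, -1], !₂[-1, -1, 1]}) P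

def IsOctahedron (P : Set E3) : Prop := IsCopyOf (convexHull ℝ (cyclicSigned 1 0 0)) P

def IsCube (P : Set E3) : Prop := IsCopyOf (convexHull ℝ (cyclicSigned 1 1 1)) P

def IsCuboctahedron (P : Set E3) : Prop := IsCopyOf (convexHull ℝ (cyclicSigned 1 1 0)) P

def IsRhombicDodecahedron (P : Set E3) : Prop :=
  IsCopyOf (convexHull ℝ (cyclicSigned 1 1 1 ∪ cyclicSigned 2 0 0)) P

def IsIcosahedron (P : Set E3) : Prop := IsCopyOf (convexHull ℝ (cyclicSigned Real.goldenRatio 1 0)) P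

def IsDodecahedron (P : Set E3) : Prop :=
  IsCopyOf (convexHull ℝ
    (cyclicSigned 1 1 1 ∪ cyclicSigned 0 Real.goldenRatio⁻¹ Real.goldenRatio)) P

def IsIcosidodecahedron (P : Set E3) : Prop :=
  IsCopyOf (convexHull ℝ
    (cyclicSigned 2 0 0 ∪ cyclicSigned 1 Real.goldenRatio Real.goldenRatio⁻¹)) P

def IsRhombicTriacontahedron (P : Set E3) : Prop :=
  IsCopyOf (convexHull ℝ (cyclicSigned Real.goldenRatio 1 0 ∪ cyclicSigned 1 1 1 ∪
    cyclicSigned 0 Real.goldenRatio⁻¹ Real.goldenRatio)) P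

end HybridDesigns

end

open HybridDesigns

open scoped RealInnerProductSpace ContDiff

noncomputable section

namespace HybridDesigns

/-! ### The mean over the sphere -/

/-! Let D be the quadrature error: the hybrid average minus the mean over the sphere. An Euler cycle
runs through all edges equally often, so its normalized path integral is the sum of the arc
integrals over the edges divided by their total length, whatever the cycle is
(`isHybridDesign_of_eulerCycle`). Hence D is a linear functional that depends only on values on the
sphere and is invariant under the symmetries common to the polytope and its facet normals. Such a
functional sees only invariant polynomials, and modulo |x|² = 1 these are spanned, up to degree s,
by 1 and a single further invariant f: the product xyz for the tetrahedral rotations (s = 3), x⁴ +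
y⁴ + z⁴ for the octahedral types (s = 5), and a product of six linear forms for the icosahedral
types (s = 9). Since D(1) = 0 for every β, all that remains is D(f) = 0, one linear equation for β.

The criteria `tetrahedral_vanishing`, `octahedral_vanishing` and `icosahedral_vanishing` establish
this without averaging over groups: invariance under a few generators and the equation of the sphere
give linear relations between the values of D at monomials, and these relations force all of them to
vanish. The mean of f over the sphere comes from the same relations for one more isometry. As f is
constant on the points and has equal integrals over all edges, the equation for β involves one point
and one arc; the arc is placed in a plane where f has an explicit primitive (`arcIntegral_planar`).

The face structure is derived from lists of vertices and facet normals. The decisive property is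
that the cones spanned by the normals at the vertices cover space: every functional is then a
nonnegative combination of normals active at a vertex, and every nonempty exposed face is cut out by
a set of facets (`IsPolytopeData.exists_eq_of_isExposed`). Vertices, edges, facets and the dual
follow. The covering property is local: a vertex that maximizes a functional is not beaten by its
neighbours, and by `exists_cone_coefficients` the functional then lies in the cone at this vertex.
What is left are finitely many equalities and inequalities in ℤ[φ], checked by computation.
Arbitrary size and position are handled by `IsHybridData.isCopyOf_dualPolytope_and_hybrid`, and
Euler cycles exist because the edge graph is connected. -/

/-- A linear isometry equivalence acts on the unit sphere. -/
def sphereHomeo (O : E3 ≃ₗᵢ[ℝ] E3) :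
    Metric.sphere (0 : E3) 1 ≃ₜ Metric.sphere (0 : E3) 1 where
  toFun x := ⟨O x, by simp⟩
  invFun x := ⟨O.symm x, by simp⟩
  left_inv x := by ext; simp
  right_inv x := by ext; simp
  continuous_toFun := by fun_prop
  continuous_invFun := by fun_prop

-- The surface measure of a set is a multiple of the volume of the cone over it, and isometries map
-- cones to cones and preserve volume.
open scoped Pointwise in
theorem sphereHomeo_measurePreserving (O : E3 ≃ₗᵢ[ℝ] E3) :
    MeasureTheory.MeasurePreserving (sphereHomeo O)
      (MeasureTheory.volume : MeasureTheory.Measure E3).toSphere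
      (MeasureTheory.volume : MeasureTheory.Measure E3).toSphere := by
  refine ⟨(sphereHomeo O).continuous.measurable, ?_⟩
  ext s hs
  rw [MeasureTheory.Measure.map_apply (sphereHomeo O).continuous.measurable hs,
    MeasureTheory.Measure.toSphere_apply' _ ((sphereHomeo O).continuous.measurable hs),
    MeasureTheory.Measure.toSphere_apply' _ hs]
  congr 1
  have h : Set.Ioo (0 : ℝ) 1 • ((↑) '' (sphereHomeo O ⁻¹' s) : Set E3) =
      O ⁻¹' (Set.Ioo (0 : ℝ) 1 • ((↑) '' s : Set E3)) := by
    ext x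
    simp only [Set.mem_smul, Set.mem_preimage, Set.mem_image, Subtype.exists, exists_and_right,
      exists_eq_right]
    constructor
    · rintro ⟨r, hr, y, ⟨hy, hys⟩, rfl⟩
      exact ⟨r, hr, O y, ⟨by simpa using hy, hys⟩, by simp⟩
    · rintro ⟨r, hr, y, ⟨hy, hys⟩, h⟩
      refine ⟨r, hr, O.symm y, ⟨by simpa using hy, ?_⟩, ?_⟩
      · have : sphereHomeo O ⟨O.symm y, by simpa using hy⟩ = ⟨y, hy⟩ := by
          ext; simp [sphereHomeo]
        rw [this]; exact hys
      · apply O.injective; simp [h]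
  rw [h]
  exact O.measurePreserving.measure_preimage_equiv (f := O.toHomeomorph.toMeasurableEquiv) _

theorem sphereMean_comp (O : E3 ≃ₗᵢ[ℝ] E3) (f : E3 → ℝ) :
    sphereMean (fun x => f (O x)) = sphereMean f := by
  unfold sphereMean
  rw [MeasureTheory.average_eq, MeasureTheory.average_eq]
  congr 1
  exact (sphereHomeo_measurePreserving O).integral_comp
    (sphereHomeo O).measurableEmbedding (fun x => f x)

theorem integrable_sphere (f : C(E3, ℝ)) :
    MeasureTheory.Integrable (fun x : Metric.sphere (0 : E3) 1 => f x)
      (MeasureTheory.volume : MeasureTheory.Measure E3).toSphere := by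
  refine Continuous.integrable_of_hasCompactSupport (by fun_prop) ?_
  exact HasCompactSupport.of_compactSpace _

/-- The mean over the sphere as a linear functional. -/
def meanFunctional : C(E3, ℝ) →ₗ[ℝ] ℝ where
  toFun f := sphereMean f
  map_add' f g := by
    simp only [sphereMean, MeasureTheory.average_eq, ContinuousMap.add_apply]
    rw [MeasureTheory.integral_add (integrable_sphere f) (integrable_sphere g), smul_add]
  map_smul' c f := by
    simp only [sphereMean, MeasureTheory.average_eq, ContinuousMap.smul_apply, RingHom.id_apply]
    rw [MeasureTheory.integral_smul, smul_comm]

theorem meanFunctional_one : meanFunctional 1 = 1 := by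
  have : NeZero (MeasureTheory.volume : MeasureTheory.Measure E3).toSphere :=
    ⟨MeasureTheory.Measure.toSphere_ne_zero _⟩
  exact MeasureTheory.average_const _ _

theorem sphereMean_congr {f g : E3 → ℝ} (h : ∀ x ∈ Metric.sphere (0 : E3) 1, f x = g x) :
    sphereMean f = sphereMean g := by
  unfold sphereMean
  congr 1
  ext x
  exact h x x.2

/-! ### Linear functionals invariant under isometries -/

/-- Invariance of a functional under an isometry. -/
def IsInvariant (D : C(E3, ℝ) →ₗ[ℝ] ℝ) (O : E3 ≃ₗᵢ[ℝ] E3) : Prop :=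
  ∀ f : C(E3, ℝ), D (f.comp ⟨O, O.continuous⟩) = D f

/-- The functional depends only on the values on the sphere. -/
def IsSpherical (D : C(E3, ℝ) →ₗ[ℝ] ℝ) : Prop :=
  ∀ f g : C(E3, ℝ), (∀ x ∈ Metric.sphere (0 : E3) 1, f x = g x) → D f = D g

theorem meanFunctional_isInvariant (O : E3 ≃ₗᵢ[ℝ] E3) : IsInvariant meanFunctional O :=
  fun f => sphereMean_comp O f

theorem meanFunctional_isSpherical : IsSpherical meanFunctional :=
  fun _ _ h => sphereMean_congr h

/-- A norm-preserving linear map of three-space is an isometry equivalence. -/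
def mkIso (f : E3 →ₗ[ℝ] E3) (h : ∀ x, ‖f x‖ = ‖x‖) : E3 ≃ₗᵢ[ℝ] E3 :=
  (LinearIsometry.mk f h).toLinearIsometryEquiv rfl

@[simp] theorem mkIso_apply (f : E3 →ₗ[ℝ] E3) (h : ∀ x, ‖f x‖ = ‖x‖) (x : E3) :
    mkIso f h x = f x := rfl

theorem norm_sq_E3 (x : E3) : ‖x‖ ^ 2 = x 0 ^ 2 + x 1 ^ 2 + x 2 ^ 2 := by
  rw [EuclideanSpace.norm_sq_eq]; simp [Fin.sum_univ_three]

theorem norm_eq_of_sq {x y : E3}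
    (h : x 0 ^ 2 + x 1 ^ 2 + x 2 ^ 2 = y 0 ^ 2 + y 1 ^ 2 + y 2 ^ 2) : ‖x‖ = ‖y‖ := by
  rw [← norm_sq_E3, ← norm_sq_E3] at h
  exact (pow_left_inj₀ (norm_nonneg _) (norm_nonneg _) two_ne_zero).1 h

theorem sq_sum_of_mem_sphere {x : E3} (hx : x ∈ Metric.sphere (0 : E3) 1) :
    x 0 ^ 2 + x 1 ^ 2 + x 2 ^ 2 = 1 := by
  rw [← norm_sq_E3, mem_sphere_zero_iff_norm.1 hx, one_pow]

/-- The linear map with the given matrix. -/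
def linMap (a₀ a₁ a₂ b₀ b₁ b₂ c₀ c₁ c₂ : ℝ) : E3 →ₗ[ℝ] E3 where
  toFun x := !₂[a₀ * x 0 + a₁ * x 1 + a₂ * x 2, b₀ * x 0 + b₁ * x 1 + b₂ * x 2,
    c₀ * x 0 + c₁ * x 1 + c₂ * x 2]
  map_add' x y := by ext i; fin_cases i <;> simp <;> ring
  map_smul' r x := by ext i; fin_cases i <;> simp <;> ring

/-- Change of the signs of two coordinates. -/
def flipYZ : E3 ≃ₗᵢ[ℝ] E3 := mkIso (linMap 1 0 0 0 (-1) 0 0 0 (-1)) fun x =>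
  norm_eq_of_sq (by simp [linMap])

/-- Change of the sign of the first coordinate. -/
def flipX : E3 ≃ₗᵢ[ℝ] E3 := mkIso (linMap (-1) 0 0 0 1 0 0 0 1) fun x =>
  norm_eq_of_sq (by simp [linMap])

/-- Cyclic permutation of the coordinates. -/
def cyc : E3 ≃ₗᵢ[ℝ] E3 := mkIso (linMap 0 1 0 0 0 1 1 0 0) fun x =>
  norm_eq_of_sq (by simp [linMap]; ring)

/-- Rotation by a right angle divided by two. -/
def rot45 : E3 ≃ₗᵢ[ℝ] E3 := mkIso (linMap (√2 / 2) (√2 / 2) 0 (√2 / 2) (-(√2 / 2)) 0 0 0 1) fun x =>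
  norm_eq_of_sq (by
    have h : √2 ^ 2 = 2 := Real.sq_sqrt (by norm_num)
    simp [linMap]; linear_combination (x 0 ^ 2 + x 1 ^ 2) / 2 * h)

/-- A reflection in a mirror plane of the icosahedron. -/
def icoReflection : E3 ≃ₗᵢ[ℝ] E3 :=
  mkIso (linMap (1 / 2) (-(Real.goldenRatio / 2)) (-((Real.goldenRatio - 1) / 2))
    (-(Real.goldenRatio / 2)) (-((Real.goldenRatio - 1) / 2)) (-(1 / 2))
    (-((Real.goldenRatio - 1) / 2)) (-(1 / 2)) (Real.goldenRatio / 2)) fun x =>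
  norm_eq_of_sq (by
    have h : Real.goldenRatio ^ 2 = Real.goldenRatio + 1 := Real.goldenRatio_sq
    simp [linMap]
    linear_combination (x 0 ^ 2 + x 1 ^ 2 + x 2 ^ 2 + x 0 * x 1 - x 0 * x 2 + x 1 * x 2) / 2 * h)

@[simp] theorem linMap_apply_zero (a₀ a₁ a₂ b₀ b₁ b₂ c₀ c₁ c₂ : ℝ) (x : E3) :
    linMap a₀ a₁ a₂ b₀ b₁ b₂ c₀ c₁ c₂ x 0 = a₀ * x 0 + a₁ * x 1 + a₂ * x 2 := rfl

@[simp] theorem linMap_apply_one (a₀ a₁ a₂ b₀ b₁ b₂ c₀ c₁ c₂ : ℝ) (x : E3) :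
    linMap a₀ a₁ a₂ b₀ b₁ b₂ c₀ c₁ c₂ x 1 = b₀ * x 0 + b₁ * x 1 + b₂ * x 2 := rfl

@[simp] theorem linMap_apply_two (a₀ a₁ a₂ b₀ b₁ b₂ c₀ c₁ c₂ : ℝ) (x : E3) :
    linMap a₀ a₁ a₂ b₀ b₁ b₂ c₀ c₁ c₂ x 2 = c₀ * x 0 + c₁ * x 1 + c₂ * x 2 := rfl

/-- The monomials as continuous functions. -/
def mono (a b c : ℕ) : C(E3, ℝ) := ⟨fun x => x 0 ^ a * x 1 ^ b * x 2 ^ c, by fun_prop⟩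

@[simp] theorem mono_apply (a b c : ℕ) (x : E3) : mono a b c x = x 0 ^ a * x 1 ^ b * x 2 ^ c := rfl

section Functional

variable {D : C(E3, ℝ) →ₗ[ℝ] ℝ}

theorem IsInvariant.mono_cyc (hD : IsInvariant D cyc) (a b c : ℕ) :
    D (mono a b c) = D (mono b c a) := by
  rw [← hD (mono b c a)]
  congr 1; ext x; simp [cyc]; ring

theorem IsInvariant.mono_flipYZ (hD : IsInvariant D flipYZ) {a b c : ℕ} (h : Odd (b + c)) :
    D (mono a b c) = 0 := by
  have h1 := hD (mono a b c)
  have h2 : (mono a b c).comp ⟨flipYZ, flipYZ.continuous⟩ = -mono a b c := by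
    ext x
    have : (-1 : ℝ) ^ b * (-1) ^ c = -1 := by rw [← pow_add]; exact h.neg_one_pow
    simp [flipYZ]
    rw [neg_pow (x.ofLp 1), neg_pow (x.ofLp 2)]
    linear_combination x 0 ^ a * x 1 ^ b * x 2 ^ c * this
  rw [h2, map_neg] at h1
  linarith

theorem IsInvariant.mono_flipX (hD : IsInvariant D flipX) {a b c : ℕ} (h : Odd a) :
    D (mono a b c) = 0 := by
  have h1 := hD (mono a b c)
  have h2 : (mono a b c).comp ⟨flipX, flipX.continuous⟩ = -mono a b c := by
    ext x
    simp [flipX, h.neg_pow]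
  rw [h2, map_neg] at h1
  linarith

/-- Multiplication by |x|², which is one on the sphere. This is the only link between moments of
different degrees. -/
theorem IsSpherical.mono_succ (hD : IsSpherical D) (a b c : ℕ) :
    D (mono a b c) = D (mono (a + 2) b c) + D (mono a (b + 2) c) + D (mono a b (c + 2)) := by
  rw [← map_add, ← map_add]
  refine hD _ _ fun x hx => ?_
  have := sq_sum_of_mem_sphere hx
  simp
  linear_combination -(x 0 ^ a * x 1 ^ b * x 2 ^ c) * this

end Functional

/-! ### Invariant polynomials and vanishing criteria -/

/-- The sum of the fourth powers of the coordinates. -/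
def octInv : C(E3, ℝ) := ⟨fun x => x 0 ^ 4 + x 1 ^ 4 + x 2 ^ 4, by fun_prop⟩

/-- The invariant of degree six of the icosahedral group, divided by a power of the golden ratio
that makes its coefficients simple. -/
def icoInv : C(E3, ℝ) :=
  ⟨fun x => (Real.goldenRatio ^ 2 * x 0 ^ 2 - x 1 ^ 2) * (Real.goldenRatio ^ 2 * x 1 ^ 2 - x 2 ^ 2) *
    (Real.goldenRatio ^ 2 * x 2 ^ 2 - x 0 ^ 2), by fun_prop⟩

theorem octInv_eq : octInv = mono 4 0 0 + mono 0 4 0 + mono 0 0 4 := by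
  ext x; simp [octInv]

theorem icoInv_eq : icoInv = (8 * Real.goldenRatio + 4) • mono 2 2 2
    - (3 * Real.goldenRatio + 2) • (mono 4 2 0 + mono 0 4 2 + mono 2 0 4)
    + (Real.goldenRatio + 1) • (mono 2 4 0 + mono 0 2 4 + mono 4 0 2) := by
  have h : Real.goldenRatio ^ 2 = Real.goldenRatio + 1 := Real.goldenRatio_sq
  have h4 : Real.goldenRatio ^ 4 = 3 * Real.goldenRatio + 2 := by
    linear_combination (Real.goldenRatio ^ 2 + Real.goldenRatio + 2) * h
  have h6 : Real.goldenRatio ^ 6 = 8 * Real.goldenRatio + 5 := by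
    linear_combination (Real.goldenRatio ^ 2) * h4 +
      (3 * Real.goldenRatio + 5) * h
  ext x
  simp only [icoInv, ContinuousMap.coe_mk, ContinuousMap.add_apply, ContinuousMap.sub_apply,
    ContinuousMap.smul_apply, mono_apply, smul_eq_mul]
  generalize Real.goldenRatio = p at *
  linear_combination (x 0 ^ 2 * x 1 ^ 2 * x 2 ^ 2) * h6
    - (x 0 ^ 4 * x 1 ^ 2 + x 1 ^ 4 * x 2 ^ 2 + x 2 ^ 4 * x 0 ^ 2) * h4
    + (x 0 ^ 2 * x 1 ^ 4 + x 1 ^ 2 * x 2 ^ 4 + x 2 ^ 2 * x 0 ^ 4) * h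

theorem meanFunctional_mono_flip (a b c : ℕ) (h : Odd a ∨ Odd b ∨ Odd c) :
    meanFunctional (mono a b c) = 0 := by
  have hf := meanFunctional_isInvariant flipX
  have hc := meanFunctional_isInvariant cyc
  rcases h with h | h | h
  · exact hf.mono_flipX h
  · rw [hc.mono_cyc]; exact hf.mono_flipX h
  · rw [hc.mono_cyc, hc.mono_cyc]; exact hf.mono_flipX h

/-- The isometry `rot45` turns x⁴ into (x + y)⁴/4; equality of the means gives M(x⁴) = 3 M(x²y²),
and the equation of the sphere fixes the scale. No integral is evaluated. -/
theorem meanFunctional_fourth :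
    meanFunctional (mono 4 0 0) = 1 / 5 ∧ meanFunctional (mono 2 2 0) = 1 / 15 := by
  have hc := meanFunctional_isInvariant cyc
  have hs := meanFunctional_isSpherical
  have h0 : meanFunctional (mono 0 0 0) = 1 := by
    rw [← meanFunctional_one]; congr 1; ext; simp
  have hr := meanFunctional_isInvariant rot45 (mono 4 0 0)
  have e : (mono 4 0 0).comp ⟨rot45, rot45.continuous⟩ = (1 / 4 : ℝ) • mono 4 0 0 + mono 3 1 0
      + (3 / 2 : ℝ) • mono 2 2 0 + mono 1 3 0 + (1 / 4 : ℝ) • mono 0 4 0 := by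
    ext x
    have h : √2 ^ 2 = 2 := Real.sq_sqrt (by norm_num)
    have h4 : √2 ^ 4 = 4 := by linear_combination (√2 ^ 2 + 2) * h
    simp [rot45]
    linear_combination (x 0 + x 1) ^ 4 / 16 * h4
  rw [e] at hr
  simp only [map_add, map_smul, smul_eq_mul] at hr
  rw [meanFunctional_mono_flip 3 1 0 (by decide), meanFunctional_mono_flip 1 3 0 (by decide),
    hc.mono_cyc 0 4 0] at hr
  have h1 := hs.mono_succ 0 0 0
  have h2 := hs.mono_succ 2 0 0
  simp only [zero_add, Nat.reduceAdd] at h1 h2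
  rw [hc.mono_cyc 0 2 0, hc.mono_cyc 0 0 2, hc.mono_cyc 0 2 0] at h1
  rw [hc.mono_cyc 2 0 2, hc.mono_cyc 0 2 2] at h2
  constructor <;> linarith

theorem meanFunctional_octInv : meanFunctional octInv = 3 / 5 := by
  have hc := meanFunctional_isInvariant cyc
  rw [octInv_eq, map_add, map_add, hc.mono_cyc 0 4 0, hc.mono_cyc 0 0 4, hc.mono_cyc 0 4 0,
    meanFunctional_fourth.1]
  norm_num

/-- Applied to x²y²z² and x⁴z², the isometry `rot45` shows that both cyclic classes of x⁴y² have
three times the mean of x²y²z². The scale comes from the fourth moments through the equation of the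
sphere. -/
theorem meanFunctional_icoInv : meanFunctional icoInv = -(2 * Real.goldenRatio + 1) / 21 := by
  have hc := meanFunctional_isInvariant cyc
  have hs := meanFunctional_isSpherical
  have h : √2 ^ 2 = 2 := Real.sq_sqrt (by norm_num)
  have h4 : √2 ^ 4 = 4 := by linear_combination (√2 ^ 2 + 2) * h
  have hr := meanFunctional_isInvariant rot45 (mono 2 2 2)
  have e : (mono 2 2 2).comp ⟨rot45, rot45.continuous⟩ = (1 / 4 : ℝ) • mono 4 0 2 -
      (1 / 2 : ℝ) • mono 2 2 2 + (1 / 4 : ℝ) • mono 0 4 2 := by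
    ext x
    simp [rot45]
    linear_combination (x 0 ^ 2 - x 1 ^ 2) ^ 2 * x 2 ^ 2 / 16 * h4
  have hr' := meanFunctional_isInvariant rot45 (mono 4 0 2)
  have e' : (mono 4 0 2).comp ⟨rot45, rot45.continuous⟩ = (1 / 4 : ℝ) • mono 4 0 2 + mono 3 1 2
      + (3 / 2 : ℝ) • mono 2 2 2 + mono 1 3 2 + (1 / 4 : ℝ) • mono 0 4 2 := by
    ext x
    simp [rot45]
    linear_combination (x 0 + x 1) ^ 4 * x 2 ^ 2 / 16 * h4
  rw [e] at hr
  rw [e'] at hr'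
  simp only [map_add, map_sub, map_smul, smul_eq_mul] at hr hr'
  rw [meanFunctional_mono_flip 3 1 2 (by decide), meanFunctional_mono_flip 1 3 2 (by decide)] at hr'
  rw [hc.mono_cyc 0 4 2] at hr hr'
  have h1 := hs.mono_succ 2 2 0
  simp only [zero_add, Nat.reduceAdd] at h1
  rw [meanFunctional_fourth.2, hc.mono_cyc 2 4 0, hc.mono_cyc 4 0 2] at h1
  rw [icoInv_eq]
  simp only [map_add, map_sub, map_smul, smul_eq_mul]
  rw [hc.mono_cyc 0 4 2, hc.mono_cyc 2 0 4, hc.mono_cyc 0 4 2, hc.mono_cyc 2 4 0, hc.mono_cyc 4 0 2]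
  rw [hc.mono_cyc 4 0 2] at hr hr'
  have h3 : meanFunctional (mono 4 2 0) = 1 / 35 := by linarith
  have h5 : meanFunctional (mono 0 2 4) = 1 / 35 := by linarith
  have h6 : meanFunctional (mono 2 2 2) = 1 / 105 := by linarith
  rw [h3, h5, h6]
  ring

/-! ### Vanishing criteria for the tetrahedral and octahedral symmetries. -/

section Vanishing

variable {D : C(E3, ℝ) →ₗ[ℝ] ℝ}

theorem IsSpherical.second_eq_zero (hs : IsSpherical D) (hc : IsInvariant D cyc)
    (h1 : D (mono 0 0 0) = 0) : D (mono 2 0 0) = 0 := by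
  have h := hs.mono_succ 0 0 0
  simp only [zero_add] at h
  rw [hc.mono_cyc 0 2 0, hc.mono_cyc 0 0 2, hc.mono_cyc 0 2 0] at h
  linarith

/-- The tetrahedral criterion for degree three. -/
theorem tetrahedral_vanishing (hs : IsSpherical D) (hc : IsInvariant D cyc)
    (hf : IsInvariant D flipYZ) (h1 : D (mono 0 0 0) = 0) (h3 : D (mono 1 1 1) = 0)
    (a b c : ℕ) (h : a + b + c ≤ 3) : D (mono a b c) = 0 := by
  have h2 := hs.second_eq_zero hc h1
  by_cases hbc : Odd (b + c)
  · exact hf.mono_flipYZ hbc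
  by_cases hca : Odd (c + a)
  · rw [hc.mono_cyc]; exact hf.mono_flipYZ hca
  by_cases hab : Odd (a + b)
  · rw [hc.mono_cyc, hc.mono_cyc]; exact hf.mono_flipYZ hab
  have ha : a ≤ 3 := by omega
  have hb : b ≤ 3 := by omega
  have hcc : c ≤ 3 := by omega
  -- All three exponents now have the same parity, which leaves 1, the squares of the coordinates
  -- and xyz.
  interval_cases a <;> interval_cases b <;> interval_cases c <;>
    first
    | (exfalso; omega)
    | (exfalso; revert hbc hca hab; decide)
    | assumption
    | (rw [hc.mono_cyc]; assumption)
    | (rw [hc.mono_cyc, hc.mono_cyc]; assumption)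

/-- A functional invariant under all sign changes and cyclic permutations is determined by the
monomials with even exponents. -/
theorem even_vanishing (hc : IsInvariant D cyc) (hf : IsInvariant D flipX) {n : ℕ}
    (H : ∀ i j k : ℕ, i + j + k ≤ n → D (mono (2 * i) (2 * j) (2 * k)) = 0)
    (a b c : ℕ) (h : a + b + c ≤ 2 * n + 1) : D (mono a b c) = 0 := by
  rcases Nat.even_or_odd a with ha | ha
  · rcases Nat.even_or_odd b with hb | hb
    · rcases Nat.even_or_odd c with hcc | hcc
      · obtain ⟨i, rfl⟩ := ha
        obtain ⟨j, rfl⟩ := hb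
        obtain ⟨k, rfl⟩ := hcc
        rw [← two_mul, ← two_mul, ← two_mul]
        exact H i j k (by omega)
      · rw [hc.mono_cyc, hc.mono_cyc]; exact hf.mono_flipX hcc
    · rw [hc.mono_cyc]; exact hf.mono_flipX hb
  · exact hf.mono_flipX ha

/-- The octahedral criterion for degree five. -/
theorem octahedral_vanishing (hs : IsSpherical D) (hc : IsInvariant D cyc)
    (hf : IsInvariant D flipX) (h1 : D (mono 0 0 0) = 0) (h4 : D octInv = 0)
    (a b c : ℕ) (h : a + b + c ≤ 5) : D (mono a b c) = 0 := by
  have h2 := hs.second_eq_zero hc h1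
  have h40 : D (mono 4 0 0) = 0 := by
    rw [octInv_eq, map_add, map_add, hc.mono_cyc 0 4 0, hc.mono_cyc 0 0 4, hc.mono_cyc 0 4 0] at h4
    linarith
  -- From x² = x⁴ + x²y² + x²z² on the sphere, where the last two terms have equal values by cyclic
  -- symmetry.
  have h22 : D (mono 2 2 0) = 0 := by
    have := hs.mono_succ 2 0 0
    simp only [zero_add, Nat.reduceAdd] at this
    rw [hc.mono_cyc 2 0 2, hc.mono_cyc 0 2 2] at this
    linarith
  refine even_vanishing hc hf (n := 2) (fun i j k hijk => ?_) a b c h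
  have hi : i ≤ 2 := by omega
  have hj : j ≤ 2 := by omega
  have hk : k ≤ 2 := by omega
  interval_cases i <;> interval_cases j <;> interval_cases k <;>
    first
    | (exfalso; omega)
    | assumption
    | (rw [hc.mono_cyc]; assumption)
    | (rw [hc.mono_cyc, hc.mono_cyc]; assumption)

/-- Averaging over the sign changes of two coordinates. -/
theorem IsInvariant.sign_average (hc : IsInvariant D cyc) (hf : IsInvariant D flipX)
    (F : C(E3, ℝ)) : 4 * D F = D ⟨fun x => F !₂[x 0, x 1, x 2] + F !₂[x 0, -x 1, x 2] +
      F !₂[x 0, x 1, -x 2] + F !₂[x 0, -x 1, -x 2], by fun_prop⟩ := by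
  have e (G : C(E3, ℝ)) : D ⟨fun x => G !₂[x 0, x 1, -x 2], by fun_prop⟩ = D G := by
    have h1 : D ((((G.comp ⟨cyc, cyc.continuous⟩).comp ⟨flipX, flipX.continuous⟩).comp
      ⟨cyc, cyc.continuous⟩).comp ⟨cyc, cyc.continuous⟩) = D G := by rw [hc, hc, hf, hc]
    rw [← h1]; congr 1; ext x; simp only [ContinuousMap.coe_mk, ContinuousMap.comp_apply]
    congr 1; ext i; fin_cases i <;> simp [cyc, flipX]
  have e' (G : C(E3, ℝ)) : D ⟨fun x => G !₂[x 0, -x 1, x 2], by fun_prop⟩ = D G := by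
    have h1 : D ((((G.comp ⟨cyc, cyc.continuous⟩).comp ⟨cyc, cyc.continuous⟩).comp
      ⟨flipX, flipX.continuous⟩).comp ⟨cyc, cyc.continuous⟩) = D G := by rw [hc, hf, hc, hc]
    rw [← h1]; congr 1; ext x; simp only [ContinuousMap.coe_mk, ContinuousMap.comp_apply]
    congr 1; ext i; fin_cases i <;> simp [cyc, flipX]
  have e1 : D ⟨fun x => F !₂[x 0, x 1, x 2], by fun_prop⟩ = D F := by
    congr 1; ext x; simp only [ContinuousMap.coe_mk]; congr 1; ext i; fin_cases i <;> rfl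
  have e2 := e' F
  have e3 := e F
  have e4 := e' ⟨fun x => F !₂[x 0, x 1, -x 2], by fun_prop⟩
  rw [e3] at e4
  have : 4 * D F = D (⟨fun x => F !₂[x 0, x 1, x 2], by fun_prop⟩ +
      ⟨fun x => F !₂[x 0, -x 1, x 2], by fun_prop⟩ + ⟨fun x => F !₂[x 0, x 1, -x 2], by fun_prop⟩ +
      ⟨fun x => F !₂[x 0, -x 1, -x 2], by fun_prop⟩) := by
    rw [map_add, map_add, map_add, e1, e2, e3]
    simp only [ContinuousMap.coe_mk] at e4
    have e5 : D ⟨fun x => F !₂[x 0, -x 1, -x 2], by fun_prop⟩ = D F := by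
      rw [← e4]; rfl
    rw [e5]; ring
  rw [this]; rfl

end Vanishing

/-! ### The vanishing criterion for the icosahedral symmetries. -/

section IcosahedralVanishing

variable {D : C(E3, ℝ) →ₗ[ℝ] ℝ}

/-- The reflection sends x to half of x − φy − (φ − 1)z. The factor 2ⁿ clears this denominator and 4
counts the sign patterns. Averaging over signs first removes every monomial with an odd exponent in
y or z from the expansions to come. -/
theorem IsInvariant.reflection_pow (hc : IsInvariant D cyc) (hf : IsInvariant D flipX)
    (hr : IsInvariant D icoReflection) (n : ℕ) :
    4 * 2 ^ n * D (mono n 0 0) = D ⟨fun x =>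
      (x 0 - Real.goldenRatio * x 1 - (Real.goldenRatio - 1) * x 2) ^ n +
      (x 0 + Real.goldenRatio * x 1 - (Real.goldenRatio - 1) * x 2) ^ n +
      (x 0 - Real.goldenRatio * x 1 + (Real.goldenRatio - 1) * x 2) ^ n +
      (x 0 + Real.goldenRatio * x 1 + (Real.goldenRatio - 1) * x 2) ^ n, by fun_prop⟩ := by
  have h := hc.sign_average hf ((mono n 0 0).comp ⟨icoReflection, icoReflection.continuous⟩)
  rw [hr] at h
  rw [mul_right_comm, h, mul_comm, ← smul_eq_mul, ← map_smul]
  congr 1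
  ext x
  simp [icoReflection, mul_add, ← mul_pow]
  congr 1
  · congr 1
    · congr 1 <;> congr 1 <;> ring
    · congr 1; ring
  · congr 1; ring

theorem goldenRatio_powers : Real.goldenRatio ^ 2 = Real.goldenRatio + 1 ∧
    Real.goldenRatio ^ 4 = 3 * Real.goldenRatio + 2 ∧
    Real.goldenRatio ^ 6 = 8 * Real.goldenRatio + 5 ∧
    Real.goldenRatio ^ 8 = 21 * Real.goldenRatio + 13 ∧
    (Real.goldenRatio - 1) ^ 2 = 2 - Real.goldenRatio ∧
    (Real.goldenRatio - 1) ^ 4 = 5 - 3 * Real.goldenRatio ∧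
    (Real.goldenRatio - 1) ^ 6 = 13 - 8 * Real.goldenRatio ∧
    (Real.goldenRatio - 1) ^ 8 = 34 - 21 * Real.goldenRatio := by
  have h : Real.goldenRatio ^ 2 = Real.goldenRatio + 1 := Real.goldenRatio_sq
  generalize Real.goldenRatio = p at *
  have h4 : p ^ 4 = 3 * p + 2 := by linear_combination (p ^ 2 + p + 2) * h
  have h6 : p ^ 6 = 8 * p + 5 := by linear_combination p ^ 2 * h4 + (3 * p + 5) * h
  have h8 : p ^ 8 = 21 * p + 13 := by linear_combination p ^ 2 * h6 + (8 * p + 13) * h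
  have q2 : (p - 1) ^ 2 = 2 - p := by linear_combination h
  have q4 : (p - 1) ^ 4 = 5 - 3 * p := by
    linear_combination ((p - 1) ^ 2 + 2 - p) * q2 + h
  have q6 : (p - 1) ^ 6 = 13 - 8 * p := by
    linear_combination (p - 1) ^ 2 * q4 + (5 - 3 * p) * q2 + 3 * h
  have q8 : (p - 1) ^ 8 = 34 - 21 * p := by
    linear_combination ((p - 1) ^ 4 + 5 - 3 * p) * q4 + 9 * h
  exact ⟨h, h4, h6, h8, q2, q4, q6, q8⟩

/-- The same relation as for the mean over the sphere: in degree four, the icosahedral group has no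
invariant besides the square of |x|². -/
theorem IsInvariant.reflection_fourth (hc : IsInvariant D cyc) (hf : IsInvariant D flipX)
    (hr : IsInvariant D icoReflection) : D (mono 4 0 0) = 3 * D (mono 2 2 0) := by
  have h := hc.reflection_pow hf hr 4
  have e (p q : ℝ) : (⟨fun x => (x 0 - p * x 1 - q * x 2) ^ 4 + (x 0 + p * x 1 - q * x 2) ^ 4 +
      (x 0 - p * x 1 + q * x 2) ^ 4 + (x 0 + p * x 1 + q * x 2) ^ 4, by fun_prop⟩ : C(E3, ℝ)) =
      (4 : ℝ) • (mono 4 0 0 + p ^ 4 • mono 0 4 0 + q ^ 4 • mono 0 0 4 + (6 * p ^ 2) • mono 2 2 0 +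
        (6 * q ^ 2) • mono 2 0 2 + (6 * (p ^ 2 * q ^ 2)) • mono 0 2 2) := by
    ext x; simp; ring
  rw [e] at h
  simp only [map_add, map_smul, smul_eq_mul] at h
  rw [hc.mono_cyc 0 4 0, hc.mono_cyc 0 0 4, hc.mono_cyc 0 4 0, hc.mono_cyc 2 0 2,
    hc.mono_cyc 0 2 2] at h
  obtain ⟨p2, p4, p6, p8, q2, q4, q6, q8⟩ := goldenRatio_powers
  rw [p4, q4, p2, q2] at h
  linear_combination h / 32 - D (mono 2 2 0) * 3 / 4 * p2

/-- In degree six the reflection does not determine the moments, as there is a new invariant. The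
relation leaves one degree of freedom, which `icoInv` removes. -/
theorem IsInvariant.reflection_sixth (hc : IsInvariant D cyc) (hf : IsInvariant D flipX)
    (hr : IsInvariant D icoReflection) :
    64 * D (mono 6 0 0) = 19 * D (mono 6 0 0) + 15 * (7 - Real.goldenRatio) * D (mono 4 2 0) +
      15 * (6 + Real.goldenRatio) * D (mono 2 4 0) + 90 * D (mono 2 2 2) := by
  have h := hc.reflection_pow hf hr 6
  have e (p q : ℝ) : (⟨fun x => (x 0 - p * x 1 - q * x 2) ^ 6 + (x 0 + p * x 1 - q * x 2) ^ 6 +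
      (x 0 - p * x 1 + q * x 2) ^ 6 + (x 0 + p * x 1 + q * x 2) ^ 6, by fun_prop⟩ : C(E3, ℝ)) =
      (4 : ℝ) • (mono 6 0 0 + p ^ 6 • mono 0 6 0 + q ^ 6 • mono 0 0 6 + (15 * p ^ 2) • mono 4 2 0 +
        (15 * q ^ 4) • mono 2 0 4 + (15 * (p ^ 4 * q ^ 2)) • mono 0 4 2 +
        (15 * q ^ 2) • mono 4 0 2 + (15 * p ^ 4) • mono 2 4 0 +
        (15 * (p ^ 2 * q ^ 4)) • mono 0 2 4 + (90 * (p ^ 2 * q ^ 2)) • mono 2 2 2) := by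
    ext x; simp; ring
  rw [e] at h
  simp only [map_add, map_smul, smul_eq_mul] at h
  rw [hc.mono_cyc 0 6 0, hc.mono_cyc 0 0 6, hc.mono_cyc 0 6 0, hc.mono_cyc 2 0 4,
    hc.mono_cyc 0 4 2, hc.mono_cyc 4 0 2, hc.mono_cyc 0 2 4] at h
  obtain ⟨p2, p4, p6, p8, q2, q4, q6, q8⟩ := goldenRatio_powers
  rw [p4, q4, p2, q2, p6, q6] at h
  generalize Real.goldenRatio = p at *
  linear_combination h / 4 -
    (45 * D (mono 4 2 0) + 45 * D (mono 2 4 0) + 90 * D (mono 2 2 2)) * p2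

theorem IsInvariant.reflection_eighth (hc : IsInvariant D cyc) (hf : IsInvariant D flipX)
    (hr : IsInvariant D icoReflection) :
    256 * D (mono 8 0 0) = 48 * D (mono 8 0 0) + 28 * (16 - 4 * Real.goldenRatio) * D (mono 6 2 0)
      + 28 * (12 + 4 * Real.goldenRatio) * D (mono 2 6 0) + 560 * D (mono 4 4 0) +
      420 * (Real.goldenRatio + 1) * D (mono 2 4 2) +
      420 * (2 - Real.goldenRatio) * D (mono 2 2 4) + 420 * D (mono 4 2 2) := by
  have h := hc.reflection_pow hf hr 8
  have e (p q : ℝ) : (⟨fun x => (x 0 - p * x 1 - q * x 2) ^ 8 + (x 0 + p * x 1 - q * x 2) ^ 8 +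
      (x 0 - p * x 1 + q * x 2) ^ 8 + (x 0 + p * x 1 + q * x 2) ^ 8, by fun_prop⟩ : C(E3, ℝ)) =
      (4 : ℝ) • (mono 8 0 0 + p ^ 8 • mono 0 8 0 + q ^ 8 • mono 0 0 8 + (28 * p ^ 2) • mono 6 2 0 +
        (28 * q ^ 6) • mono 2 0 6 + (28 * (p ^ 6 * q ^ 2)) • mono 0 6 2 +
        (28 * q ^ 2) • mono 6 0 2 + (28 * p ^ 6) • mono 2 6 0 +
        (28 * (p ^ 2 * q ^ 6)) • mono 0 2 6 + (70 * p ^ 4) • mono 4 4 0 +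
        (70 * q ^ 4) • mono 4 0 4 + (70 * (p ^ 4 * q ^ 4)) • mono 0 4 4 +
        (420 * (p ^ 2 * q ^ 2)) • mono 4 2 2 + (420 * (p ^ 4 * q ^ 2)) • mono 2 4 2 +
        (420 * (p ^ 2 * q ^ 4)) • mono 2 2 4) := by
    ext x; simp; ring
  rw [e] at h
  simp only [map_add, map_smul, smul_eq_mul] at h
  rw [hc.mono_cyc 0 8 0, hc.mono_cyc 0 0 8, hc.mono_cyc 0 8 0, hc.mono_cyc 2 0 6,
    hc.mono_cyc 0 6 2, hc.mono_cyc 6 0 2, hc.mono_cyc 0 2 6, hc.mono_cyc 4 0 4,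
    hc.mono_cyc 0 4 4] at h
  obtain ⟨p2, p4, p6, p8, q2, q4, q6, q8⟩ := goldenRatio_powers
  rw [p4, q4, p2, q2, p6, q6, p8, q8] at h
  generalize Real.goldenRatio = p at *
  linear_combination h / 4 - (28 * 8 * D (mono 6 2 0) + 28 * 8 * D (mono 2 6 0) +
    70 * 9 * D (mono 4 4 0) + 420 * D (mono 4 2 2) + 420 * 3 * D (mono 2 4 2) +
    420 * 3 * D (mono 2 2 4)) * p2

/-- The icosahedral criterion for degree nine. -/
theorem icosahedral_vanishing (hs : IsSpherical D) (hc : IsInvariant D cyc)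
    (hf : IsInvariant D flipX) (hr : IsInvariant D icoReflection) (h1 : D (mono 0 0 0) = 0)
    (h6 : D icoInv = 0) (a b c : ℕ) (h : a + b + c ≤ 9) : D (mono a b c) = 0 := by
  have h2 := hs.second_eq_zero hc h1
  have r4 := hc.reflection_fourth hf hr
  have s4 := hs.mono_succ 2 0 0
  simp only [zero_add, Nat.reduceAdd] at s4
  rw [hc.mono_cyc 2 0 2, hc.mono_cyc 0 2 2] at s4
  have h40 : D (mono 4 0 0) = 0 := by linarith
  have h22 : D (mono 2 2 0) = 0 := by linarith
  have r6 := hc.reflection_sixth hf hr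
  have s6 := hs.mono_succ 4 0 0
  have s6' := hs.mono_succ 2 2 0
  simp only [zero_add, Nat.reduceAdd] at s6 s6'
  rw [hc.mono_cyc 4 0 2, hc.mono_cyc 0 2 4] at s6
  rw [icoInv_eq] at h6
  simp only [map_add, map_sub, map_smul, smul_eq_mul] at h6
  rw [hc.mono_cyc 0 4 2, hc.mono_cyc 2 0 4, hc.mono_cyc 0 4 2, hc.mono_cyc 0 2 4,
    hc.mono_cyc 4 0 2, hc.mono_cyc 0 2 4] at h6
  have p2 : Real.goldenRatio ^ 2 = Real.goldenRatio + 1 := Real.goldenRatio_sq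
  have ppos := Real.goldenRatio_pos
  -- By the equation of the sphere, all sextic moments are combinations of those of x⁶ and x⁴y². The
  -- reflection and the vanishing at `icoInv` give two equations for these two unknowns.
  have e1 : D (mono 6 0 0) * (3 + Real.goldenRatio) =
      D (mono 4 2 0) * (1 - 2 * Real.goldenRatio) := by
    linear_combination r6 / 15 + (6 + Real.goldenRatio) * (h40 - s6) +
      6 * (h22 - s6') - 6 * (h40 - s6)
  have e2 : (5 * Real.goldenRatio + 1) * D (mono 6 0 0) -
      (12 * Real.goldenRatio + 9) * D (mono 4 2 0) = 0 := by
    have hE : D (mono 2 2 2) = D (mono 6 0 0) := by linarith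
    have hC : D (mono 2 4 0) = -D (mono 6 0 0) - D (mono 4 2 0) := by linarith
    rw [hE, hC] at h6
    linear_combination h6
  -- Elimination of the moment of x⁴y² leaves the coefficient −16(4φ + 3), which is not zero.
  have h60 : D (mono 6 0 0) = 0 := by
    have : (4 * Real.goldenRatio + 3) * D (mono 6 0 0) = 0 := by
      generalize Real.goldenRatio = p at *
      linear_combination -1 / 16 * ((1 - 2 * p) * e2 - (12 * p + 9) * e1) -
        22 / 16 * D (mono 6 0 0) * p2
    exact (mul_eq_zero.1 this).resolve_left (by positivity)
  have h42 : D (mono 4 2 0) = 0 := by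
    have : (12 * Real.goldenRatio + 9) * D (mono 4 2 0) = 0 := by
      linear_combination (5 * Real.goldenRatio + 1) * h60 - e2
    exact (mul_eq_zero.1 this).resolve_left (by positivity)
  have h24 : D (mono 2 4 0) = 0 := by linarith
  have h222 : D (mono 2 2 2) = 0 := by linarith
  -- Since the sextic moments vanish, the equation of the sphere expresses all moments of degree
  -- eight by that of x⁴y⁴; the reflection then multiplies it by 640.
  have r8 := hc.reflection_eighth hf hr
  have s8 := hs.mono_succ 6 0 0
  have s8' := hs.mono_succ 4 2 0
  have s8'' := hs.mono_succ 2 4 0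
  have s8''' := hs.mono_succ 2 2 2
  simp only [zero_add, Nat.reduceAdd] at s8 s8' s8'' s8'''
  rw [hc.mono_cyc 6 0 2, hc.mono_cyc 0 2 6] at s8
  have c1 := hc.mono_cyc 4 2 2
  have c2 := hc.mono_cyc 2 2 4
  have h422 : D (mono 4 2 2) = 0 := by linarith
  have h242 : D (mono 2 4 2) = 0 := by linarith
  have h224 : D (mono 2 2 4) = 0 := by linarith
  have hB : D (mono 6 2 0) = -D (mono 4 4 0) := by linarith
  have hC : D (mono 2 6 0) = -D (mono 4 4 0) := by linarith
  have hA : D (mono 8 0 0) = 2 * D (mono 4 4 0) := by linarith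
  rw [h422, h242, h224, hB, hC, hA] at r8
  have h44 : D (mono 4 4 0) = 0 := by
    linear_combination r8 / 640
  rw [h44] at hA hB hC
  simp only [mul_zero, neg_zero] at hA hB hC
  refine even_vanishing hc hf (n := 4) (fun i j k hijk => ?_) a b c h
  have hi : i ≤ 4 := by omega
  have hj : j ≤ 4 := by omega
  have hk : k ≤ 4 := by omega
  interval_cases i <;> interval_cases j <;> interval_cases k <;>
    first
    | (exfalso; omega)
    | assumption
    | (rw [hc.mono_cyc]; assumption)
    | (rw [hc.mono_cyc, hc.mono_cyc]; assumption)

end IcosahedralVanishing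

/-! ### Polynomials as combinations of monomials -/

/-- The span of the monomial functions of degree at most `s`. -/
def monoSpan (s : ℕ) : Submodule ℝ C(E3, ℝ) :=
  Submodule.span ℝ {f | ∃ a b c : ℕ, a + b + c ≤ s ∧ f = mono a b c}

theorem mono_mem_monoSpan {a b c s : ℕ} (h : a + b + c ≤ s) : mono a b c ∈ monoSpan s :=
  Submodule.subset_span ⟨a, b, c, h, rfl⟩

theorem monoSpan_mono {s t : ℕ} (h : s ≤ t) : monoSpan s ≤ monoSpan t :=
  Submodule.span_mono fun _ ⟨a, b, c, hs, hf⟩ => ⟨a, b, c, hs.trans h, hf⟩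

theorem mul_mem_monoSpan {s t : ℕ} {f g : C(E3, ℝ)} (hf : f ∈ monoSpan s) (hg : g ∈ monoSpan t) :
    f * g ∈ monoSpan (s + t) := by
  have h := Submodule.mul_mem_mul hf hg
  rw [monoSpan, monoSpan, Submodule.span_mul_span] at h
  refine Submodule.span_le.2 ?_ h
  rintro _ ⟨_, ⟨a, b, c, hs, rfl⟩, _, ⟨a', b', c', ht, rfl⟩, rfl⟩
  have : mono a b c * mono a' b' c' = mono (a + a') (b + b') (c + c') := by
    ext x; simp; ring
  simp only [this]
  exact mono_mem_monoSpan (by omega)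

theorem one_mem_monoSpan (s : ℕ) : (1 : C(E3, ℝ)) ∈ monoSpan s := by
  have : (1 : C(E3, ℝ)) = mono 0 0 0 := by ext; simp
  rw [this]; exact mono_mem_monoSpan (by omega)

theorem pow_mem_monoSpan {f : C(E3, ℝ)} (hf : f ∈ monoSpan 1) (n : ℕ) : f ^ n ∈ monoSpan n := by
  induction n with
  | zero => rw [pow_zero]; exact one_mem_monoSpan 0
  | succ n ih => rw [pow_succ]; exact mul_mem_monoSpan ih hf

theorem coord_comp_mem_monoSpan (O : E3 ≃ₗᵢ[ℝ] E3) (i : Fin 3) :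
    (⟨fun x => O x i, by fun_prop⟩ : C(E3, ℝ)) ∈ monoSpan 1 := by
  have : (⟨fun x => O x i, by fun_prop⟩ : C(E3, ℝ)) =
      (O (EuclideanSpace.single 0 1) i) • mono 1 0 0 + (O (EuclideanSpace.single 1 1) i) • mono 0 1 0 +
      (O (EuclideanSpace.single 2 1) i) • mono 0 0 1 := by
    ext x
    have hx : x = x 0 • EuclideanSpace.single 0 1 + x 1 • EuclideanSpace.single 1 1 +
        x 2 • EuclideanSpace.single 2 1 := by
      ext j; fin_cases j <;> simp
    simp only [ContinuousMap.coe_mk]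
    conv_lhs => rw [hx]
    simp only [map_add, map_smul]
    simp
    ring
  rw [this]
  refine add_mem (add_mem ?_ ?_) ?_ <;>
    exact Submodule.smul_mem _ _ (mono_mem_monoSpan (by omega))

@[fun_prop]
theorem continuous_evalPoly (p : MvPolynomial (Fin 3) ℝ) : Continuous (evalPoly p) := by
  unfold evalPoly
  simp only [MvPolynomial.eval_eq']
  fun_prop

/-- Instead of moving the polytope into standard position, one moves the polynomial; an orthogonal
substitution does not raise the degree. -/
theorem evalPoly_comp_mem_monoSpan (O : E3 ≃ₗᵢ[ℝ] E3) {s : ℕ} (p : MvPolynomial (Fin 3) ℝ)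
    (hp : p.totalDegree ≤ s) :
    (⟨fun x => evalPoly p (O x), by fun_prop⟩ : C(E3, ℝ)) ∈ monoSpan s := by
  have : (⟨fun x => evalPoly p (O x), by fun_prop⟩ : C(E3, ℝ)) = ∑ d ∈ p.support, p.coeff d •
      ((⟨fun x => O x 0, by fun_prop⟩ : C(E3, ℝ)) ^ d 0 *
      (⟨fun x => O x 1, by fun_prop⟩ : C(E3, ℝ)) ^ d 1 *
      (⟨fun x => O x 2, by fun_prop⟩ : C(E3, ℝ)) ^ d 2) := by
    ext x
    simp [evalPoly, MvPolynomial.eval_eq', Fin.prod_univ_three]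
  rw [this]
  refine sum_mem fun d hd => Submodule.smul_mem _ _ ?_
  have hdeg : d 0 + d 1 + d 2 ≤ s := by
    have h := (MvPolynomial.le_totalDegree hd).trans hp
    rw [Finsupp.sum_fintype _ _ (by simp)] at h
    simpa [Fin.sum_univ_three] using h
  refine monoSpan_mono hdeg (mul_mem_monoSpan (mul_mem_monoSpan ?_ ?_) ?_) <;>
    exact pow_mem_monoSpan (coord_comp_mem_monoSpan O _) _

theorem vanish_of_monomials {D : C(E3, ℝ) →ₗ[ℝ] ℝ} {s : ℕ}
    (H : ∀ a b c : ℕ, a + b + c ≤ s → D (mono a b c) = 0) {f : C(E3, ℝ)} (hf : f ∈ monoSpan s) :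
    D f = 0 := by
  have : monoSpan s ≤ LinearMap.ker D :=
    Submodule.span_le.2 fun _ ⟨a, b, c, h, hf⟩ => by rw [hf]; exact H a b c h
  exact this hf

/-! ### Geodesic arcs -/

/-- The unit tangent vector at `x` of the geodesic arc from `x` to `y`. -/
def arcDir (x y : E3) : E3 := (Real.sin (sphDist x y))⁻¹ • (y - ⟪x, y⟫ • x)

section Arc

variable {x y : E3}

theorem cos_sphDist (h : |⟪x, y⟫| < 1) : Real.cos (sphDist x y) = ⟪x, y⟫ :=
  Real.cos_arccos (abs_lt.1 h).1.le (abs_lt.1 h).2.le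

theorem sphDist_pos (h : |⟪x, y⟫| < 1) : 0 < sphDist x y := Real.arccos_pos.2 (abs_lt.1 h).2

theorem sphDist_nonneg (x y : E3) : 0 ≤ sphDist x y := Real.arccos_nonneg _

theorem sphDist_comm (x y : E3) : sphDist x y = sphDist y x := by
  rw [sphDist, sphDist, real_inner_comm]

theorem sin_sphDist_pos (h : |⟪x, y⟫| < 1) : 0 < Real.sin (sphDist x y) := by
  rw [sphDist, Real.sin_arccos]
  exact Real.sqrt_pos.2 (by have := (sq_lt_one_iff_abs_lt_one _).2 h; linarith)

/-- The addition formula for the sine, with ⟪x, y⟫ as the cosine of the distance. In the orthonormal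
frame `x`, `arcDir x y` the arc is the standard circle, so norm and speed can be read off. -/
theorem geodesicArc_eq (h : |⟪x, y⟫| < 1) (t : ℝ) :
    geodesicArc x y t = Real.cos t • x + Real.sin t • arcDir x y := by
  have hs := (sin_sphDist_pos h).ne'
  rw [geodesicArc, arcDir, ← cos_sphDist h, Real.sin_sub]
  match_scalars <;> field_simp
  ring

theorem geodesicArc_zero (h : |⟪x, y⟫| < 1) : geodesicArc x y 0 = x := by
  simp [geodesicArc_eq h]

theorem geodesicArc_end (h : |⟪x, y⟫| < 1) : geodesicArc x y (sphDist x y) = y := by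
  simp [geodesicArc, (sin_sphDist_pos h).ne']

theorem geodesicArc_reverse (x y : E3) (t : ℝ) :
    geodesicArc x y (sphDist x y - t) = geodesicArc y x t := by
  rw [geodesicArc, geodesicArc, sphDist_comm y x, sub_sub_cancel, add_comm]

theorem inner_arcDir (hx : ‖x‖ = 1) : ⟪x, arcDir x y⟫ = 0 := by
  simp [arcDir, inner_smul_right, inner_sub_right, hx]

theorem norm_arcDir (hx : ‖x‖ = 1) (hy : ‖y‖ = 1) (h : |⟪x, y⟫| < 1) : ‖arcDir x y‖ = 1 := by
  have hs := sin_sphDist_pos h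
  have h1 : ‖y - ⟪x, y⟫ • x‖ ^ 2 = Real.sin (sphDist x y) ^ 2 := by
    rw [@norm_sub_sq_real, hy, norm_smul, hx, inner_smul_right, real_inner_comm x y, Real.sin_sq,
      cos_sphDist h, Real.norm_eq_abs, mul_one, sq_abs]
    ring
  rw [arcDir, norm_smul, norm_inv, Real.norm_of_nonneg hs.le,
    (pow_left_inj₀ (norm_nonneg _) hs.le two_ne_zero).1 h1, inv_mul_cancel₀ hs.ne']

theorem norm_circle {x u : E3} (hx : ‖x‖ = 1) (hu : ‖u‖ = 1) (h : ⟪x, u⟫ = 0) (a b : ℝ)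
    (hab : a ^ 2 + b ^ 2 = 1) : ‖a • x + b • u‖ = 1 := by
  have : ‖a • x + b • u‖ ^ 2 = 1 := by
    rw [@norm_add_sq_real, norm_smul, norm_smul, inner_smul_left, inner_smul_right, h, hx, hu]
    simpa using hab
  exact (pow_eq_one_iff_of_nonneg (norm_nonneg _) two_ne_zero).1 this

theorem norm_geodesicArc (hx : ‖x‖ = 1) (hy : ‖y‖ = 1) (h : |⟪x, y⟫| < 1) (t : ℝ) :
    ‖geodesicArc x y t‖ = 1 := by
  rw [geodesicArc_eq h]
  exact norm_circle hx (norm_arcDir hx hy h) (inner_arcDir hx) _ _ (Real.cos_sq_add_sin_sq t)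

theorem contDiff_geodesicArc (x y : E3) : ContDiff ℝ ∞ (geodesicArc x y) := by
  unfold geodesicArc
  fun_prop

@[fun_prop]
theorem continuous_geodesicArc (x y : E3) : Continuous (geodesicArc x y) :=
  (contDiff_geodesicArc x y).continuous

theorem norm_deriv_geodesicArc (hx : ‖x‖ = 1) (hy : ‖y‖ = 1) (h : |⟪x, y⟫| < 1) (t : ℝ) :
    ‖deriv (geodesicArc x y) t‖ = 1 := by
  have hd : HasDerivAt (geodesicArc x y) (-Real.sin t • x + Real.cos t • arcDir x y) t := by
    rw [funext (geodesicArc_eq h)]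
    exact ((Real.hasDerivAt_cos t).smul_const x).add ((Real.hasDerivAt_sin t).smul_const _)
  rw [hd.deriv]
  refine norm_circle hx (norm_arcDir hx hy h) (inner_arcDir hx) _ _ ?_
  rw [neg_sq, Real.sin_sq_add_cos_sq]

/-- The integral along the geodesic arc from `x` to `y`. -/
def arcIntegral (f : E3 → ℝ) (x y : E3) : ℝ := ∫ t in (0 : ℝ)..sphDist x y, f (geodesicArc x y t)

/-- Reversal of the arc. It makes the integral a function of the unoriented edge. -/
theorem arcIntegral_comm (f : E3 → ℝ) (x y : E3) : arcIntegral f x y = arcIntegral f y x := by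
  unfold arcIntegral
  rw [← sphDist_comm x y]
  simp_rw [← geodesicArc_reverse x y]
  rw [intervalIntegral.integral_comp_sub_left (fun t => f (geodesicArc x y t))]
  simp

theorem arcIntegral_one (x y : E3) : arcIntegral (fun _ => 1) x y = sphDist x y := by
  simp [arcIntegral]

theorem sphDist_map (O : E3 ≃ₗᵢ[ℝ] E3) (x y : E3) : sphDist (O x) (O y) = sphDist x y := by
  simp [sphDist]

theorem geodesicArc_map (O : E3 ≃ₗᵢ[ℝ] E3) (x y : E3) (t : ℝ) :
    geodesicArc (O x) (O y) t = O (geodesicArc x y t) := by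
  simp [geodesicArc, sphDist_map]

theorem arcIntegral_map (O : E3 ≃ₗᵢ[ℝ] E3) (f : E3 → ℝ) (x y : E3) :
    arcIntegral f (O x) (O y) = arcIntegral (fun z => f (O z)) x y := by
  simp [arcIntegral, geodesicArc_map, sphDist_map]

end Arc

/-! ### Geodesic chains -/

/-- The sum of a function over the successive pairs of a list. -/
def chainSum (A : E3 → E3 → ℝ) : List E3 → ℝ
  | [] => 0
  | [_] => 0
  | x :: y :: l => A x y + chainSum A (y :: l)

/-- The lists of points of the sphere with successive points neither equal nor opposite. -/
def IsGoodChain (l : List E3) : Prop := (∀ x ∈ l, ‖x‖ = 1) ∧ l.IsChain fun x y => |⟪x, y⟫| < 1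

theorem IsGoodChain.tail {x : E3} {l : List E3} (h : IsGoodChain (x :: l)) : IsGoodChain l :=
  ⟨fun y hy => h.1 y (List.mem_cons_of_mem _ hy), h.2.tail⟩

theorem IsGoodChain.head {x y : E3} {l : List E3} (h : IsGoodChain (x :: y :: l)) :
    ‖x‖ = 1 ∧ ‖y‖ = 1 ∧ |⟪x, y⟫| < 1 :=
  ⟨h.1 x (by simp), h.1 y (by simp), (List.isChain_cons_cons.1 h.2).1⟩

theorem chainLength_nonneg (l : List E3) : 0 ≤ chainLength l := by
  induction l with
  | nil => exact le_rfl
  | cons x l ih =>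
    cases l with
    | nil => exact le_rfl
    | cons y l => exact add_nonneg (sphDist_nonneg _ _) ih

theorem geodesicChain_zero {x : E3} {l : List E3} (h : IsGoodChain (x :: l)) :
    geodesicChain (x :: l) 0 = x := by
  cases l with
  | nil => rfl
  | cons y l => simp [geodesicChain, sphDist_nonneg, geodesicArc_zero h.head.2.2]

theorem geodesicChain_of_le {x y : E3} {l : List E3} {t : ℝ} (ht : t ≤ sphDist x y) :
    geodesicChain (x :: y :: l) t = geodesicArc x y t := by
  simp [geodesicChain, ht]

/-- At the junction itself the definition takes the first branch; the two branches agree there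
because the arc ends where the rest of the chain begins. -/
theorem geodesicChain_of_ge {x y : E3} {l : List E3} (h : IsGoodChain (x :: y :: l)) {t : ℝ}
    (ht : sphDist x y ≤ t) :
    geodesicChain (x :: y :: l) t = geodesicChain (y :: l) (t - sphDist x y) := by
  rcases ht.eq_or_lt with rfl | ht
  · rw [geodesicChain_of_le le_rfl, sub_self, geodesicChain_zero h.tail,
      geodesicArc_end h.head.2.2]
  · simp [geodesicChain, ht]

theorem geodesicChain_end {x : E3} {l : List E3} (h : IsGoodChain (x :: l)) :
    geodesicChain (x :: l) (chainLength (x :: l)) = (x :: l).getLast (by simp) := by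
  induction l generalizing x with
  | nil => rfl
  | cons y l ih =>
    rw [chainLength, geodesicChain_of_ge h (by linarith [chainLength_nonneg (y :: l)]),
      add_sub_cancel_left, ih h.tail]
    simp

theorem norm_geodesicChain {x : E3} {l : List E3} (h : IsGoodChain (x :: l)) (t : ℝ) :
    ‖geodesicChain (x :: l) t‖ = 1 := by
  induction l generalizing x t with
  | nil => exact h.1 x (by simp)
  | cons y l ih =>
    rcases le_total t (sphDist x y) with ht | ht
    · rw [geodesicChain_of_le ht]
      exact norm_geodesicArc h.head.1 h.head.2.1 h.head.2.2 t
    · rw [geodesicChain_of_ge h ht]; exact ih h.tail _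

theorem continuous_geodesicChain {x : E3} {l : List E3} (h : IsGoodChain (x :: l)) :
    Continuous (geodesicChain (x :: l)) := by
  induction l generalizing x with
  | nil => exact continuous_const
  | cons y l ih =>
    have : geodesicChain (x :: y :: l) = fun t =>
        if t ≤ sphDist x y then geodesicArc x y t else geodesicChain (y :: l) (t - sphDist x y) := by
      ext1 t; rfl
    rw [this]
    refine Continuous.if_le (by fun_prop) ((ih h.tail).comp (by fun_prop)) continuous_id
      continuous_const ?_
    rintro t rfl
    rw [sub_self, geodesicChain_zero h.tail, geodesicArc_end h.head.2.2]

theorem geodesicChain_piecewise {x : E3} {l : List E3} (h : IsGoodChain (x :: l)) :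
    ∃ (n : ℕ) (τ : Fin (n + 1) → ℝ), StrictMono τ ∧ τ 0 = 0 ∧
      τ (Fin.last n) = chainLength (x :: l) ∧
      ∀ i : Fin n, ContDiffOn ℝ ∞ (geodesicChain (x :: l)) (Set.Icc (τ i.castSucc) (τ i.succ)) := by
  induction l generalizing x with
  | nil => exact ⟨0, fun _ => 0, fun a b hab => absurd hab (by omega), rfl, rfl, fun i => i.elim0⟩
  | cons y l ih =>
    obtain ⟨n, τ, hτ, h0, hl, hd⟩ := ih h.tail
    refine ⟨n + 1, Fin.cons 0 fun i => sphDist x y + τ i, ?_, rfl, ?_, ?_⟩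
    · refine Fin.strictMono_iff_lt_succ.2 fun i => ?_
      refine Fin.cases ?_ (fun j => ?_) i
      · simpa [h0] using sphDist_pos h.head.2.2
      · rw [← Fin.succ_castSucc]
        simpa using hτ (Fin.castSucc_lt_succ)
    · rw [← Fin.succ_last, Fin.cons_succ, hl]; rfl
    · intro i
      refine Fin.cases ?_ (fun j => ?_) i
      · refine (contDiff_geodesicArc x y).contDiffOn.congr fun t ht => ?_
        refine geodesicChain_of_le (ht.2.trans ?_)
        simp [h0]
      · rw [← Fin.succ_castSucc, Fin.cons_succ, Fin.cons_succ]
        have hnn : 0 ≤ τ j.castSucc := h0 ▸ hτ.monotone (Fin.zero_le _)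
        refine ((hd j).comp (g := geodesicChain (y :: l)) (f := fun t => t - sphDist x y)
          (s := Set.Icc (sphDist x y + τ j.castSucc) (sphDist x y + τ j.succ))
          (by fun_prop) ?_).congr ?_
        · intro t ht
          simp only [Set.mem_Icc] at ht ⊢
          constructor <;> linarith [ht.1, ht.2]
        · intro t ht
          exact geodesicChain_of_ge h (by linarith [ht.1])

/-- Near every time other than a junction the chain coincides with a single arc of unit speed. The
two ends are excluded, since the two-sided derivative there also depends on values outside the
parameter interval. -/
theorem finite_deriv_geodesicChain {x : E3} {l : List E3} (h : IsGoodChain (x :: l)) :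
    {t | t < chainLength (x :: l) ∧ ‖deriv (geodesicChain (x :: l)) t‖ ≠ 1 ∧ 0 < t}.Finite := by
  induction l generalizing x with
  | nil =>
    convert Set.finite_empty
    ext t
    simp only [chainLength, Set.mem_ofPred_eq, Set.mem_empty_iff_false, iff_false]
    rintro ⟨h1, -, h2⟩
    linarith
  | cons y l ih =>
    refine ((Set.finite_singleton (sphDist x y)).union
      ((ih h.tail).image fun t => t + sphDist x y)).subset ?_
    rintro t ⟨h1, h2, h3⟩
    rcases lt_trichotomy t (sphDist x y) with ht | ht | ht
    · exfalso
      apply h2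
      have : geodesicChain (x :: y :: l) =ᶠ[nhds t] geodesicArc x y :=
        (eventually_lt_nhds ht).mono fun s hs => geodesicChain_of_le (le_of_lt hs)
      rw [this.deriv_eq]
      exact norm_deriv_geodesicArc h.head.1 h.head.2.1 h.head.2.2 t
    · exact Or.inl ht
    · right
      refine ⟨t - sphDist x y, ⟨?_, ?_, by linarith⟩, by simp⟩
      · rw [chainLength] at h1; linarith
      · have : geodesicChain (x :: y :: l) =ᶠ[nhds t]
            fun s => geodesicChain (y :: l) (s - sphDist x y) :=
          (eventually_gt_nhds ht).mono fun s hs => geodesicChain_of_ge h (le_of_lt hs)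
        rw [this.deriv_eq, deriv_comp_sub_const] at h2
        exact h2

theorem pathIntegral_geodesicChain {x : E3} {l : List E3} (h : IsGoodChain (x :: l))
    (f : E3 → ℝ) : pathIntegral (chainLength (x :: l)) (geodesicChain (x :: l)) f =
      ∫ t in (0 : ℝ)..chainLength (x :: l), f (geodesicChain (x :: l) t) := by
  unfold pathIntegral
  refine intervalIntegral.integral_congr_ae ?_
  have hfin := (finite_deriv_geodesicChain h).union (Set.finite_singleton (chainLength (x :: l)))
  filter_upwards [hfin.countable.ae_notMem MeasureTheory.volume] with t ht hmem
  rw [Set.uIoc_of_le (chainLength_nonneg _)] at hmem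
  have : ‖deriv (geodesicChain (x :: l)) t‖ = 1 := by
    by_contra hne
    rcases hmem.2.eq_or_lt with heq | hlt
    · exact ht (Or.inr heq)
    · exact ht (Or.inl ⟨hlt, hne, hmem.1⟩)
  rw [this, mul_one]

theorem pathIntegral_eq_chainSum {x : E3} {l : List E3} (h : IsGoodChain (x :: l))
    {f : E3 → ℝ} (hf : Continuous f) :
    pathIntegral (chainLength (x :: l)) (geodesicChain (x :: l)) f =
      chainSum (arcIntegral f) (x :: l) := by
  rw [pathIntegral_geodesicChain h]
  induction l generalizing x with
  | nil => simp [chainLength, chainSum]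
  | cons y l ih =>
    rw [chainSum, ← ih h.tail, chainLength]
    have hc : Continuous fun t => f (geodesicChain (x :: y :: l) t) :=
      hf.comp (continuous_geodesicChain h)
    rw [← intervalIntegral.integral_add_adjacent_intervals (b := sphDist x y)
      (hc.intervalIntegrable _ _) (hc.intervalIntegrable _ _)]
    congr 1
    · refine intervalIntegral.integral_congr fun t ht => ?_
      rw [Set.uIcc_of_le (sphDist_nonneg x y)] at ht
      simp only [geodesicChain_of_le ht.2]
    · have h1 : ∫ t in sphDist x y..sphDist x y + chainLength (y :: l),
          f (geodesicChain (x :: y :: l) t) = ∫ t in sphDist x y..sphDist x y + chainLength (y :: l),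
          f (geodesicChain (y :: l) (t - sphDist x y)) := by
        refine intervalIntegral.integral_congr fun t ht => ?_
        rw [Set.uIcc_of_le (by linarith [chainLength_nonneg (y :: l)])] at ht
        simp only [geodesicChain_of_ge h ht.1]
      rw [h1, intervalIntegral.integral_comp_sub_right (fun t => f (geodesicChain (y :: l) t))]
      simp

theorem isSphericalCurve_geodesicChain {x y : E3} {l : List E3} (h : IsGoodChain (x :: y :: l))
    (hc : (x :: y :: l).getLast (by simp) = x) :
    IsSphericalCurve (chainLength (x :: y :: l)) (geodesicChain (x :: y :: l)) where
  pos := add_pos_of_pos_of_nonneg (sphDist_pos h.head.2.2) (chainLength_nonneg _)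
  mem_sphere t _ := mem_sphere_zero_iff_norm.2 (norm_geodesicChain h t)
  continuousOn := (continuous_geodesicChain h).continuousOn
  closed := by rw [geodesicChain_zero h, geodesicChain_end h, hc]
  piecewise_smooth := geodesicChain_piecewise h

/-! ### The faces of a convex polytope with known vertices and facet normals -/

/-- The vectors `n ∈ N` are the facet normals, with common offset `h`, of the polytope with
vertices `V`. -/
structure IsPolytopeData (V N : Finset E3) (h : ℝ) : Prop where
  pos : 0 < h
  le : ∀ n ∈ N, ∀ v ∈ V, ⟪n, v⟫ ≤ h
  fan : ∀ c : E3, ∃ v ∈ V, c ∈ Submodule.span NNReal {n | n ∈ N ∧ ⟪n, v⟫ = h}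
  vertex : ∀ v ∈ V, ∀ u ∈ V, (∀ n ∈ N, ⟪n, v⟫ = h → ⟪n, u⟫ = h) → u = v
  facet : ∀ n ∈ N, ∃ v₁ ∈ V, ∃ v₂ ∈ V, ∃ v₃ ∈ V, ⟪n, v₁⟫ = h ∧ ⟪n, v₂⟫ = h ∧ ⟪n, v₃⟫ = h ∧
    LinearIndependent ℝ ![v₂ - v₁, v₃ - v₁]

open Classical in
/-- The vertices that lie on the facets with normals in `S`. -/
def tightSet (V : Finset E3) (h : ℝ) (S : Finset E3) : Finset E3 :=
  V.filter fun v => ∀ n ∈ S, ⟪n, v⟫ = h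

theorem mem_tightSet {V : Finset E3} {h : ℝ} {S : Finset E3} {v : E3} :
    v ∈ tightSet V h S ↔ v ∈ V ∧ ∀ n ∈ S, ⟪n, v⟫ = h := by
  classical
  simp [tightSet]

theorem tightSet_subset (V : Finset E3) (h : ℝ) (S : Finset E3) : tightSet V h S ⊆ V :=
  fun _ hv => (mem_tightSet.1 hv).1

theorem inner_eq_of_mem_convexHull {s : Set E3} {n : E3} {h : ℝ} (H : ∀ v ∈ s, ⟪n, v⟫ = h) {x : E3}
    (hx : x ∈ convexHull ℝ s) : ⟪n, x⟫ = h := by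
  have : convexHull ℝ s ⊆ {x | ⟪n, x⟫ = h} :=
    convexHull_min H (convex_hyperplane ⟨inner_add_right n, fun c x => inner_smul_right n x c⟩ h)
  exact this hx

theorem inner_le_of_mem_convexHull {s : Set E3} {n : E3} {h : ℝ} (H : ∀ v ∈ s, ⟪n, v⟫ ≤ h) {x : E3}
    (hx : x ∈ convexHull ℝ s) : ⟪n, x⟫ ≤ h := by
  have : convexHull ℝ s ⊆ {x | ⟪n, x⟫ ≤ h} :=
    convexHull_min H (convex_halfSpace_le ⟨inner_add_right n, fun c x => inner_smul_right n x c⟩ h)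
  exact this hx

theorem inner_lt_of_mem_convexHull {s : Set E3} {n : E3} {h : ℝ} (H : ∀ v ∈ s, ⟪n, v⟫ < h) {x : E3}
    (hx : x ∈ convexHull ℝ s) : ⟪n, x⟫ < h := by
  have : convexHull ℝ s ⊆ {x | ⟪n, x⟫ < h} :=
    convexHull_min H (convex_halfSpace_lt ⟨inner_add_right n, fun c x => inner_smul_right n x c⟩ h)
  exact this hx

theorem mem_vertices_of_subset {A B : Set E3} (h : B ⊆ A) {x : E3} (hx : x ∈ vertices A)
    (hB : x ∈ B) : x ∈ vertices B := by
  obtain ⟨_, l, hl⟩ := hx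
  exact ⟨hB, l, fun y hy => hl y (h hy)⟩

theorem vertices_convexHull_subset (s : Set E3) : vertices (convexHull ℝ s) ⊆ s :=
  exposedPoints_subset_extremePoints.trans extremePoints_convexHull_subset

/-- A point x of a sphere is exposed by y ↦ ⟪x, y⟫: within the ball, |x − y|² ≤ 2(r² − ⟪x, y⟫), so
that the maximum r² is attained at x only. -/
theorem vertices_convexHull_of_norm_eq {s : Set E3} {r : ℝ} (hs : ∀ x ∈ s, ‖x‖ = r) :
    vertices (convexHull ℝ s) = s := by
  refine (vertices_convexHull_subset s).antisymm fun x hx => ?_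
  have hball : convexHull ℝ s ⊆ Metric.closedBall 0 r :=
    convexHull_min (fun y hy => by simp [hs y hy]) (convex_closedBall 0 r)
  refine ⟨subset_convexHull ℝ s hx, innerSL ℝ x, fun y hy => ?_⟩
  have hy' : ‖y‖ ≤ r := by simpa using hball hy
  have hr : 0 ≤ r := hs x hx ▸ norm_nonneg x
  have hn := @norm_sub_sq_real E3 _ _ x y
  have h2 : ‖y‖ ^ 2 ≤ r ^ 2 := pow_le_pow_left₀ (norm_nonneg _) hy' 2
  simp only [innerSL_apply_apply, real_inner_self_eq_norm_sq]
  rw [hs x hx] at hn ⊢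
  refine ⟨by nlinarith [sq_nonneg ‖x - y‖], fun h => ?_⟩
  have : ‖x - y‖ ^ 2 = 0 := le_antisymm (by linarith) (sq_nonneg _)
  rw [sq_eq_zero_iff, norm_eq_zero, sub_eq_zero] at this
  exact this.symm

/-- Two vectors orthogonal to two independent vectors are parallel. -/
theorem exists_smul_of_orthogonal {n n' d x : E3} (hn : LinearIndependent ℝ ![n, n']) (hd : d ≠ 0)
    (hd1 : ⟪n, d⟫ = 0) (hd2 : ⟪n', d⟫ = 0) (hx1 : ⟪n, x⟫ = 0) (hx2 : ⟪n', x⟫ = 0) :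
    ∃ s : ℝ, x = s • d := by
  have hr : Module.finrank ℝ (Submodule.span ℝ (Set.range ![n, n'])) = 2 := by
    simpa using finrank_span_eq_card hn
  have hsum := (Submodule.span ℝ (Set.range ![n, n'])).finrank_add_finrank_orthogonal
  rw [hr, finrank_euclideanSpace_fin] at hsum
  have hmem {y : E3} (h1 : ⟪n, y⟫ = 0) (h2 : ⟪n', y⟫ = 0) :
      y ∈ (Submodule.span ℝ (Set.range ![n, n']))ᗮ := by
    rw [Submodule.mem_orthogonal]
    intro u hu
    induction hu using Submodule.span_induction with
    | mem u hu => obtain ⟨i, rfl⟩ := hu; fin_cases i <;> assumption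
    | zero => simp
    | add a b _ _ ha hb => rw [inner_add_left, ha, hb, add_zero]
    | smul c a _ ha => rw [inner_smul_left, ha, mul_zero]
  have hone : Module.finrank ℝ (Submodule.span ℝ (Set.range ![n, n']))ᗮ = 1 := by omega
  obtain ⟨s, hs⟩ := (finrank_eq_one_iff_of_nonzero' (⟨d, hmem hd1 hd2⟩ :
    (Submodule.span ℝ (Set.range ![n, n']))ᗮ) (by simpa using hd)).1 hone ⟨x, hmem hx1 hx2⟩
  exact ⟨s, (congrArg Subtype.val hs).symm⟩

/-- Pairing a linear relation with the common point shows that its coefficients are a and −a, and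
then a(n − n') = 0. -/
theorem linearIndependent_of_inner_eq {n n' v : E3} {h : ℝ} (hh : h ≠ 0) (hne : n ≠ n')
    (h1 : ⟪n, v⟫ = h) (h2 : ⟪n', v⟫ = h) : LinearIndependent ℝ ![n, n'] := by
  rw [LinearIndependent.pair_iff]
  intro a b hab
  have h3 : ⟪a • n + b • n', v⟫ = (0 : ℝ) := by rw [hab, inner_zero_left]
  rw [inner_add_left, inner_smul_left, inner_smul_left, h1, h2] at h3
  have h4 : b = -a := by
    have : (a + b) * h = 0 := by simpa [add_mul] using h3
    linarith [(mul_eq_zero.1 this).resolve_right hh]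
  subst h4
  have h5 : a • (n - n') = 0 := by rw [← hab]; module
  have : a = 0 := (smul_eq_zero.1 h5).resolve_right (sub_ne_zero.2 hne)
  simp [this]

namespace IsPolytopeData

variable {V N : Finset E3} {h : ℝ}

theorem inner_le (D : IsPolytopeData V N h) {n x : E3} (hn : n ∈ N)
    (hx : x ∈ convexHull ℝ (V : Set E3)) : ⟪n, x⟫ ≤ h :=
  inner_le_of_mem_convexHull (D.le n hn) hx

/-- Linear programming duality in the form in which it is used: every functional is a positive
combination of normals that are active at one vertex. Normals with weight zero are dropped, so that
the remaining ones describe the face exposed by the functional. -/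
theorem exists_weights (D : IsPolytopeData V N h) (c : E3) : ∃ v ∈ V, ∃ (S : Finset E3) (w : E3 → ℝ),
    S ⊆ N ∧ (∀ n ∈ S, 0 < w n ∧ ⟪n, v⟫ = h) ∧ c = ∑ n ∈ S, w n • n := by
  obtain ⟨v, hv, hc⟩ := D.fan c
  obtain ⟨f, hf, rfl⟩ := Submodule.mem_span_set.1 hc
  refine ⟨v, hv, f.support, fun n => f n, fun n hn => (hf hn).1, fun n hn => ⟨?_, (hf hn).2⟩, rfl⟩
  exact NNReal.coe_pos.2 (pos_iff_ne_zero.2 (Finsupp.mem_support_iff.1 hn))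

/-- A convex combination of vertices attains the bound h for a normal only if each vertex with
nonzero weight attains it. -/
theorem mem_convexHull_tightSet (D : IsPolytopeData V N h) {S : Finset E3} (hS : S ⊆ N) {x : E3} :
    x ∈ convexHull ℝ (tightSet V h S : Set E3) ↔
      x ∈ convexHull ℝ (V : Set E3) ∧ ∀ n ∈ S, ⟪n, x⟫ = h := by
  constructor
  · intro hx
    refine ⟨convexHull_mono (by exact_mod_cast tightSet_subset V h S) hx, fun n hn => ?_⟩
    exact inner_eq_of_mem_convexHull (fun v hv => (mem_tightSet.1 hv).2 n hn) hx
  · rintro ⟨hx, hn⟩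
    rw [Finset.mem_convexHull'] at hx ⊢
    obtain ⟨w, h0, h1, rfl⟩ := hx
    have hz : ∀ v ∈ V, v ∉ tightSet V h S → w v = 0 := by
      intro v hv hvT
      by_contra hne
      apply hvT
      refine mem_tightSet.2 ⟨hv, fun n hnS => ?_⟩
      have hsum : ∑ u ∈ V, w u * (h - ⟪n, u⟫) = 0 := by
        have := hn n hnS
        rw [inner_sum] at this
        simp only [inner_smul_right] at this
        simp only [mul_sub, Finset.sum_sub_distrib, ← Finset.sum_mul, h1, one_mul, this, sub_self]
      have := (Finset.sum_eq_zero_iff_of_nonneg fun u hu =>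
        mul_nonneg (h0 u hu) (sub_nonneg.2 (D.le n (hS hnS) u hu))).1 hsum v hv
      linarith [(mul_eq_zero.1 this).resolve_left hne]
    refine ⟨w, fun v hv => h0 v (tightSet_subset V h S hv), ?_, ?_⟩
    · rw [← h1]
      exact Finset.sum_subset (tightSet_subset V h S) hz
    · exact Finset.sum_subset (tightSet_subset V h S) fun v hv hv' => by rw [hz v hv hv', zero_smul]

/-- Write the exposing functional as a positive combination of normals active at a vertex. Its
maximum is h times the sum of the weights, and a point attains it exactly when it is tight for each
of these normals. -/
theorem exists_eq_of_isExposed (D : IsPolytopeData V N h) {F : Set E3}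
    (hF : IsExposed ℝ (convexHull ℝ (V : Set E3)) F) (hne : F.Nonempty) :
    ∃ S ⊆ N, F = convexHull ℝ (tightSet V h S : Set E3) := by
  obtain ⟨l, rfl⟩ := hF hne
  obtain ⟨v, hv, S, w, hS, hw, hc⟩ := D.exists_weights ((InnerProductSpace.toDual ℝ E3).symm l)
  refine ⟨S, hS, ?_⟩
  have hl (x : E3) : l x = ∑ n ∈ S, w n * ⟪n, x⟫ := by
    rw [← InnerProductSpace.toDual_symm_apply, hc, sum_inner]
    simp [inner_smul_left]
  have hle {x : E3} (hx : x ∈ convexHull ℝ (V : Set E3)) : l x ≤ ∑ n ∈ S, w n * h := by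
    rw [hl]
    exact Finset.sum_le_sum fun n hn =>
      mul_le_mul_of_nonneg_left (D.inner_le (hS hn) hx) (hw n hn).1.le
  have hlv : l v = ∑ n ∈ S, w n * h := by
    rw [hl]; exact Finset.sum_congr rfl fun n hn => by rw [(hw n hn).2]
  ext x
  rw [D.mem_convexHull_tightSet hS]
  refine and_congr_right fun hx => ⟨fun H n hn => ?_, fun H y hy => ?_⟩
  · have h1 := H v (subset_convexHull ℝ _ hv)
    rw [hlv, hl] at h1
    have h2 : ∑ n ∈ S, w n * (h - ⟪n, x⟫) ≤ 0 := by
      simp only [mul_sub, Finset.sum_sub_distrib]; linarith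
    have hnn : ∀ n ∈ S, 0 ≤ w n * (h - ⟪n, x⟫) := fun n hn =>
      mul_nonneg (hw n hn).1.le (sub_nonneg.2 (D.inner_le (hS hn) hx))
    have h3 := (Finset.sum_eq_zero_iff_of_nonneg hnn).1 (h2.antisymm (Finset.sum_nonneg hnn)) n hn
    linarith [(mul_eq_zero.1 h3).resolve_left (hw n hn).1.ne']
  · refine (hle hy).trans (le_of_eq ?_)
    rw [hl]; exact Finset.sum_congr rfl fun n hn => by rw [H n hn]

/-- The sum of the normals in `S` exposes the face, as soon as some point is tight for all of them.
-/
theorem isExposed_tightSet (D : IsPolytopeData V N h) {S : Finset E3} (hS : S ⊆ N) :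
    IsExposed ℝ (convexHull ℝ (V : Set E3)) (convexHull ℝ (tightSet V h S : Set E3)) := by
  rintro ⟨z, hz⟩
  rw [D.mem_convexHull_tightSet hS] at hz
  refine ⟨innerSL ℝ (∑ n ∈ S, n), ?_⟩
  ext x
  rw [D.mem_convexHull_tightSet hS]
  simp only [Set.mem_ofPred_eq, innerSL_apply_apply, sum_inner]
  refine and_congr_right fun hx => ⟨fun H y hy => ?_, fun H n hn => ?_⟩
  · exact Finset.sum_le_sum fun n hn => by rw [H n hn]; exact D.inner_le (hS hn) hy
  · have h1 := H z hz.1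
    rw [Finset.sum_congr rfl hz.2] at h1
    have h2 : ∑ n ∈ S, (h - ⟪n, x⟫) ≤ 0 := by rw [Finset.sum_sub_distrib]; linarith
    have hnn : ∀ n ∈ S, 0 ≤ h - ⟪n, x⟫ := fun n hn => sub_nonneg.2 (D.inner_le (hS hn) hx)
    have h3 := (Finset.sum_eq_zero_iff_of_nonneg hnn).1 (h2.antisymm (Finset.sum_nonneg hnn)) n hn
    linarith

theorem vertices_eq (D : IsPolytopeData V N h) : vertices (convexHull ℝ (V : Set E3)) = V := by
  classical
  refine (vertices_convexHull_subset _).antisymm fun v hv => ?_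
  rw [vertices, mem_exposedPoints_iff_exposed_singleton]
  have := D.isExposed_tightSet (Finset.filter_subset (fun n => ⟪n, v⟫ = h) N)
  have h2 : tightSet V h (N.filter fun n => ⟪n, v⟫ = h) = {v} := by
    ext u
    simp only [mem_tightSet, Finset.mem_filter, Finset.mem_singleton]
    refine ⟨fun hu => D.vertex v hv u hu.1 fun n hn hnv => hu.2 n ⟨hn, hnv⟩, ?_⟩
    rintro rfl
    exact ⟨hv, fun n hn => hn.2⟩
  rwa [h2, Finset.coe_singleton, convexHull_singleton] at this

theorem normals_nonempty (D : IsPolytopeData V N h) : N.Nonempty := by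
  obtain ⟨v, _, S, w, hS, _, hc⟩ := D.exists_weights (EuclideanSpace.single 0 1)
  rcases S.eq_empty_or_nonempty with rfl | hne
  · have := congrArg (fun x : E3 => x 0) hc
    simp at this
  · exact hne.mono hS

/-- If at most one normal were needed to cut out an exposed segment, then a whole facet would lie on
a line. Conversely, two facets with two common vertices meet in a line, and no vertex on this line
lies beyond the two given ones, since vertices are not proper convex combinations of other vertices.
-/
theorem adj_iff (D : IsPolytopeData V N h) {v w : E3} :
    (edgeGraph (convexHull ℝ (V : Set E3))).Adj v w ↔ v ∈ V ∧ w ∈ V ∧ v ≠ w ∧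
      ∃ n ∈ N, ∃ n' ∈ N, n ≠ n' ∧ ⟪n, v⟫ = h ∧ ⟪n, w⟫ = h ∧ ⟪n', v⟫ = h ∧ ⟪n', w⟫ = h := by
  classical
  constructor
  · rintro ⟨hne, hex⟩
    obtain ⟨S, hS, hseg⟩ := D.exists_eq_of_isExposed hex ⟨v, left_mem_segment ℝ v w⟩
    -- An end a of the segment must be one of the tight vertices: the functional a − b is strictly
    -- smaller at all other points of the segment, hence on the hull of any set of them.
    have hend {a b : E3} (hab : a ≠ b) (hsub : ∀ u ∈ tightSet V h S, u ∈ segment ℝ a b)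
        (ha : a ∈ convexHull ℝ (tightSet V h S : Set E3)) : a ∈ tightSet V h S := by
      by_contra hmem
      refine lt_irrefl _ (inner_lt_of_mem_convexHull (n := a - b) (h := ⟪a - b, a⟫) ?_ ha)
      intro u hu
      obtain ⟨t, ht, rfl⟩ := (segment_eq_image' ℝ a b) ▸ hsub u hu
      have ht0 : t ≠ 0 := by
        rintro rfl
        apply hmem
        simpa using hu
      have htpos : 0 < t := lt_of_le_of_ne ht.1 (Ne.symm ht0)
      have hb : b - a = -(a - b) := by abel
      rw [inner_add_right, inner_smul_right, hb, inner_neg_right, real_inner_self_eq_norm_sq]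
      have : 0 < ‖a - b‖ ^ 2 := by
        have := norm_pos_iff.2 (sub_ne_zero.2 hab)
        positivity
      nlinarith
    have hsub : ∀ u ∈ tightSet V h S, u ∈ segment ℝ v w := fun u hu => by
      rw [hseg]; exact subset_convexHull ℝ _ hu
    have hv := hend hne hsub (hseg ▸ left_mem_segment ℝ v w)
    have hw := hend hne.symm (fun u hu => segment_symm ℝ v w ▸ hsub u hu)
      (hseg ▸ right_mem_segment ℝ v w)
    rw [mem_tightSet] at hv hw
    refine ⟨hv.1, hw.1, hne, ?_⟩
    by_contra hno
    have hone : ∃ n ∈ N, S ⊆ {n} := by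
      rcases S.eq_empty_or_nonempty with rfl | ⟨n, hn⟩
      · obtain ⟨n, hn⟩ := D.normals_nonempty
        exact ⟨n, hn, by simp⟩
      · refine ⟨n, hS hn, fun n' hn' => ?_⟩
        by_contra hnn
        exact hno ⟨n, hS hn, n', hS hn', fun he => hnn (by simp [he]), hv.2 n hn, hw.2 n hn,
          hv.2 n' hn', hw.2 n' hn'⟩
    obtain ⟨n, hn, hSn⟩ := hone
    obtain ⟨v₁, m₁, v₂, m₂, v₃, m₃, t₁, t₂, t₃, hli⟩ := D.facet n hn
    have hT {u : E3} (hu : u ∈ V) (hun : ⟪n, u⟫ = h) : ∃ t : ℝ, u = v + t • (w - v) := by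
      have : u ∈ tightSet V h S := mem_tightSet.2 ⟨hu, fun n' hn' => by
        rw [Finset.mem_singleton.1 (hSn hn')]; exact hun⟩
      obtain ⟨t, _, ht⟩ := (segment_eq_image' ℝ v w) ▸ hsub u this
      exact ⟨t, ht.symm⟩
    obtain ⟨a₁, e₁⟩ := hT m₁ t₁
    obtain ⟨a₂, e₂⟩ := hT m₂ t₂
    obtain ⟨a₃, e₃⟩ := hT m₃ t₃
    rw [LinearIndependent.pair_iff] at hli
    have k1 := hli (a₃ - a₁) (-(a₂ - a₁)) (by rw [e₁, e₂, e₃]; module)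
    have k2 := hli 1 0 (by
      have : a₂ - a₁ = 0 := neg_eq_zero.1 k1.2
      rw [e₁, e₂, sub_eq_zero.1 this]; module)
    exact one_ne_zero k2.1
  · rintro ⟨hv, hw, hne, n, hn, n', hn', hnn, hnv, hnw, hnv', hnw'⟩
    refine ⟨hne, ?_⟩
    have hS : ({n, n'} : Finset E3) ⊆ N := by
      intro m hm
      rcases Finset.mem_insert.1 hm with rfl | hm
      · exact hn
      · rwa [Finset.mem_singleton.1 hm]
    have hex := D.isExposed_tightSet hS
    -- Every normal active at a proper convex combination is active at both points, and the active
    -- normals determine the vertex.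
    have hstrict {a b c : E3} (ha : a ∈ V) (hb : b ∈ V) (hc : c ∈ V) {s t : ℝ} (hs : 0 < s)
        (ht : 0 < t) (hst : s + t = 1) (he : a = s • b + t • c) : b = a := by
      refine D.vertex a ha b hb fun m hm hma => ?_
      rw [he, inner_add_right, inner_smul_right, inner_smul_right] at hma
      have h1 := D.le m hm b hb
      have h2 := D.le m hm c hc
      have h3 : t * ⟪m, c⟫ ≤ t * h := mul_le_mul_of_nonneg_left h2 ht.le
      have h4 : s * h ≤ s * ⟪m, b⟫ := by
        have : s * h + t * h = h := by rw [← add_mul, hst, one_mul]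
        linarith
      exact le_antisymm h1 (le_of_mul_le_mul_left h4 hs)
    have hseg : convexHull ℝ (tightSet V h {n, n'} : Set E3) = segment ℝ v w := by
      apply subset_antisymm
      · refine convexHull_min (fun u hu => ?_) (convex_segment v w)
        obtain ⟨huV, hun⟩ := mem_tightSet.1 hu
        have u1 := hun n (by simp)
        have u2 := hun n' (by simp)
        obtain ⟨s, hs⟩ := exists_smul_of_orthogonal (d := w - v) (x := u - v)
          (linearIndependent_of_inner_eq D.pos.ne' hnn hnv hnv') (sub_ne_zero.2 hne.symm)
          (by rw [inner_sub_right, hnv, hnw, sub_self]) (by rw [inner_sub_right, hnv', hnw', sub_self])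
          (by rw [inner_sub_right, hnv, u1, sub_self]) (by rw [inner_sub_right, hnv', u2, sub_self])
        have hu' : u = v + s • (w - v) := by rw [← hs]; abel
        rcases lt_or_ge s 0 with hs0 | hs0
        · have : u = v := by
            -- For s < 0 the point v lies strictly between u and w; the weights solve u = (1 − s)v +
            -- sw for v.
            refine hstrict hv huV hw (s := 1 / (1 - s)) (t := -s / (1 - s)) (by
              apply div_pos <;> linarith) (by apply div_pos <;> linarith) ?_ ?_
            · rw [← add_div, ← sub_eq_add_neg, div_self (by linarith)]
            · have : 1 - s ≠ 0 := by linarith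
              rw [hu']
              match_scalars <;> field_simp <;> ring
          rw [this]; exact left_mem_segment ℝ v w
        · rcases lt_or_ge 1 s with hs1 | hs1
          · have : u = w := by
              refine hstrict hw huV hv (s := 1 / s) (t := (s - 1) / s) (by positivity) (by
                apply div_pos <;> linarith) ?_ ?_
              · rw [← add_div, add_sub_cancel, div_self (by linarith)]
              · have : s ≠ 0 := by linarith
                rw [hu']
                match_scalars <;> field_simp
                ring
            rw [this]; exact right_mem_segment ℝ v w
          · rw [segment_eq_image']
            exact ⟨s, ⟨hs0, hs1⟩, hu'.symm⟩
      · refine (convex_convexHull ℝ _).segment_subset (subset_convexHull ℝ _ ?_)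
          (subset_convexHull ℝ _ ?_)
        · exact mem_tightSet.2 ⟨hv, by simp [hnv, hnv']⟩
        · exact mem_tightSet.2 ⟨hw, by simp [hnw, hnw']⟩
    rwa [hseg] at hex

/-- Dimension two leaves exactly one normal. Without normals the face is the whole polytope, which
is full-dimensional because every nonzero functional is positive at some vertex; two distinct
normals confine the face to a line. -/
theorem facets_eq (D : IsPolytopeData V N h) : facets (convexHull ℝ (V : Set E3)) =
    (fun n => convexHull ℝ (tightSet V h {n} : Set E3)) '' N := by
  classical
  have horth {F : Set E3} {n : E3} (H : ∀ x ∈ F, ⟪n, x⟫ = h) {d : E3} (hd : d ∈ vectorSpan ℝ F) :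
      ⟪n, d⟫ = 0 := by
    rw [vectorSpan_def] at hd
    induction hd using Submodule.span_induction with
    | mem d hd =>
      obtain ⟨a, ha, b, hb, rfl⟩ := hd
      change ⟪n, a - b⟫ = 0
      rw [inner_sub_right, H a ha, H b hb, sub_self]
    | zero => simp
    | add a b _ _ ha hb => rw [inner_add_right, ha, hb, add_zero]
    | smul c a _ ha => rw [inner_smul_right, ha, mul_zero]
  ext F
  constructor
  · rintro ⟨hex, hrank⟩
    have hne : F.Nonempty := by
      rw [Set.nonempty_iff_ne_empty]
      rintro rfl
      rw [vectorSpan_empty, finrank_bot] at hrank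
      omega
    obtain ⟨S, hS, rfl⟩ := D.exists_eq_of_isExposed hex hne
    obtain ⟨z, hz⟩ := convexHull_nonempty_iff.1 hne
    have htight : ∀ n ∈ S, ∀ x ∈ convexHull ℝ (tightSet V h S : Set E3), ⟪n, x⟫ = h :=
      fun n hn x hx => ((D.mem_convexHull_tightSet hS).1 hx).2 n hn
    rcases S.eq_empty_or_nonempty with rfl | ⟨n, hn⟩
    · exfalso
      have hT : tightSet V h ∅ = V := by ext; simp [mem_tightSet]
      rw [hT] at hrank
      have hsum := (vectorSpan ℝ (convexHull ℝ (V : Set E3))).finrank_add_finrank_orthogonal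
      rw [hrank, finrank_euclideanSpace_fin] at hsum
      have hbot : (vectorSpan ℝ (convexHull ℝ (V : Set E3)))ᗮ ≠ ⊥ := by
        intro hb; rw [hb] at hsum; simp at hsum
      obtain ⟨c, hc, hc0⟩ := Submodule.exists_mem_ne_zero_of_ne_bot hbot
      have hpos {c : E3} (hc0 : c ≠ 0) : ∃ v ∈ V, 0 < ⟪c, v⟫ := by
        obtain ⟨v, hv, S, w, hS, hw, rfl⟩ := D.exists_weights c
        refine ⟨v, hv, ?_⟩
        rw [sum_inner]
        refine Finset.sum_pos (fun n hn => ?_) ?_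
        · rw [inner_smul_left, (hw n hn).2]
          exact mul_pos (by simpa using (hw n hn).1) D.pos
        · rw [Finset.nonempty_iff_ne_empty]
          rintro rfl
          simp at hc0
      obtain ⟨v, hv, hv0⟩ := hpos hc0
      obtain ⟨u, hu, hu0⟩ := hpos (neg_ne_zero.2 hc0)
      have h1 := (Submodule.mem_orthogonal' _ _).1 hc (v - u)
        (vsub_mem_vectorSpan ℝ (subset_convexHull ℝ _ hv) (subset_convexHull ℝ _ hu))
      rw [inner_sub_right] at h1
      rw [inner_neg_left] at hu0
      linarith
    · have hSn : S = {n} := by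
        refine Finset.eq_singleton_iff_unique_mem.2 ⟨hn, fun n' hn' => ?_⟩
        by_contra hnn
        have hzz := mem_tightSet.1 hz
        have hli := linearIndependent_of_inner_eq D.pos.ne' (Ne.symm hnn) (hzz.2 n hn)
          (hzz.2 n' hn')
        have hfr : 1 < Module.finrank ℝ (vectorSpan ℝ (convexHull ℝ (tightSet V h S : Set E3))) := by
          omega
        have hnb : vectorSpan ℝ (convexHull ℝ (tightSet V h S : Set E3)) ≠ ⊥ := by
          intro hb; rw [hb, finrank_bot] at hrank; omega
        obtain ⟨d, hd, hd0⟩ := Submodule.exists_mem_ne_zero_of_ne_bot hnb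
        have hle : vectorSpan ℝ (convexHull ℝ (tightSet V h S : Set E3)) ≤ ℝ ∙ d := by
          intro x hx
          obtain ⟨s, rfl⟩ := exists_smul_of_orthogonal hli hd0 (horth (htight n hn) hd)
            (horth (htight n' hn') hd) (horth (htight n hn) hx) (horth (htight n' hn') hx)
          exact Submodule.smul_mem _ _ (Submodule.mem_span_singleton_self d)
        have := Submodule.finrank_mono hle
        rw [finrank_span_singleton hd0] at this
        omega
      subst hSn
      exact ⟨n, hS hn, rfl⟩
  · rintro ⟨n, hn, rfl⟩
    have hS : ({n} : Finset E3) ⊆ N := by simpa using hn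
    refine ⟨D.isExposed_tightSet hS, ?_⟩
    obtain ⟨v₁, m₁, v₂, m₂, v₃, m₃, t₁, t₂, t₃, hli⟩ := D.facet n hn
    have hmem {u : E3} (hu : u ∈ V) (hun : ⟪n, u⟫ = h) :
        u ∈ convexHull ℝ (tightSet V h {n} : Set E3) :=
      subset_convexHull ℝ _ (mem_tightSet.2 ⟨hu, by simpa using hun⟩)
    apply le_antisymm
    · have hn0 : n ≠ 0 := by
        rintro rfl
        rw [inner_zero_left] at t₁
        exact D.pos.ne t₁
      have hle : vectorSpan ℝ (convexHull ℝ (tightSet V h {n} : Set E3)) ≤ (ℝ ∙ n)ᗮ := by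
        intro d hd
        rw [Submodule.mem_orthogonal_singleton_iff_inner_right]
        exact horth (fun x hx => ((D.mem_convexHull_tightSet hS).1 hx).2 n (by simp)) hd
      refine (Submodule.finrank_mono hle).trans (le_of_eq ?_)
      have hsum := (ℝ ∙ n).finrank_add_finrank_orthogonal
      rw [finrank_span_singleton hn0, finrank_euclideanSpace_fin] at hsum
      omega
    · have hle : Submodule.span ℝ (Set.range ![v₂ - v₁, v₃ - v₁]) ≤
          vectorSpan ℝ (convexHull ℝ (tightSet V h {n} : Set E3)) := by
        rw [Submodule.span_le]
        rintro _ ⟨i, rfl⟩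
        fin_cases i
        · exact vsub_mem_vectorSpan ℝ (hmem m₂ t₂) (hmem m₁ t₁)
        · exact vsub_mem_vectorSpan ℝ (hmem m₃ t₃) (hmem m₁ t₁)
      have := Submodule.finrank_mono hle
      rw [finrank_span_eq_card hli] at this
      simpa using this

theorem vertices_facet (D : IsPolytopeData V N h) (n : E3) :
    vertices (convexHull ℝ (tightSet V h {n} : Set E3)) = tightSet V h {n} := by
  refine (vertices_convexHull_subset _).antisymm fun v hv => ?_
  refine mem_vertices_of_subset (A := convexHull ℝ (V : Set E3))
    (convexHull_mono (by exact_mod_cast tightSet_subset V h {n})) ?_ (subset_convexHull ℝ _ hv)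
  rw [D.vertices_eq]
  exact tightSet_subset V h {n} hv

theorem center_facet (D : IsPolytopeData V N h) (n : E3) :
    center (convexHull ℝ (tightSet V h {n} : Set E3)) =
      ((tightSet V h {n}).card : ℝ)⁻¹ • ∑ v ∈ tightSet V h {n}, v := by
  rw [center, D.vertices_facet, Set.ncard_coe_finset, finsum_mem_coe_finset]

theorem dualPolytope_eq (D : IsPolytopeData V N h) {k : ℝ}
    (hk : ∀ n ∈ N, ∑ v ∈ tightSet V h {n}, v = (((tightSet V h {n}).card : ℝ) * k) • n) :
    dualPolytope (convexHull ℝ (V : Set E3)) = convexHull ℝ ((fun n => k • n) '' (N : Set E3)) := by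
  rw [dualPolytope, D.facets_eq, Set.image_image]
  congr 1
  refine Set.image_congr fun n hn => ?_
  obtain ⟨v₁, m₁, -, -, -, -, t₁, -, -, -⟩ := D.facet n hn
  have hne : ((tightSet V h {n}).card : ℝ) ≠ 0 := by
    rw [Nat.cast_ne_zero, Finset.card_ne_zero]
    exact ⟨v₁, mem_tightSet.2 ⟨m₁, by simpa using t₁⟩⟩
  rw [D.center_facet, hk n hn, smul_smul, ← mul_assoc, inv_mul_cancel₀ hne, one_mul]

end IsPolytopeData

/-! ### Existence of Euler cycles -/

section Euler

variable {V : Type*} {G : SimpleGraph V}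

/-- In a connected graph, a walk that misses an edge has a vertex incident with a missed edge. -/
theorem exists_missed_edge_at_support {u v a b : V} (p : G.Walk u v) (hab : G.Adj a b)
    (hr : G.Reachable u a) (hm : s(a, b) ∉ p.edges) :
    ∃ x ∈ p.support, ∃ y, G.Adj x y ∧ s(x, y) ∉ p.edges := by
  by_contra! hcon
  have hclosed {x y : V} (q : G.Walk x y) (hx : x ∈ p.support) : y ∈ p.support := by
    induction q with
    | nil => exact hx
    | cons h q ih => exact ih (p.snd_mem_support_of_mem_edges (hcon _ hx _ h))
  obtain ⟨q⟩ := hr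
  exact hm (hcon a (hclosed q p.start_mem_support) b hab)

/-- In a connected graph, there is a closed walk running twice through every edge. -/
theorem exists_double_walk [DecidableEq V] (hfin : G.edgeSet.Finite) (v₀ : V)
    (hconn : ∀ a b, G.Adj a b → G.Reachable v₀ a) :
    ∃ w : G.Walk v₀ v₀, ∀ e ∈ G.edgeSet, w.edges.count e = 2 := by
  -- Induction on the number of edges not yet used, for closed walks that use every edge either not
  -- at all or twice.
  have key : ∀ k : ℕ, ∀ w : G.Walk v₀ v₀, (∀ e, w.edges.count e = 0 ∨ w.edges.count e = 2) →
      (hfin.toFinset.filter fun e => w.edges.count e = 0).card = k →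
      ∃ w : G.Walk v₀ v₀, ∀ e ∈ G.edgeSet, w.edges.count e = 2 := by
    intro k
    induction k using Nat.strong_induction_on with
    | _ k ih =>
      intro w hw hk
      by_cases hall : ∀ e ∈ G.edgeSet, w.edges.count e = 2
      · exact ⟨w, hall⟩
      push Not at hall
      obtain ⟨e, he, hne⟩ := hall
      induction e with | _ a b => ?_
      have h0 : s(a, b) ∉ w.edges := List.count_eq_zero.1 ((hw _).resolve_right hne)
      obtain ⟨x, hx, y, hxy, hm⟩ :=
        exists_missed_edge_at_support w (G.mem_edgeSet.1 he) (hconn a b he) h0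
      -- The walk is extended by a detour along a missed edge and back, inserted at a vertex where
      -- the walk already passes.
      have hcount (e : Sym2 V) : ((w.takeUntil x hx).append (SimpleGraph.Walk.cons hxy
          (SimpleGraph.Walk.cons hxy.symm (w.dropUntil x hx)))).edges.count e =
          w.edges.count e + if s(x, y) = e then 2 else 0 := by
        conv_rhs => rw [← w.take_spec hx]
        simp only [SimpleGraph.Walk.edges_append, SimpleGraph.Walk.edges_cons, List.count_append,
          List.count_cons, Sym2.eq_swap (a := y), beq_iff_eq]
        split_ifs <;> omega
      have hxy0 := List.count_eq_zero.2 hm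
      refine ih _ ?_ ((w.takeUntil x hx).append (SimpleGraph.Walk.cons hxy
          (SimpleGraph.Walk.cons hxy.symm (w.dropUntil x hx)))) (fun e => ?_) rfl
      · rw [← hk]
        apply Finset.card_lt_card
        refine Finset.ssubset_iff_of_subset ?_ |>.2 ⟨s(x, y), ?_, ?_⟩
        · intro e he
          rw [Finset.mem_filter, hcount] at he
          rw [Finset.mem_filter]
          exact ⟨he.1, by omega⟩
        · simpa [Finset.mem_filter, hxy0] using hxy
        · rw [Finset.mem_filter, hcount]; simp
      · rw [hcount]
        split_ifs with h
        · subst h; omega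
        · simpa using hw e
  exact key _ SimpleGraph.Walk.nil (by simp) rfl

/-- In a connected graph with even degrees, there is a closed walk running once through every
edge. -/
theorem exists_euler_walk [DecidableEq V] (hfin : G.edgeSet.Finite) (v₀ v₁ : V) (h₀ : G.Adj v₀ v₁)
    (hconn : ∀ a b, G.Adj a b → G.Reachable v₀ a)
    (heven : ∀ v, Even (G.neighborSet v).ncard) :
    ∃ (v : V) (w : G.Walk v v), ∀ e ∈ G.edgeSet, w.edges.count e = 1 := by
  have : Nonempty V := ⟨v₀⟩
  have : Finite G.edgeSet := hfin
  -- A trail of maximal length does it. At its end all edges are used, so by parity it is closed. It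
  -- misses no edge, because the closed trail could be rotated to start at an end of a missed edge
  -- and then be prolonged.
  obtain ⟨u, v, p, hp, hmax⟩ :=
    SimpleGraph.Walk.exists_isTrail_forall_isTrail_length_le_length G
  have huv : u = v := by
    by_contra hne
    have hodd : ¬ Even (p.edges.countP fun e => v ∈ e) := by
      rw [hp.even_countP_edges_iff]
      exact fun h => (h hne).2 rfl
    apply hodd
    have hall : ∀ y, G.Adj v y → s(v, y) ∈ p.edges := by
      intro y hy
      by_contra hmem
      have ht : (SimpleGraph.Walk.cons hy.symm p.reverse).IsTrail := by
        rw [SimpleGraph.Walk.isTrail_cons]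
        exact ⟨SimpleGraph.Walk.IsTrail.reverse _ hp, by simpa [Sym2.eq_swap] using hmem⟩
      have := hmax _ _ _ ht
      simp at this
    have hset : (p.edges.filter fun e => v ∈ e).toFinset = ((fun y => s(v, y)) '' G.neighborSet v) := by
      ext e
      simp only [List.coe_toFinset, Set.mem_ofPred_eq, List.mem_filter, decide_eq_true_eq,
        Set.mem_image, SimpleGraph.mem_neighborSet]
      constructor
      · rintro ⟨he, hve⟩
        obtain ⟨y, rfl⟩ := Sym2.mem_iff_exists.1 hve
        exact ⟨y, p.adj_of_mem_edges he, rfl⟩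
      · rintro ⟨y, hy, rfl⟩
        exact ⟨hall y hy, by simp⟩
    have hcard := congrArg Set.ncard hset
    rw [Set.ncard_coe_finset, List.toFinset_card_of_nodup (hp.edges_nodup.filter _),
      Set.ncard_image_of_injective _ (fun a b hab => Sym2.congr_right.1 hab)] at hcard
    rw [List.countP_eq_length_filter, hcard]
    exact heven v
  subst huv
  refine ⟨u, p, fun e he => hp.count_edges_eq_one ?_⟩
  induction e with | _ a b => ?_
  by_contra hm
  have hu : G.Reachable v₀ u := by
    have hpos : 0 < p.length := by
      have ht : (SimpleGraph.Walk.cons h₀ SimpleGraph.Walk.nil).IsTrail := by simp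
      have := hmax _ _ _ ht
      simp at this
      omega
    cases p with
    | nil => simp at hpos
    | cons h q => exact hconn _ _ h
  obtain ⟨x, hx, y, hxy, hxm⟩ := exists_missed_edge_at_support p he
    (hu.symm.trans (hconn a b he)) hm
  have ht : (SimpleGraph.Walk.cons hxy.symm (p.rotate x hx)).IsTrail := by
    rw [SimpleGraph.Walk.isTrail_cons]
    refine ⟨hp.rotate hx, fun h => hxm ?_⟩
    rw [(p.rotate_edges x hx).mem_iff] at h
    rwa [Sym2.eq_swap]
  have := hmax _ _ _ ht
  have hl : (p.rotate x hx).length = p.length := by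
    rw [← SimpleGraph.Walk.length_edges, ← SimpleGraph.Walk.length_edges]
    exact (p.rotate_edges x hx).perm.length_eq
  rw [SimpleGraph.Walk.length_cons, hl] at this
  omega

end Euler

namespace IsPolytopeData

variable {V N : Finset E3} {h : ℝ}

theorem finite_edgeSet (D : IsPolytopeData V N h) :
    (edgeGraph (convexHull ℝ (V : Set E3))).edgeSet.Finite := by
  refine ((V.finite_toSet.prod V.finite_toSet).image fun x : E3 × E3 => s(x.1, x.2)).subset ?_
  intro e he
  induction e with | _ a b => ?_
  obtain ⟨ha, hb, -⟩ := D.adj_iff.1 he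
  exact ⟨(a, b), ⟨ha, hb⟩, rfl⟩

theorem exists_eulerCycle (D : IsPolytopeData V N h) {v₀ v₁ : E3}
    (h₀ : (edgeGraph (convexHull ℝ (V : Set E3))).Adj v₀ v₁)
    (hconn : ∀ v ∈ V, (edgeGraph (convexHull ℝ (V : Set E3))).Reachable v₀ v) :
    ∃ (v : E3) (w : (edgeGraph (convexHull ℝ (V : Set E3))).Walk v v),
      IsEulerCycle (convexHull ℝ (V : Set E3)) w := by
  classical
  have hconn' : ∀ a b, (edgeGraph (convexHull ℝ (V : Set E3))).Adj a b →
      (edgeGraph (convexHull ℝ (V : Set E3))).Reachable v₀ a :=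
    fun a b hab => hconn a (D.adj_iff.1 hab).1
  by_cases hE : ∀ v ∈ vertices (convexHull ℝ (V : Set E3)),
      Even ((edgeGraph (convexHull ℝ (V : Set E3))).neighborSet v).ncard
  · have heven : ∀ v, Even ((edgeGraph (convexHull ℝ (V : Set E3))).neighborSet v).ncard := by
      intro v
      by_cases hv : v ∈ V
      · exact hE v (by rw [D.vertices_eq]; exact hv)
      · have : (edgeGraph (convexHull ℝ (V : Set E3))).neighborSet v = ∅ := by
          ext y
          simp only [SimpleGraph.mem_neighborSet, Set.mem_empty_iff_false, iff_false]
          exact fun hy => hv (D.adj_iff.1 hy).1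
        rw [this, Set.ncard_empty]
        exact Even.zero
    obtain ⟨v, w, hw⟩ := exists_euler_walk D.finite_edgeSet v₀ v₁ h₀ hconn' heven
    refine ⟨v, w, fun e he => ?_⟩
    rw [edgeMultiplicity, if_pos hE]
    convert hw e he
  · obtain ⟨w, hw⟩ := exists_double_walk D.finite_edgeSet v₀ hconn'
    refine ⟨v₀, w, fun e he => ?_⟩
    rw [edgeMultiplicity, if_neg hE]
    convert hw e he

/-- The image under a similarity. -/
theorem map (D : IsPolytopeData V N h) {r : ℝ} (hr : 0 < r) (O : E3 ≃ₗᵢ[ℝ] E3)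
    {V' N' : Finset E3} (hV : (V' : Set E3) = (fun x => r • O x) '' V)
    (hN : (N' : Set E3) = O '' N) : IsPolytopeData V' N' (r * h) := by
  have memV {x : E3} : x ∈ V' ↔ ∃ v ∈ V, r • O v = x := by
    rw [← Finset.mem_coe, hV]; rfl
  have memN {x : E3} : x ∈ N' ↔ ∃ n ∈ N, O n = x := by
    rw [← Finset.mem_coe, hN]; rfl
  have hin (n v : E3) : ⟪O n, r • O v⟫ = r * ⟪n, v⟫ := by
    rw [inner_smul_right, O.inner_map_map]
  have htight (n v : E3) : ⟪O n, r • O v⟫ = r * h ↔ ⟪n, v⟫ = h := by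
    rw [hin, mul_right_inj' hr.ne']
  refine ⟨mul_pos hr D.pos, ?_, ?_, ?_, ?_⟩
  · intro n' hn' v' hv'
    obtain ⟨n, hn, rfl⟩ := memN.1 hn'
    obtain ⟨v, hv, rfl⟩ := memV.1 hv'
    rw [hin]
    exact mul_le_mul_of_nonneg_left (D.le n hn v hv) hr.le
  · intro c
    obtain ⟨v, hv, hc⟩ := D.fan (O.symm c)
    refine ⟨r • O v, memV.2 ⟨v, hv, rfl⟩, ?_⟩
    have := Submodule.apply_mem_span_image_of_mem_span
      ((O.toLinearEquiv : E3 →ₗ[ℝ] E3).restrictScalars NNReal) hc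
    simp only [LinearMap.coe_restrictScalars, LinearEquiv.coe_coe,
      LinearIsometryEquiv.coe_toLinearEquiv, LinearIsometryEquiv.apply_symm_apply] at this
    refine Submodule.span_mono ?_ this
    rintro _ ⟨n, ⟨hn, hnv⟩, rfl⟩
    exact ⟨memN.2 ⟨n, hn, rfl⟩, (htight n v).2 hnv⟩
  · intro v' hv' u' hu' H
    obtain ⟨v, hv, rfl⟩ := memV.1 hv'
    obtain ⟨u, hu, rfl⟩ := memV.1 hu'
    rw [D.vertex v hv u hu fun n hn hnv =>
      (htight n u).1 (H (O n) (memN.2 ⟨n, hn, rfl⟩) ((htight n v).2 hnv))]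
  · intro n' hn'
    obtain ⟨n, hn, rfl⟩ := memN.1 hn'
    obtain ⟨v₁, m₁, v₂, m₂, v₃, m₃, t₁, t₂, t₃, hli⟩ := D.facet n hn
    refine ⟨_, memV.2 ⟨v₁, m₁, rfl⟩, _, memV.2 ⟨v₂, m₂, rfl⟩, _, memV.2 ⟨v₃, m₃, rfl⟩,
      (htight _ _).2 t₁, (htight _ _).2 t₂, (htight _ _).2 t₃, ?_⟩
    rw [LinearIndependent.pair_iff] at hli ⊢
    intro a b hab
    apply hli a b
    have : r • O (a • (v₂ - v₁) + b • (v₃ - v₁)) = 0 := by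
      rw [← hab]
      simp only [map_add, map_smul, map_sub]
      module
    rw [smul_eq_zero, or_iff_right hr.ne'] at this
    exact (LinearIsometryEquiv.map_eq_zero_iff O).1 this

end IsPolytopeData

/-! ### Integration along the edges of a polytope -/

/-- The integral along the outward projection of an edge. -/
def edgeIntegral (f : E3 → ℝ) : Sym2 E3 → ℝ :=
  Sym2.lift ⟨fun v w => arcIntegral f (proj v) (proj w), fun _ _ => arcIntegral_comm _ _ _⟩

@[simp] theorem edgeIntegral_mk (f : E3 → ℝ) (v w : E3) :
    edgeIntegral f s(v, w) = arcIntegral f (proj v) (proj w) := rfl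

/-- The edges whose projections are geodesic arcs. -/
def IsGoodEdge (e : Sym2 E3) : Prop :=
  ∃ v w, e = s(v, w) ∧ v ≠ 0 ∧ w ≠ 0 ∧ |⟪proj v, proj w⟫| < 1

theorem norm_proj {v : E3} (hv : v ≠ 0) : ‖proj v‖ = 1 := by
  rw [proj, norm_smul, norm_inv, norm_norm, inv_mul_cancel₀ (norm_ne_zero_iff.2 hv)]

theorem proj_smul_map (O : E3 ≃ₗᵢ[ℝ] E3) {r : ℝ} (hr : 0 < r) (v : E3) :
    proj (r • O v) = O (proj v) := by
  rw [proj, proj, map_smul, norm_smul, O.norm_map, Real.norm_of_nonneg hr.le, smul_smul]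
  congr 1
  field_simp

theorem proj_map (O : E3 ≃ₗᵢ[ℝ] E3) (v : E3) : proj (O v) = O (proj v) := by
  simpa using proj_smul_map O one_pos v

theorem isGoodEdge_mk {v w : E3} : IsGoodEdge s(v, w) ↔ v ≠ 0 ∧ w ≠ 0 ∧ |⟪proj v, proj w⟫| < 1 := by
  constructor
  · rintro ⟨a, b, hab, ha, hb, h⟩
    rcases Sym2.eq_iff.1 hab with ⟨rfl, rfl⟩ | ⟨rfl, rfl⟩
    · exact ⟨ha, hb, h⟩
    · exact ⟨hb, ha, by rwa [real_inner_comm]⟩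
  · rintro ⟨hv, hw, h⟩
    exact ⟨v, w, rfl, hv, hw, h⟩

theorem chainSum_support {G : SimpleGraph E3} {u v : E3} (w : G.Walk u v) (f : E3 → ℝ) :
    chainSum (arcIntegral f) (w.support.map proj) = (w.edges.map (edgeIntegral f)).sum := by
  induction w with
  | nil => simp [chainSum]
  | cons h p ih =>
    cases p with
    | nil => simp [chainSum]
    | cons h' q =>
      simp only [SimpleGraph.Walk.support_cons, List.map_cons, SimpleGraph.Walk.edges_cons,
        List.sum_cons, edgeIntegral_mk, chainSum] at ih ⊢
      rw [← ih]

theorem isGoodChain_support {G : SimpleGraph E3} (hG : ∀ e ∈ G.edgeSet, IsGoodEdge e) {u v : E3}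
    (hu : u ≠ 0) (w : G.Walk u v) : IsGoodChain (w.support.map proj) := by
  induction w with
  | nil => simp [IsGoodChain, norm_proj hu]
  | cons h p ih =>
    obtain ⟨h1, h2, h3⟩ := isGoodEdge_mk.1 (hG _ h)
    have ih := ih h2
    refine ⟨?_, ?_⟩
    · simp only [SimpleGraph.Walk.support_cons, List.map_cons, List.mem_cons]
      rintro x (rfl | hx)
      · exact norm_proj h1
      · exact ih.1 x hx
    · cases p with
      | nil => simpa using h3
      | cons h' q =>
        simp only [SimpleGraph.Walk.support_cons, List.map_cons, List.isChain_cons_cons] at ih ⊢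
        refine ⟨h3, ?_⟩
        simpa using ih.2

/-- All edges are traversed the same number of times, once or twice, and this number cancels between
the path integral and the arc length. The design property thus becomes a statement on sums over
edges. -/
theorem isHybridDesign_of_eulerCycle {P Q : Set E3} {s : ℕ} {β : ℝ} (E : Finset (Sym2 E3))
    (hE : (E : Set (Sym2 E3)) = (edgeGraph P).edgeSet) (hne : E.Nonempty)
    (hgood : ∀ e ∈ E, IsGoodEdge e) (hfin : (proj '' vertices Q).Finite)
    (hsub : proj '' vertices Q ⊆ Metric.sphere (0 : E3) 1) (h0 : 0 ≤ β) (h1 : β ≤ 1)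
    (hdesign : ∀ p : MvPolynomial (Fin 3) ℝ, p.totalDegree ≤ s →
      β / ((proj '' vertices Q).ncard : ℝ) * (∑ᶠ x ∈ proj '' vertices Q, evalPoly p x) +
        (1 - β) / (∑ e ∈ E, edgeIntegral (fun _ => 1) e) * ∑ e ∈ E, edgeIntegral (evalPoly p) e =
        sphereMean (evalPoly p))
    (v : E3) (w : (edgeGraph P).Walk v v) (hw : IsEulerCycle P w) :
    IsHybridDesign s β (chainLength (w.support.map proj)) (geodesicChain (w.support.map proj))
      (proj '' vertices Q) := by
  classical
  have hm : edgeMultiplicity P ≠ 0 := by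
    unfold edgeMultiplicity; split_ifs <;> decide
  have hw' : ∀ e ∈ E, w.edges.count e = edgeMultiplicity P := fun e he => by
    have := hw e (hE ▸ he)
    convert this
  have hgoodG : ∀ e ∈ (edgeGraph P).edgeSet, IsGoodEdge e := fun e he => hgood e (by
    rw [← hE] at he; exact he)
  have hset : w.edges.toFinset = E := by
    ext e
    rw [List.mem_toFinset]
    constructor
    · intro he
      have := w.edges_subset_edgeSet he
      rw [← hE] at this
      exact this
    · intro he
      rw [← List.count_pos_iff, hw' e he]
      exact Nat.pos_of_ne_zero hm
  have hsum (f : E3 → ℝ) : chainSum (arcIntegral f) (w.support.map proj) =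
      edgeMultiplicity P * ∑ e ∈ E, edgeIntegral f e := by
    rw [chainSum_support, Finset.sum_list_map_count, hset, Finset.mul_sum]
    refine Finset.sum_congr rfl fun e he => ?_
    rw [hw' e he, nsmul_eq_mul]
  obtain ⟨x, y, l, hl, hlast⟩ : ∃ x y l, w.support.map proj = x :: y :: l ∧
      (w.support.map proj).getLast? = some x := by
    cases w with
    | nil =>
      exfalso
      simp only [SimpleGraph.Walk.edges_nil, List.toFinset_nil] at hset
      exact hne.ne_empty hset.symm
    | cons h p =>
      cases p with
      | nil => exact absurd h ((edgeGraph P).loopless.irrefl _)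
      | cons h' q =>
        refine ⟨_, _, _, rfl, ?_⟩
        rw [List.getLast?_map, List.getLast?_eq_some_getLast (by simp)]
        rw [SimpleGraph.Walk.getLast_support]
        rfl
  have hv : v ≠ 0 := by
    cases w with
    | nil => simp at hl
    | cons h p => exact (isGoodEdge_mk.1 (hgoodG _ h)).1
  have hchain := isGoodChain_support hgoodG hv w
  have hlen : arcLength (chainLength (w.support.map proj)) (geodesicChain (w.support.map proj)) =
      edgeMultiplicity P * ∑ e ∈ E, edgeIntegral (fun _ => 1) e := by
    rw [← hsum, arcLength]
    rw [hl] at hchain ⊢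
    exact pathIntegral_eq_chainSum hchain continuous_const
  have hint (p : MvPolynomial (Fin 3) ℝ) :
      pathIntegral (chainLength (w.support.map proj)) (geodesicChain (w.support.map proj))
        (evalPoly p) = edgeMultiplicity P * ∑ e ∈ E, edgeIntegral (evalPoly p) e := by
    rw [← hsum]
    rw [hl] at hchain ⊢
    exact pathIntegral_eq_chainSum hchain (continuous_evalPoly p)
  refine ⟨?_, hfin, hsub, h0, h1, fun p hp => ?_⟩
  · rw [hl] at hchain hlast ⊢
    refine isSphericalCurve_geodesicChain hchain ?_
    rw [List.getLast?_eq_some_getLast (by simp)] at hlast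
    exact Option.some.inj hlast
  · rw [← hdesign p hp, hlen, hint]
    have : (edgeMultiplicity P : ℝ) ≠ 0 := by exact_mod_cast hm
    rw [div_mul_eq_mul_div, div_mul_eq_mul_div, div_mul_eq_mul_div, mul_left_comm (1 - β),
      mul_div_mul_left _ _ this]

theorem arcIntegral_add (f g : C(E3, ℝ)) (x y : E3) :
    arcIntegral (⇑f + ⇑g) x y = arcIntegral f x y + arcIntegral g x y := by
  have hf : Continuous fun t => f (geodesicArc x y t) := by fun_prop
  have hg : Continuous fun t => g (geodesicArc x y t) := by fun_prop
  exact intervalIntegral.integral_add (hf.intervalIntegrable _ _) (hg.intervalIntegrable _ _)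

theorem arcIntegral_smul (c : ℝ) (f : C(E3, ℝ)) (x y : E3) :
    arcIntegral (c • ⇑f) x y = c * arcIntegral f x y :=
  intervalIntegral.integral_const_mul _ _

/-- The weighted average over the projections of the points `N` and of the edges `E`. -/
def hybridFunctional (β : ℝ) (N : Finset E3) (E : Finset (Sym2 E3)) : C(E3, ℝ) →ₗ[ℝ] ℝ where
  toFun f := β / N.card * ∑ n ∈ N, f (proj n) +
    (1 - β) / (∑ e ∈ E, edgeIntegral (fun _ => 1) e) * ∑ e ∈ E, edgeIntegral f e
  map_add' f g := by
    have : ∀ e, edgeIntegral (⇑(f + g)) e = edgeIntegral f e + edgeIntegral g e := fun e => by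
      induction e with | _ v w => exact arcIntegral_add f g _ _
    simp only [this, ContinuousMap.add_apply, Finset.sum_add_distrib]
    ring
  map_smul' c f := by
    have : ∀ e, edgeIntegral (⇑(c • f)) e = c * edgeIntegral f e := fun e => by
      induction e with | _ v w => exact arcIntegral_smul c f _ _
    simp only [this, ContinuousMap.smul_apply, smul_eq_mul, ← Finset.mul_sum, RingHom.id_apply]
    ring

theorem hybridFunctional_apply (β : ℝ) (N : Finset E3) (E : Finset (Sym2 E3)) (f : C(E3, ℝ)) :
    hybridFunctional β N E f = β / N.card * ∑ n ∈ N, f (proj n) +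
    (1 - β) / (∑ e ∈ E, edgeIntegral (fun _ => 1) e) * ∑ e ∈ E, edgeIntegral f e := rfl

section HybridFunctional

variable {β : ℝ} {N : Finset E3} {E : Finset (Sym2 E3)}

theorem edgeIntegral_one_pos {e : Sym2 E3} (he : IsGoodEdge e) :
    0 < edgeIntegral (fun _ => 1) e := by
  obtain ⟨v, w, rfl, -, -, h⟩ := he
  rw [edgeIntegral_mk, arcIntegral_one]
  exact sphDist_pos h

theorem hybridFunctional_isSpherical (hN : ∀ n ∈ N, n ≠ 0) (hE : ∀ e ∈ E, IsGoodEdge e) :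
    IsSpherical (hybridFunctional β N E) := by
  intro f g hfg
  rw [hybridFunctional_apply, hybridFunctional_apply]
  congr 2
  · exact Finset.sum_congr rfl fun n hn => hfg _ (mem_sphere_zero_iff_norm.2 (norm_proj (hN n hn)))
  · refine Finset.sum_congr rfl fun e he => ?_
    obtain ⟨v, w, rfl, hv, hw, h⟩ := hE e he
    rw [edgeIntegral_mk, edgeIntegral_mk, arcIntegral, arcIntegral]
    congr 1
    ext t
    exact hfg _ (mem_sphere_zero_iff_norm.2 (norm_geodesicArc (norm_proj hv) (norm_proj hw) h t))

theorem edgeIntegral_map (O : E3 ≃ₗᵢ[ℝ] E3) {r : ℝ} (hr : 0 < r) (f : E3 → ℝ) (e : Sym2 E3) :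
    edgeIntegral f (e.map fun x => r • O x) = edgeIntegral (fun x => f (O x)) e := by
  induction e with | _ v w => ?_
  rw [Sym2.map_mk, edgeIntegral_mk, edgeIntegral_mk, proj_smul_map O hr, proj_smul_map O hr,
    arcIntegral_map]

/-- An injective map of a finite set into itself is a permutation, so it suffices that points and
edges are mapped into themselves. -/
theorem hybridFunctional_isInvariant {O : E3 ≃ₗᵢ[ℝ] E3} (hN : ∀ n ∈ N, O n ∈ N)
    (hE : ∀ e ∈ E, e.map O ∈ E) : IsInvariant (hybridFunctional β N E) O := by
  classical
  intro f
  rw [hybridFunctional_apply, hybridFunctional_apply]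
  have hN' : N.image O = N := Finset.eq_of_subset_of_card_le
    (Finset.image_subset_iff.2 hN) (Finset.card_image_of_injective _ O.injective).ge
  have hE' : E.image (Sym2.map O) = E := Finset.eq_of_subset_of_card_le
    (Finset.image_subset_iff.2 hE)
    (Finset.card_image_of_injective _ (Sym2.map.injective O.injective)).ge
  congr 2
  · conv_rhs => rw [← hN']
    rw [Finset.sum_image O.injective.injOn]
    exact Finset.sum_congr rfl fun n _ => by rw [proj_map]; rfl
  · conv_rhs => rw [← hE']
    rw [Finset.sum_image (Sym2.map.injective O.injective).injOn]
    refine Finset.sum_congr rfl fun e _ => ?_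
    have := edgeIntegral_map O one_pos f e
    simp only [one_smul] at this
    exact this.symm

theorem hybridFunctional_of_const {f : C(E3, ℝ)} (hN : N.Nonempty) (hE : E.Nonempty) {a θ J : ℝ}
    (hf : ∀ n ∈ N, f (proj n) = a) (hθ : ∀ e ∈ E, edgeIntegral (fun _ => 1) e = θ)
    (hJ : ∀ e ∈ E, edgeIntegral f e = J) :
    hybridFunctional β N E f = β * a + (1 - β) / θ * J := by
  rw [hybridFunctional_apply, Finset.sum_congr rfl hf, Finset.sum_congr rfl hθ,
    Finset.sum_congr rfl hJ]
  have h1 : (N.card : ℝ) ≠ 0 := by exact_mod_cast hN.card_ne_zero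
  have h2 : (E.card : ℝ) ≠ 0 := by exact_mod_cast hE.card_ne_zero
  simp only [Finset.sum_const, nsmul_eq_mul]
  congr 1
  · field_simp
  · rw [div_mul_eq_mul_div, div_mul_eq_mul_div, mul_left_comm, mul_div_mul_left _ _ h2]

theorem hybridFunctional_one (hN : N.Nonempty) (hE : E.Nonempty) (hg : ∀ e ∈ E, IsGoodEdge e) :
    hybridFunctional β N E (mono 0 0 0) = 1 := by
  rw [hybridFunctional_apply]
  have h1 : (N.card : ℝ) ≠ 0 := by exact_mod_cast hN.card_ne_zero
  have h2 : 0 < ∑ e ∈ E, edgeIntegral (fun _ => 1) e :=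
    Finset.sum_pos (fun e he => edgeIntegral_one_pos (hg e he)) hE
  have h3 : ⇑(mono 0 0 0) = fun _ => 1 := by ext; simp
  rw [h3]
  simp only [Finset.sum_const, nsmul_eq_mul, mul_one]
  field_simp
  ring

end HybridFunctional

/-! ### Polytopes given by vertices, facet normals and the inner product of adjacent vertices -/

open Classical in
/-- The pairs of points of `V` with inner product `t`. -/
def edgePairs (V : Finset E3) (t : ℝ) : Finset (Sym2 E3) :=
  ((V ×ˢ V).filter fun x => ⟪x.1, x.2⟫ = t).image fun x => s(x.1, x.2)

theorem mk_mem_edgePairs {V : Finset E3} {t : ℝ} {v w : E3} :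
    s(v, w) ∈ edgePairs V t ↔ v ∈ V ∧ w ∈ V ∧ ⟪v, w⟫ = t := by
  classical
  simp only [edgePairs, Finset.mem_image, Finset.mem_filter, Finset.mem_product, Prod.exists]
  constructor
  · rintro ⟨a, b, ⟨⟨ha, hb⟩, hab⟩, he⟩
    rcases Sym2.eq_iff.1 he with ⟨rfl, rfl⟩ | ⟨rfl, rfl⟩
    · exact ⟨ha, hb, hab⟩
    · exact ⟨hb, ha, by rwa [real_inner_comm]⟩
  · rintro ⟨hv, hw, h⟩
    exact ⟨v, w, ⟨⟨hv, hw⟩, h⟩, rfl⟩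

theorem map_mem_edgePairs {V : Finset E3} {t : ℝ} {O : E3 ≃ₗᵢ[ℝ] E3} (hV : ∀ v ∈ V, O v ∈ V)
    {e : Sym2 E3} (he : e ∈ edgePairs V t) : e.map O ∈ edgePairs V t := by
  induction e with | _ v w => ?_
  rw [mk_mem_edgePairs] at he
  rw [Sym2.map_mk, mk_mem_edgePairs, O.inner_map_map]
  exact ⟨hV _ he.1, hV _ he.2.1, he.2.2⟩

/-- The facet normals `N` have common norm, the facet with normal `n` has the center `k • n`, and
two vertices are adjacent when their inner product is `t`. -/
structure IsHybridData (V N : Finset E3) (h t k : ℝ) : Prop extends IsPolytopeData V N h where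
  adj : ∀ v ∈ V, ∀ w ∈ V, (⟪v, w⟫ = t ↔ v ≠ w ∧ ∃ n ∈ N, ∃ n' ∈ N, n ≠ n' ∧ ⟪n, v⟫ = h ∧
    ⟪n, w⟫ = h ∧ ⟪n', v⟫ = h ∧ ⟪n', w⟫ = h)
  k_pos : 0 < k
  center : ∀ n ∈ N, ∑ v ∈ tightSet V h {n}, v = (((tightSet V h {n}).card : ℝ) * k) • n
  conn : ∃ v₀ ∈ V, ∃ v₁ ∈ V, ⟪v₀, v₁⟫ = t ∧
    ∀ v ∈ V, Relation.ReflTransGen (fun a b => a ∈ V ∧ b ∈ V ∧ ⟪a, b⟫ = t) v₀ v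
  norm_eq : ∃ ρ : ℝ, ∀ n ∈ N, ‖n‖ = ρ

namespace IsHybridData

variable {V N : Finset E3} {h t k : ℝ}

theorem adj_iff' (D : IsHybridData V N h t k) {v w : E3} :
    (edgeGraph (convexHull ℝ (V : Set E3))).Adj v w ↔ v ∈ V ∧ w ∈ V ∧ ⟪v, w⟫ = t := by
  rw [D.adj_iff]
  constructor
  · rintro ⟨hv, hw, H⟩
    exact ⟨hv, hw, (D.adj v hv w hw).2 H⟩
  · rintro ⟨hv, hw, H⟩
    exact ⟨hv, hw, (D.adj v hv w hw).1 H⟩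

theorem normal_ne_zero (D : IsHybridData V N h t k) : ∀ n ∈ N, n ≠ 0 := by
  rintro n hn rfl
  obtain ⟨v, -, -, -, -, -, hv, -⟩ := D.facet 0 hn
  rw [inner_zero_left] at hv
  exact D.pos.ne hv

/-- If the projections were equal or opposite, then w would be a multiple of v. The two share a
facet, whose positive offset forces the factor to be one, but the ends of an edge are distinct. -/
theorem isGoodEdge (D : IsHybridData V N h t k) : ∀ e ∈ edgePairs V t, IsGoodEdge e := by
  intro e he
  induction e with | _ v w => ?_
  obtain ⟨hv, hw, hvw⟩ := mk_mem_edgePairs.1 he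
  obtain ⟨hne, n, hn, n', hn', -, h1, h2, -, -⟩ := (D.adj v hv w hw).1 hvw
  have hv0 : v ≠ 0 := by rintro rfl; rw [inner_zero_right] at h1; exact D.pos.ne h1
  have hw0 : w ≠ 0 := by rintro rfl; rw [inner_zero_right] at h2; exact D.pos.ne h2
  refine isGoodEdge_mk.2 ⟨hv0, hw0, ?_⟩
  have hle : |⟪proj v, proj w⟫| ≤ 1 := by
    have := abs_real_inner_le_norm (proj v) (proj w)
    rwa [norm_proj hv0, norm_proj hw0, one_mul] at this
  refine lt_of_le_of_ne hle fun heq => ?_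
  have hpv : proj v ≠ 0 := by rw [← norm_ne_zero_iff, norm_proj hv0]; exact one_ne_zero
  have hpar : ∃ r : ℝ, r ≠ 0 ∧ proj w = r • proj v :=
    (abs_real_inner_div_norm_mul_norm_eq_one_iff (proj v) (proj w)).1 (by
      rw [norm_proj hv0, norm_proj hw0, mul_one, div_one, heq]) |>.2
  obtain ⟨r, -, hr⟩ := hpar
  have hnw : ‖w‖ ≠ 0 := norm_ne_zero_iff.2 hw0
  have hw' : w = (‖w‖ * r * ‖v‖⁻¹) • v := by
    have := congrArg (fun x => ‖w‖ • x) hr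
    simp only [proj, smul_smul, mul_inv_cancel₀ hnw, one_smul] at this
    rw [mul_assoc]
    exact this
  have hc : ‖w‖ * r * ‖v‖⁻¹ = 1 := by
    rw [hw', inner_smul_right, h1] at h2
    exact (mul_eq_right₀ D.pos.ne').1 h2
  rw [hc, one_smul] at hw'
  exact hne hw'.symm

theorem edgePairs_nonempty (D : IsHybridData V N h t k) : (edgePairs V t).Nonempty := by
  obtain ⟨v, hv, w, hw, hvw, -⟩ := D.conn
  exact ⟨s(v, w), mk_mem_edgePairs.2 ⟨hv, hw, hvw⟩⟩

/-- A similarity x ↦ r O x replaces the normals n by O n and the offset h by r h. The facet centers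
become r k O n; they have a common norm, so that all of them are vertices of the dual. The
orthogonal map is then moved from the polytope to the polynomial. -/
theorem isCopyOf_dualPolytope_and_hybrid (D : IsHybridData V N h t k) {s : ℕ} {β : ℝ}
    (h0 : 0 ≤ β) (h1 : β ≤ 1)
    (hD : ∀ f ∈ monoSpan s, hybridFunctional β N (edgePairs V t) f = meanFunctional f)
    {P : Set E3} (hP : IsCopyOf (convexHull ℝ (V : Set E3)) P) :
    IsCopyOf (convexHull ℝ (N : Set E3)) (dualPolytope P) ∧
      EdgesVerticesHybrid P (dualPolytope P) s β := by
  classical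
  obtain ⟨r, O, hr, rfl⟩ := hP
  let F : E3 →ₗ[ℝ] E3 := r • (O.toLinearEquiv : E3 →ₗ[ℝ] E3)
  have hF (x : E3) : F x = r • O x := rfl
  have hFinj : Function.Injective F := fun x y hxy => by
    rw [hF, hF] at hxy
    exact O.injective (smul_right_injective E3 hr.ne' hxy)
  have hin (n v : E3) : ⟪O n, F v⟫ = r * ⟪n, v⟫ := by
    rw [hF, inner_smul_right, O.inner_map_map]
  have hP' : (fun x => r • O x) '' convexHull ℝ (V : Set E3) =
      convexHull ℝ ((V.image F : Finset E3) : Set E3) := by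
    rw [Finset.coe_image]
    exact F.image_convexHull _
  have D' : IsPolytopeData (V.image F) (N.image O) (r * h) :=
    D.toIsPolytopeData.map hr O (by rw [Finset.coe_image]; rfl) (by rw [Finset.coe_image])
  have htight (n : E3) : tightSet (V.image F) (r * h) {O n} = (tightSet V h {n}).image F := by
    ext x
    simp only [mem_tightSet, Finset.mem_image, Finset.mem_singleton, forall_eq]
    constructor
    · rintro ⟨⟨v, hv, rfl⟩, hx⟩
      rw [hin, mul_right_inj' hr.ne'] at hx
      exact ⟨v, ⟨hv, hx⟩, rfl⟩
    · rintro ⟨v, ⟨hv, hx⟩, rfl⟩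
      exact ⟨⟨v, hv, rfl⟩, by rw [hin, hx]⟩
  have hdual := D'.dualPolytope_eq (k := r * k) (by
    intro n' hn'
    obtain ⟨n, hn, rfl⟩ := Finset.mem_image.1 hn'
    rw [htight, Finset.sum_image hFinj.injOn, Finset.card_image_of_injective _ hFinj, ← map_sum,
      D.center n hn, map_smul, hF, smul_smul]
    congr 1; ring)
  rw [← hP', Finset.coe_image, Set.image_image] at hdual
  have hrk : 0 < r * k := mul_pos hr D.k_pos
  obtain ⟨ρ, hρ⟩ := D.norm_eq
  have hvert : vertices (dualPolytope ((fun x => r • O x) '' convexHull ℝ (V : Set E3))) =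
      (fun n => (r * k) • O n) '' (N : Set E3) := by
    rw [hdual]
    refine vertices_convexHull_of_norm_eq (r := (r * k) * ρ) ?_
    rintro _ ⟨n, hn, rfl⟩
    rw [norm_smul, O.norm_map, hρ n hn, Real.norm_of_nonneg hrk.le]
  have hX : proj '' vertices (dualPolytope ((fun x => r • O x) '' convexHull ℝ (V : Set E3))) =
      (fun n => O (proj n)) '' (N : Set E3) := by
    rw [hvert, Set.image_image]
    exact Set.image_congr fun n _ => proj_smul_map O hrk n
  have hinj : Set.InjOn (fun n => O (proj n)) (N : Set E3) := by
    intro a ha b hb hab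
    have h1 := O.injective hab
    rw [proj, proj, hρ a ha, hρ b hb] at h1
    have hρ0 : ρ ≠ 0 := hρ a ha ▸ norm_ne_zero_iff.2 (D.normal_ne_zero a ha)
    exact smul_right_injective E3 (inv_ne_zero hρ0) h1
  have hadj {v w : E3} : (edgeGraph ((fun x => r • O x) '' convexHull ℝ (V : Set E3))).Adj
      (F v) (F w) ↔ v ∈ V ∧ w ∈ V ∧ ⟪v, w⟫ = t := by
    rw [hP', D'.adj_iff, ← D.adj_iff', D.adj_iff]
    simp only [Finset.mem_image, exists_exists_and_eq_and, hin, mul_right_inj' hr.ne',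
      hFinj.eq_iff, hFinj.ne_iff, O.injective.ne_iff, exists_eq_right]
  refine ⟨⟨r * k, O, hrk, ?_⟩, ?_, ?_⟩
  · rw [hdual]
    exact (((r * k) • (O.toLinearEquiv : E3 →ₗ[ℝ] E3)).image_convexHull _).symm
  · obtain ⟨v₀, hv₀, v₁, hv₁, hv, hc⟩ := D.conn
    rw [hP'] at hadj ⊢
    refine D'.exists_eulerCycle (hadj.2 ⟨hv₀, hv₁, hv⟩) ?_
    intro v' hv'
    obtain ⟨v, hv, rfl⟩ := Finset.mem_image.1 hv'
    have := hc v hv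
    induction this with
    | refl => exact SimpleGraph.Reachable.refl _
    | tail _ hbc ih =>
      exact (ih hbc.1 (Finset.mem_image_of_mem F hbc.1)).trans (hadj.2 hbc).reachable
  · refine isHybridDesign_of_eulerCycle ((edgePairs V t).image (Sym2.map F)) ?_
      (D.edgePairs_nonempty.image _) ?_ (hX ▸ N.finite_toSet.image _) ?_ h0 h1 ?_
    · ext e
      rw [Finset.coe_image]
      constructor
      · rintro ⟨e, he, rfl⟩
        induction e with | _ v w => exact hadj.2 (mk_mem_edgePairs.1 he)
      · intro he
        induction e with | _ a b => ?_
        have hmem := he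
        rw [SimpleGraph.mem_edgeSet, hP', D'.adj_iff] at hmem
        obtain ⟨v, -, rfl⟩ := Finset.mem_image.1 hmem.1
        obtain ⟨w, -, rfl⟩ := Finset.mem_image.1 hmem.2.1
        exact ⟨s(v, w), mk_mem_edgePairs.2 (hadj.1 he), rfl⟩
    · intro e' he'
      obtain ⟨e, he, rfl⟩ := Finset.mem_image.1 he'
      induction e with | _ v w => ?_
      obtain ⟨hv, hw, hg⟩ := isGoodEdge_mk.1 (D.isGoodEdge _ he)
      rw [Sym2.map_mk, isGoodEdge_mk]
      refine ⟨(map_ne_zero_iff F hFinj).2 hv, (map_ne_zero_iff F hFinj).2 hw, ?_⟩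
      rwa [hF, hF, proj_smul_map O hr, proj_smul_map O hr, O.inner_map_map]
    · rw [hX]
      rintro _ ⟨n, hn, rfl⟩
      rw [mem_sphere_zero_iff_norm, O.norm_map, norm_proj (D.normal_ne_zero n hn)]
    · intro p hp
      have hcont : Continuous fun x => evalPoly p (O x) := by fun_prop
      have key := hD ⟨fun x => evalPoly p (O x), hcont⟩ (evalPoly_comp_mem_monoSpan O p hp)
      have hmean : meanFunctional ⟨fun x => evalPoly p (O x), hcont⟩ = sphereMean (evalPoly p) :=
        sphereMean_comp O (evalPoly p)
      have hsum (f : E3 → ℝ) : ∑ e ∈ (edgePairs V t).image (Sym2.map F), edgeIntegral f e =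
          ∑ e ∈ edgePairs V t, edgeIntegral (fun x => f (O x)) e := by
        rw [Finset.sum_image (Sym2.map.injective hFinj).injOn]
        exact Finset.sum_congr rfl fun e _ => edgeIntegral_map O hr f e
      rw [← hmean, ← key, hX, hinj.ncard_image, Set.ncard_coe_finset,
        finsum_mem_image hinj, finsum_mem_coe_finset, hsum, hsum]
      rfl

end IsHybridData

/-! ### Cones of facet normals at a vertex -/

/-- The cross product. -/
def crossProd (x y : E3) : E3 :=
  !₂[x 1 * y 2 - x 2 * y 1, x 2 * y 0 - x 0 * y 2, x 0 * y 1 - x 1 * y 0]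

/-- The determinant of three vectors. -/
def det3 (x y z : E3) : ℝ := ⟪x, crossProd y z⟫

theorem inner_E3 (x y : E3) : ⟪x, y⟫ = x 0 * y 0 + x 1 * y 1 + x 2 * y 2 := by
  simp [PiLp.inner_apply, Fin.sum_univ_three]; ring

theorem det3_eq (x y z : E3) : det3 x y z = x 0 * (y 1 * z 2 - y 2 * z 1) +
    x 1 * (y 2 * z 0 - y 0 * z 2) + x 2 * (y 0 * z 1 - y 1 * z 0) := by
  rw [det3, inner_E3]; simp [crossProd]

/-- Cramer's rule. -/
theorem det3_smul (x y z c : E3) :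
    det3 x y z • c = det3 c y z • x + det3 x c z • y + det3 x y c • z := by
  ext i
  simp only [det3_eq]
  fin_cases i <;> simp <;> ring

theorem eq_zero_of_inner_eq_zero {x y z c : E3} (h : det3 x y z ≠ 0) (hx : ⟪x, c⟫ = 0)
    (hy : ⟪y, c⟫ = 0) (hz : ⟪z, c⟫ = 0) : c = 0 := by
  have h1 := congrArg (fun v : E3 => ⟪v, c⟫) (det3_smul x y z c)
  simp only [inner_add_left, inner_smul_left, hx, hy, hz] at h1
  simp at h1
  exact h1.resolve_left h

/-- If nonnegative terms were always followed by positive ones, then running through the cycle,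
forwards from a nonnegative first term or backwards from a negative one, would show that all terms
have the same strict sign. Their sum could not be zero. -/
theorem exists_sign_change {k : ℕ} {d : ℕ → ℝ} (hk : 0 < k) (hd : d k = d 0)
    (hsum : ∑ i ∈ Finset.range k, d i = 0) : ∃ i < k, 0 ≤ d i ∧ d (i + 1) ≤ 0 := by
  by_contra! H
  rcases le_or_gt 0 (d 0) with h0 | h0
  · have hpos : ∀ i ≤ k, 0 ≤ d i := by
      intro i
      induction i with
      | zero => exact fun _ => h0
      | succ i ih => exact fun hi => (H i (by omega) (ih (by omega))).le
    have hpos' : ∀ i < k, 0 < d i := by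
      intro i hi
      cases i with
      | zero =>
        rw [← hd]
        obtain ⟨j, rfl⟩ := Nat.exists_eq_succ_of_ne_zero hk.ne'
        exact H j (by omega) (hpos j (by omega))
      | succ i => exact H i (by omega) (hpos i (by omega))
    exact (Finset.sum_pos (fun i hi => hpos' i (Finset.mem_range.1 hi)) ⟨0, by simpa⟩).ne' hsum
  · have hneg : ∀ j ≤ k, d (k - j) < 0 := by
      intro j
      induction j with
      | zero => exact fun _ => by rw [Nat.sub_zero, hd]; exact h0
      | succ j ih =>
        intro hj
        by_contra! hc
        have := H (k - (j + 1)) (by omega) hc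
        rw [show k - (j + 1) + 1 = k - j by omega] at this
        linarith [ih (by omega)]
    refine (Finset.sum_neg (fun i hi => ?_) ⟨0, by simpa⟩).ne hsum
    have hi := Finset.mem_range.1 hi
    have := hneg (k - i) (by omega)
    rwa [show k - (k - i) = i by omega] at this

/-- If a linear functional does not increase along the edges at a vertex, then it is a nonnegative
combination of the facet normals at this vertex, which are given in cyclic order. -/
theorem exists_cone_coefficients {k : ℕ} (hk : 0 < k) {n w : ℕ → E3} {v a : E3} {h : ℝ}
    (hper : n k = n 0) (ha : a = ∑ i ∈ Finset.range k, n i) (hv : ∀ i ≤ k, ⟪n i, v⟫ = h)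
    (hw : ∀ i < k, ⟪n i, w i⟫ = h ∧ ⟪n (i + 1), w i⟫ = h)
    (hdet : ∀ i < k, 0 < det3 a (n i) (n (i + 1))) (haw : ∀ i < k, ⟪a, w i⟫ < ⟪a, v⟫) {c : E3}
    (hc : ∀ i < k, ⟪c, w i⟫ ≤ ⟪c, v⟫) :
    ∃ i < k, ∃ α β γ : ℝ, 0 ≤ α ∧ 0 ≤ β ∧ 0 ≤ γ ∧ c = α • a + β • n i + γ • n (i + 1) := by
  have hcyc (x y z : E3) : det3 x y z = ⟪y, crossProd z x⟫ := by
    rw [det3_eq, inner_E3]; simp [crossProd]; ring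
  -- The sign of det(a, n i, c) tells on which side of the plane through a and n i the vector c
  -- lies. The sum of these determinants is det(a, a, c) = 0, so a sign change exists; it places c
  -- in the sector around the axis a between two successive normals.
  obtain ⟨i, hi, h1, h2⟩ := exists_sign_change (d := fun i => det3 a (n i) c) hk (by simp [hper]) (by
    simp only [hcyc]
    rw [← sum_inner, ← ha, ← hcyc, det3_eq]; ring)
  have hD := hdet i hi
  have hβ : det3 a c (n (i + 1)) = -det3 a (n (i + 1)) c := by simp only [det3_eq]; ring
  have hce : c = (det3 c (n i) (n (i + 1)) / det3 a (n i) (n (i + 1))) • a +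
      (-det3 a (n (i + 1)) c / det3 a (n i) (n (i + 1))) • n i +
      (det3 a (n i) c / det3 a (n i) (n (i + 1))) • n (i + 1) := by
    have := congrArg (fun x => (det3 a (n i) (n (i + 1)))⁻¹ • x) (det3_smul a (n i) (n (i + 1)) c)
    simp only [smul_add, smul_smul, inv_mul_cancel₀ hD.ne', one_smul, hβ] at this
    simp only [div_eq_inv_mul]
    exact this
  refine ⟨i, hi, _, _, _, ?_, div_nonneg (by linarith) hD.le, div_nonneg h1 hD.le, hce⟩
  have e := hc i hi
  have hw' := hw i hi
  -- Both normals of the sector are constant along the edge from v to w i, so only the coefficient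
  -- of a is felt there. As a decreases along the edge and c does not increase, this coefficient is
  -- nonnegative.
  have hz : ⟪c, w i⟫ - ⟪c, v⟫ =
      (det3 c (n i) (n (i + 1)) / det3 a (n i) (n (i + 1))) * (⟪a, w i⟫ - ⟪a, v⟫) := by
    conv_lhs => rw [hce]
    simp only [inner_add_left, inner_smul_left, hw'.1, hw'.2, hv i hi.le, hv (i + 1) hi]
    simp
    ring
  have h4 : ⟪a, w i⟫ - ⟪a, v⟫ < 0 := by linarith [haw i hi]
  by_contra! hneg
  linarith [mul_pos_of_neg_of_neg hneg h4]

/-! ### Coordinates in the ring of integers of the golden field -/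

/-- Pairs `(a, b)` of integers stand for `a + b φ`, where `φ` is the golden ratio. -/
abbrev ZPhi : Type := ℤ × ℤ

/-- Vectors with coordinates `a + b φ`. -/
abbrev ZVec : Type := ZPhi × ZPhi × ZPhi

namespace ZPhi

/-- The real number represented by a pair. -/
def toReal (x : ZPhi) : ℝ := x.1 + x.2 * Real.goldenRatio

def add (x y : ZPhi) : ZPhi := (x.1 + y.1, x.2 + y.2)

def sub (x y : ZPhi) : ZPhi := (x.1 - y.1, x.2 - y.2)

/-- Change of the sign. -/
def neg (x : ZPhi) : ZPhi := (-x.1, -x.2)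

def mul (x y : ZPhi) : ZPhi := (x.1 * y.1 + x.2 * y.2, x.1 * y.2 + x.2 * y.1 + x.2 * y.2)

/-- A sufficient criterion for positivity. -/
def IsPos (x : ZPhi) : Prop :=
  (0 ≤ x.2 ∧ 0 < 1000 * x.1 + 1618 * x.2) ∨ (x.2 ≤ 0 ∧ 0 < 1000 * x.1 + 1619 * x.2)

instance (x : ZPhi) : Decidable x.IsPos := by unfold IsPos; infer_instance

theorem toReal_add (x y : ZPhi) : (x.add y).toReal = x.toReal + y.toReal := by
  simp [toReal, add]; ring

theorem toReal_sub (x y : ZPhi) : (x.sub y).toReal = x.toReal - y.toReal := by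
  simp [toReal, sub]; ring

theorem toReal_neg (x : ZPhi) : x.neg.toReal = -x.toReal := by
  simp [toReal, neg]; ring

theorem toReal_mul (x y : ZPhi) : (x.mul y).toReal = x.toReal * y.toReal := by
  have h : Real.goldenRatio ^ 2 = Real.goldenRatio + 1 := Real.goldenRatio_sq
  generalize hp : Real.goldenRatio = p at *
  simp only [toReal, mul, hp]
  push_cast
  linear_combination (-(x.2 : ℝ) * y.2) * h

/-- Irrationality of the golden ratio. It turns equations between real numbers into decidable
equations between pairs of integers. -/
theorem toReal_injective : Function.Injective toReal := by
  intro x y h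
  have h1 : ((x.2 - y.2 : ℤ) : ℝ) * Real.goldenRatio = ((y.1 - x.1 : ℤ) : ℝ) := by
    simp only [toReal] at h
    push_cast
    linarith
  have h2 : x.2 - y.2 = 0 := by
    by_contra hne
    exact (Real.goldenRatio_irrational.intCast_mul hne).ne_int _ h1
  rw [h2] at h1
  have h3 : y.1 - x.1 = 0 := by
    have : ((y.1 - x.1 : ℤ) : ℝ) = 0 := by rw [← h1]; simp
    exact_mod_cast this
  exact Prod.ext (by omega) (by omega)

theorem toReal_inj {x y : ZPhi} : x.toReal = y.toReal ↔ x = y := toReal_injective.eq_iff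

theorem goldenRatio_bounds : 1.618 < Real.goldenRatio ∧ Real.goldenRatio < 1.619 := by
  have h5 : √5 ^ 2 = 5 := Real.sq_sqrt (by norm_num)
  have h0 := Real.sqrt_nonneg 5
  unfold Real.goldenRatio
  constructor <;> nlinarith

theorem IsPos.toReal_pos {x : ZPhi} (h : x.IsPos) : 0 < x.toReal := by
  obtain ⟨h1, h2⟩ := goldenRatio_bounds
  unfold toReal
  rcases h with ⟨h3, h4⟩ | ⟨h3, h4⟩
  · have h3' : (0 : ℝ) ≤ x.2 := by exact_mod_cast h3
    have h4' : (0 : ℝ) < 1000 * x.1 + 1618 * x.2 := by exact_mod_cast h4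
    nlinarith
  · have h3' : (x.2 : ℝ) ≤ 0 := by exact_mod_cast h3
    have h4' : (0 : ℝ) < 1000 * x.1 + 1619 * x.2 := by exact_mod_cast h4
    nlinarith

end ZPhi

namespace ZVec

/-- The vector in three-space. -/
def toE3 (x : ZVec) : E3 := !₂[x.1.toReal, x.2.1.toReal, x.2.2.toReal]

@[simp] theorem toE3_zero (x : ZVec) : x.toE3 0 = x.1.toReal := rfl
@[simp] theorem toE3_one (x : ZVec) : x.toE3 1 = x.2.1.toReal := rfl
@[simp] theorem toE3_two (x : ZVec) : x.toE3 2 = x.2.2.toReal := rfl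

def add (x y : ZVec) : ZVec := (x.1.add y.1, x.2.1.add y.2.1, x.2.2.add y.2.2)

def smul (c : ZPhi) (x : ZVec) : ZVec := (c.mul x.1, c.mul x.2.1, c.mul x.2.2)

def dot (x y : ZVec) : ZPhi := (x.1.mul y.1).add ((x.2.1.mul y.2.1).add (x.2.2.mul y.2.2))

def cross (x y : ZVec) : ZVec :=
  ((x.2.1.mul y.2.2).sub (x.2.2.mul y.2.1), (x.2.2.mul y.1).sub (x.1.mul y.2.2),
    (x.1.mul y.2.1).sub (x.2.1.mul y.1))

theorem toE3_injective : Function.Injective toE3 := by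
  intro x y h
  have h0 := congrArg (fun v : E3 => v 0) h
  have h1 := congrArg (fun v : E3 => v 1) h
  have h2 := congrArg (fun v : E3 => v 2) h
  simp only [toE3_zero, toE3_one, toE3_two, ZPhi.toReal_inj] at h0 h1 h2
  exact Prod.ext h0 (Prod.ext h1 h2)

theorem toE3_add (x y : ZVec) : (x.add y).toE3 = x.toE3 + y.toE3 := by
  ext i; fin_cases i <;> simp [toE3, add, ZPhi.toReal_add]

theorem toE3_smul (c : ZPhi) (x : ZVec) : (smul c x).toE3 = c.toReal • x.toE3 := by
  ext i; fin_cases i <;> simp [toE3, smul, ZPhi.toReal_mul]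

theorem inner_toE3 (x y : ZVec) : ⟪x.toE3, y.toE3⟫ = (x.dot y).toReal := by
  rw [inner_E3]
  simp only [toE3_zero, toE3_one, toE3_two, dot, ZPhi.toReal_add, ZPhi.toReal_mul]
  ring

theorem det3_toE3 (x y z : ZVec) : det3 x.toE3 y.toE3 z.toE3 = (x.dot (y.cross z)).toReal := by
  rw [det3_eq]
  simp only [toE3_zero, toE3_one, toE3_two, dot, cross, ZPhi.toReal_add, ZPhi.toReal_sub,
    ZPhi.toReal_mul]
  ring

/-- The sum of the first `k` values of a sequence. -/
def sumRange (f : ℕ → ZVec) : ℕ → ZVec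
  | 0 => ((0, 0), (0, 0), (0, 0))
  | k + 1 => (sumRange f k).add (f k)

theorem toE3_sumRange (f : ℕ → ZVec) (k : ℕ) :
    (sumRange f k).toE3 = ∑ i ∈ Finset.range k, (f i).toE3 := by
  induction k with
  | zero =>
    ext i; fin_cases i <;> simp [sumRange, toE3, ZPhi.toReal]
  | succ k ih => rw [sumRange, toE3_add, ih, Finset.sum_range_succ]

/-- The sum of a list. -/
def sumList : List ZVec → ZVec
  | [] => ((0, 0), (0, 0), (0, 0))
  | x :: l => x.add (sumList l)

theorem toE3_sumList (l : List ZVec) : (sumList l).toE3 = (l.map toE3).sum := by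
  induction l with
  | nil => ext i; fin_cases i <;> simp [sumList, toE3, ZPhi.toReal]
  | cons x l ih => rw [sumList, toE3_add, ih]; simp

/-- The entry of a list at a given position. -/
def nth (l : List ZVec) (i : ℕ) : ZVec := l.getD i ((0, 0), (0, 0), (0, 0))

theorem nth_mem {l : List ZVec} {i : ℕ} (h : i < l.length) : nth l i ∈ l := by
  rw [nth, List.getD_eq_getElem _ _ h]; exact List.getElem_mem h

theorem exists_nth {l : List ZVec} {x : ZVec} (h : x ∈ l) : ∃ i < l.length, nth l i = x := by
  obtain ⟨i, hi, rfl⟩ := List.getElem_of_mem h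
  exact ⟨i, hi, List.getD_eq_getElem _ _ hi⟩

theorem nth_inj {l : List ZVec} (hl : l.Nodup) {i j : ℕ} (hi : i < l.length) (hj : j < l.length) :
    nth l i = nth l j ↔ i = j := by
  rw [nth, nth, List.getD_eq_getElem _ _ hi, List.getD_eq_getElem _ _ hj, hl.getElem_inj_iff]

open Classical in
/-- The finite set of vectors represented by a list. -/
def toFinset (l : List ZVec) : Finset E3 := (l.map toE3).toFinset

theorem mem_toFinset {l : List ZVec} {v : E3} : v ∈ toFinset l ↔ ∃ x ∈ l, toE3 x = v := by
  classical
  simp [toFinset]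

theorem toE3_mem_toFinset {l : List ZVec} {x : ZVec} : toE3 x ∈ toFinset l ↔ x ∈ l := by
  rw [mem_toFinset]
  exact ⟨fun ⟨y, hy, h⟩ => toE3_injective h ▸ hy, fun h => ⟨x, h, rfl⟩⟩

theorem sum_toFinset {l : List ZVec} (hl : l.Nodup) : ∑ v ∈ toFinset l, v = (sumList l).toE3 := by
  classical
  rw [toE3_sumList, toFinset, List.sum_toFinset _ (hl.map toE3_injective), List.map_map]
  rfl

theorem card_toFinset {l : List ZVec} (hl : l.Nodup) : (toFinset l).card = l.length := by
  classical
  rw [toFinset, List.toFinset_card_of_nodup (hl.map toE3_injective), List.length_map]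

end ZVec

/-! ### Certificates for polytopes -/

theorem linearIndependent_of_det3_ne_zero {x y z : E3} (h : det3 x y z ≠ 0) :
    LinearIndependent ℝ ![y - x, z - x] := by
  rw [LinearIndependent.pair_iff]
  intro a b hab
  -- Pairing with z × x isolates a times the determinant, pairing with x × y isolates b times it.
  have h1 := congrArg (fun c : E3 => ⟪c, crossProd z x⟫) hab
  have h2 := congrArg (fun c : E3 => ⟪c, crossProd x y⟫) hab
  rw [det3_eq] at h
  simp [inner_E3, crossProd] at h1 h2
  constructor
  · refine (mul_eq_zero.1 (?_ : a * _ = 0)).resolve_right h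
    linear_combination h1
  · refine (mul_eq_zero.1 (?_ : b * _ = 0)).resolve_right h
    linear_combination h2

/-- The numbers of the facets at the vertex number `i`. -/
def facetsAt (fan : List (List (ℕ × ℕ))) (i : ℕ) : List ℕ := (fan.getD i []).map Prod.fst

/-- Two vertices have two facets in common. -/
def ShareTwoFacets (fan : List (List (ℕ × ℕ))) (i i' : ℕ) : Prop :=
  ∃ j ∈ facetsAt fan i, ∃ j' ∈ facetsAt fan i, j ≠ j' ∧ j ∈ facetsAt fan i' ∧ j' ∈ facetsAt fan i'

instance (fan : List (List (ℕ × ℕ))) (i i' : ℕ) : Decidable (ShareTwoFacets fan i i') := by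
  unfold ShareTwoFacets; infer_instance

/-- The entry of a cyclic list of pairs. -/
def fanEntry (fan : List (List (ℕ × ℕ))) (i p : ℕ) : ℕ × ℕ :=
  (fan.getD i []).getD (p % (fan.getD i []).length) (0, 0)

/-- The sum of the facet normals at a vertex. -/
def fanSum (N : List ZVec) (fan : List (List (ℕ × ℕ))) (i : ℕ) : ZVec :=
  ZVec.sumRange (fun p => ZVec.nth N (fanEntry fan i p).1) (fan.getD i []).length

/-- The conditions on lists of vertices and of facet normals that certify the combinatorial
structure. For each vertex, `fan` lists the facets at this vertex in cyclic order, each with the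
other vertex of the edge that it shares with the next facet. -/
structure IsCertificate (V N : List ZVec) (fan : List (List (ℕ × ℕ))) (h t μ : ZPhi) (m : ℕ)
    (ν : ZPhi) : Prop where
  nodup_vertices : V.Nodup
  nodup_normals : N.Nodup
  pos : h.IsPos
  incidence : ∀ i < V.length, ∀ j < N.length,
    ((ZVec.nth N j).dot (ZVec.nth V i) = h ∧ j ∈ facetsAt fan i) ∨
    ((h.sub ((ZVec.nth N j).dot (ZVec.nth V i))).IsPos ∧ j ∉ facetsAt fan i)
  adj : ∀ i < V.length, ∀ i' < V.length, ((ZVec.nth V i).dot (ZVec.nth V i') = t ↔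
    i ≠ i' ∧ ShareTwoFacets fan i i')
  fan_length : ∀ i < V.length, 0 < (fan.getD i []).length
  fan_entry : ∀ i < V.length, ∀ p < (fan.getD i []).length,
    (fanEntry fan i p).1 < N.length ∧ (fanEntry fan i p).1 ∈ facetsAt fan i ∧
    (fanEntry fan i p).2 < V.length ∧
    (fanEntry fan i p).1 ∈ facetsAt fan (fanEntry fan i p).2 ∧
    (fanEntry fan i (p + 1)).1 ∈ facetsAt fan (fanEntry fan i p).2 ∧
    ((fanSum N fan i).dot ((ZVec.nth N (fanEntry fan i p).1).cross
      (ZVec.nth N (fanEntry fan i (p + 1)).1))).IsPos ∧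
    (((fanSum N fan i).dot (ZVec.nth V i)).sub
      ((fanSum N fan i).dot (ZVec.nth V (fanEntry fan i p).2))).IsPos
  three_le : 3 ≤ m
  facet : ∀ n ∈ N, (V.filter fun v => n.dot v = h).length = m ∧
    ZVec.sumList (V.filter fun v => n.dot v = h) = ZVec.smul μ n ∧
    (ZVec.nth (V.filter fun v => n.dot v = h) 0).dot
      ((ZVec.nth (V.filter fun v => n.dot v = h) 1).cross
        (ZVec.nth (V.filter fun v => n.dot v = h) 2)) ≠ (0, 0)
  center_pos : μ.IsPos
  two_le : 2 ≤ V.length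
  conn : ∀ i < V.length, 0 < i → ∃ i' < i, (ZVec.nth V i').dot (ZVec.nth V i) = t
  norm : ∀ n ∈ N, n.dot n = ν

namespace IsCertificate

open ZVec

variable {V N : List ZVec} {fan : List (List (ℕ × ℕ))} {h t μ ν : ZPhi} {m : ℕ}

theorem tight_iff (C : IsCertificate V N fan h t μ m ν) {i j : ℕ} (hi : i < V.length)
    (hj : j < N.length) : ⟪(nth N j).toE3, (nth V i).toE3⟫ = h.toReal ↔ j ∈ facetsAt fan i := by
  rw [inner_toE3, ZPhi.toReal_inj]
  rcases C.incidence i hi j hj with ⟨h1, h2⟩ | ⟨h1, h2⟩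
  · exact iff_of_true h1 h2
  · refine iff_of_false (fun he => ?_) h2
    have := h1.toReal_pos
    rw [ZPhi.toReal_sub, he, sub_self] at this
    exact lt_irrefl _ this

theorem inner_le (C : IsCertificate V N fan h t μ m ν) {i j : ℕ} (hi : i < V.length)
    (hj : j < N.length) : ⟪(nth N j).toE3, (nth V i).toE3⟫ ≤ h.toReal := by
  rw [inner_toE3]
  rcases C.incidence i hi j hj with ⟨h1, h2⟩ | ⟨h1, h2⟩
  · rw [h1]
  · have := h1.toReal_pos
    rw [ZPhi.toReal_sub] at this
    linarith

theorem exists_vertex {v : E3} (hv : v ∈ toFinset V) : ∃ i < V.length, (nth V i).toE3 = v := by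
  obtain ⟨x, hx, rfl⟩ := mem_toFinset.1 hv
  obtain ⟨i, hi, rfl⟩ := exists_nth hx
  exact ⟨i, hi, rfl⟩

theorem nth_mem_toFinset {i : ℕ} (hi : i < V.length) : (nth V i).toE3 ∈ toFinset V :=
  toE3_mem_toFinset.2 (nth_mem hi)

/-- Everything but the covering by the cones is read off from the lists. For the covering, a given
functional is maximized over the vertices, as in the simplex method; optimality against the
neighbours alone puts it into the cone at the maximizing vertex. -/
theorem isPolytopeData (C : IsCertificate V N fan h t μ m ν) :
    IsPolytopeData (toFinset V) (toFinset N) h.toReal := by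
  classical
  have htight {i : ℕ} (hi : i < V.length) {p : ℕ} (hp : p < (fan.getD i []).length) :=
    (C.tight_iff hi (C.fan_entry i hi p hp).1).2 (C.fan_entry i hi p hp).2.1
  have hmod (i p : ℕ) : fanEntry fan i (p % (fan.getD i []).length) = fanEntry fan i p := by
    rw [fanEntry, fanEntry, Nat.mod_mod]
  have hentry {i : ℕ} (hi : i < V.length) (p : ℕ) : (fanEntry fan i p).1 < N.length := by
    rw [← hmod]; exact (C.fan_entry i hi _ (Nat.mod_lt _ (C.fan_length i hi))).1
  have htight' {i : ℕ} (hi : i < V.length) (p : ℕ) :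
      ⟪(nth N (fanEntry fan i p).1).toE3, (nth V i).toE3⟫ = h.toReal := by
    rw [← hmod]; exact htight hi (Nat.mod_lt _ (C.fan_length i hi))
  have hfan {i : ℕ} (hi : i < V.length) {c : E3}
      (hc : ∀ p < (fan.getD i []).length, ⟪c, (nth V (fanEntry fan i p).2).toE3⟫ ≤
        ⟪c, (nth V i).toE3⟫) :=
    exists_cone_coefficients (C.fan_length i hi)
      (n := fun p => (nth N (fanEntry fan i p).1).toE3)
      (w := fun p => (nth V (fanEntry fan i p).2).toE3) (v := (nth V i).toE3)
      (a := (fanSum N fan i).toE3) (h := h.toReal) (by simp [fanEntry])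
      (by rw [fanSum, toE3_sumRange]) (fun p _ => htight' hi p)
      (fun p hp => by
        obtain ⟨-, -, e3, e4, e5, -, -⟩ := C.fan_entry i hi p hp
        exact ⟨(C.tight_iff e3 (hentry hi p)).2 e4, (C.tight_iff e3 (hentry hi (p + 1))).2 e5⟩)
      (fun p hp => by rw [det3_toE3]; exact (C.fan_entry i hi p hp).2.2.2.2.2.1.toReal_pos)
      (fun p hp => by
        have := (C.fan_entry i hi p hp).2.2.2.2.2.2.toReal_pos
        rw [ZPhi.toReal_sub] at this
        rw [inner_toE3, inner_toE3]; linarith) hc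
  refine ⟨C.pos.toReal_pos, ?_, ?_, ?_, ?_⟩
  · intro n hn v hv
    obtain ⟨j, hj, rfl⟩ := exists_vertex hn
    obtain ⟨i, hi, rfl⟩ := exists_vertex hv
    exact C.inner_le hi hj
  · intro c
    have hne : (toFinset V).Nonempty := ⟨_, nth_mem_toFinset (by have := C.two_le; omega : 0 < V.length)⟩
    obtain ⟨v, hv, hmax⟩ := Finset.exists_max_image (toFinset V) (fun v => ⟪c, v⟫) hne
    obtain ⟨i, hi, rfl⟩ := exists_vertex hv
    refine ⟨_, hv, ?_⟩
    obtain ⟨p, hp, α, β, γ, hα, hβ, hγ, rfl⟩ := hfan hi (c := c) (fun p hp =>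
      hmax _ (nth_mem_toFinset (C.fan_entry i hi p hp).2.2.1))
    have hmem (q : ℕ) : (nth N (fanEntry fan i q).1).toE3 ∈ Submodule.span NNReal
        {n | n ∈ toFinset N ∧ ⟪n, (nth V i).toE3⟫ = h.toReal} :=
      Submodule.subset_span ⟨nth_mem_toFinset (hentry hi q), htight' hi q⟩
    refine add_mem (add_mem ?_ ?_) ?_
    · lift α to NNReal using hα
      refine Submodule.smul_mem _ α ?_
      rw [fanSum, toE3_sumRange]
      exact sum_mem fun q _ => hmem q
    · lift β to NNReal using hβ
      exact Submodule.smul_mem _ β (hmem p)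
    · lift γ to NNReal using hγ
      exact Submodule.smul_mem _ γ (hmem (p + 1))
  · intro v hv u hu H
    obtain ⟨i, hi, rfl⟩ := exists_vertex hv
    have hz (q : ℕ) : ⟪(nth N (fanEntry fan i q).1).toE3, u - (nth V i).toE3⟫ = (0 : ℝ) := by
      rw [inner_sub_right, htight' hi q, H _ (nth_mem_toFinset (hentry hi q)) (htight' hi q),
        sub_self]
    -- The difference of the two vertices is orthogonal to three independent vectors: two successive
    -- normals and the sum of all normals at the vertex.
    have hd : det3 (fanSum N fan i).toE3 (nth N (fanEntry fan i 0).1).toE3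
        (nth N (fanEntry fan i 1).1).toE3 ≠ 0 := by
      rw [det3_toE3]
      exact (C.fan_entry i hi 0 (C.fan_length i hi)).2.2.2.2.2.1.toReal_pos.ne'
    refine sub_eq_zero.1 (eq_zero_of_inner_eq_zero hd ?_ (hz 0) (hz 1))
    rw [fanSum, toE3_sumRange, sum_inner]
    exact Finset.sum_eq_zero fun q _ => hz q
  · intro n hn
    obtain ⟨x, hx, rfl⟩ := mem_toFinset.1 hn
    obtain ⟨h1, -, h3⟩ := C.facet x hx
    have hm := C.three_le
    have hmem {q : ℕ} (hq : q < 3) := nth_mem (l := V.filter fun v => x.dot v = h) (i := q) (by omega)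
    have hmem' {q : ℕ} (hq : q < 3) := List.mem_filter.1 (hmem hq)
    simp only [decide_eq_true_eq] at hmem'
    have hd := (ZPhi.toReal_injective.ne h3)
    rw [← det3_toE3, show ZPhi.toReal (0, 0) = 0 by simp [ZPhi.toReal]] at hd
    obtain ⟨m0, e0⟩ := hmem' (q := 0) (by norm_num)
    obtain ⟨m1, e1⟩ := hmem' (q := 1) (by norm_num)
    obtain ⟨m2, e2⟩ := hmem' (q := 2) (by norm_num)
    refine ⟨_, toE3_mem_toFinset.2 m0, _, toE3_mem_toFinset.2 m1, _, toE3_mem_toFinset.2 m2,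
      by rw [inner_toE3, e0], by rw [inner_toE3, e1], by rw [inner_toE3, e2], ?_⟩
    exact linearIndependent_of_det3_ne_zero hd

theorem tightSet_eq (V : List ZVec) (h : ZPhi) (n : ZVec) :
    tightSet (toFinset V) h.toReal {n.toE3} = toFinset (V.filter fun v => n.dot v = h) := by
  ext v
  simp only [mem_tightSet, Finset.mem_singleton, forall_eq, mem_toFinset, List.mem_filter,
    decide_eq_true_eq]
  constructor
  · rintro ⟨⟨x, hx, rfl⟩, hn⟩
    rw [inner_toE3, ZPhi.toReal_inj] at hn
    exact ⟨x, ⟨hx, hn⟩, rfl⟩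
  · rintro ⟨x, ⟨hx, hn⟩, rfl⟩
    exact ⟨⟨x, hx, rfl⟩, by rw [inner_toE3, hn]⟩

/-- The `m` vertices of a facet add up to μ n, so its center is (μ / m) n. Connectedness holds
because each vertex but the first is joined to an earlier one. -/
theorem isHybridData (C : IsCertificate V N fan h t μ m ν) :
    IsHybridData (toFinset V) (toFinset N) h.toReal t.toReal (μ.toReal / m) := by
  have hm : (0 : ℝ) < m := by have := C.three_le; exact_mod_cast (by omega : 0 < m)
  have hlt {i j : ℕ} (hi : i < V.length) (hj : j ∈ facetsAt fan i) : j < N.length := by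
    obtain ⟨⟨j, w⟩, hx, rfl⟩ := List.mem_map.1 hj
    obtain ⟨p, hp, he⟩ := List.getElem_of_mem hx
    have := (C.fan_entry i hi p hp).1
    rw [fanEntry, Nat.mod_eq_of_lt hp, List.getD_eq_getElem _ _ hp, he] at this
    exact this
  refine { C.isPolytopeData with
    adj := ?_, k_pos := div_pos C.center_pos.toReal_pos hm, center := ?_, conn := ?_, norm_eq := ?_ }
  · intro v hv w hw
    obtain ⟨i, hi, rfl⟩ := exists_vertex hv
    obtain ⟨i', hi', rfl⟩ := exists_vertex hw
    rw [inner_toE3, ZPhi.toReal_inj, C.adj i hi i' hi', toE3_injective.ne_iff, ne_eq, ne_eq,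
      nth_inj C.nodup_vertices hi hi']
    refine and_congr_right fun _ => ⟨?_, ?_⟩
    · rintro ⟨j, hj, j', hj', hne, h1, h2⟩
      refine ⟨_, nth_mem_toFinset (hlt hi hj), _, nth_mem_toFinset (hlt hi hj'), ?_,
        (C.tight_iff hi (hlt hi hj)).2 hj, (C.tight_iff hi' (hlt hi hj)).2 h1,
        (C.tight_iff hi (hlt hi hj')).2 hj', (C.tight_iff hi' (hlt hi hj')).2 h2⟩
      rwa [toE3_injective.ne_iff, ne_eq, nth_inj C.nodup_normals (hlt hi hj) (hlt hi hj')]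
    · rintro ⟨n, hn, n', hn', hne, h1, h2, h3, h4⟩
      obtain ⟨j, hj, rfl⟩ := exists_vertex hn
      obtain ⟨j', hj', rfl⟩ := exists_vertex hn'
      exact ⟨j, (C.tight_iff hi hj).1 h1, j', (C.tight_iff hi hj').1 h3,
        fun he => hne (by rw [he]), (C.tight_iff hi' hj).1 h2, (C.tight_iff hi' hj').1 h4⟩
  · intro n hn
    obtain ⟨x, hx, rfl⟩ := mem_toFinset.1 hn
    obtain ⟨h1, h2, -⟩ := C.facet x hx
    have hnd : (V.filter fun v => x.dot v = h).Nodup := C.nodup_vertices.filter _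
    rw [tightSet_eq, sum_toFinset hnd, card_toFinset hnd, h1, h2, toE3_smul]
    congr 1
    field_simp
  · have h0 : 0 < V.length := by have := C.two_le; omega
    have h1 : 1 < V.length := by have := C.two_le; omega
    refine ⟨_, nth_mem_toFinset h0, _, nth_mem_toFinset h1, ?_, ?_⟩
    · obtain ⟨i', hi', he⟩ := C.conn 1 h1 one_pos
      rw [inner_toE3, ← he, Nat.lt_one_iff.1 hi']
    · intro v hv
      obtain ⟨i, hi, rfl⟩ := exists_vertex hv
      induction i using Nat.strong_induction_on with
      | _ i ih =>
        rcases Nat.eq_zero_or_pos i with rfl | hpos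
        · exact Relation.ReflTransGen.refl
        · obtain ⟨i', hi', he⟩ := C.conn i hi hpos
          have hi'' : i' < V.length := by omega
          exact (ih i' hi' hi'' (nth_mem_toFinset hi'')).tail
            ⟨nth_mem_toFinset hi'', nth_mem_toFinset hi, by rw [inner_toE3, he]⟩
  · refine ⟨√ν.toReal, fun n hn => ?_⟩
    obtain ⟨x, hx, rfl⟩ := mem_toFinset.1 hn
    rw [norm_eq_sqrt_real_inner, inner_toE3, C.norm x hx]

end IsCertificate

/-! ### Certificates for the polytopes of the theorem -/

/-- The vertices of the tetrahedron. -/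
def tetrahedronList : List ZVec :=
  [((1, 0), (1, 0), (1, 0)), ((1, 0), (-1, 0), (-1, 0)), ((-1, 0), (1, 0), (-1, 0)),
   ((-1, 0), (-1, 0), (1, 0))]

/-- The vertices of the opposite tetrahedron. -/
def tetrahedronDualList : List ZVec :=
  [((-1, 0), (-1, 0), (-1, 0)), ((-1, 0), (1, 0), (1, 0)), ((1, 0), (-1, 0), (1, 0)),
   ((1, 0), (1, 0), (-1, 0))]

/-- The vertices of the octahedron. -/
def octahedronList : List ZVec :=
  [((1, 0), (0, 0), (0, 0)), ((0, 0), (0, 0), (1, 0)), ((0, 0), (0, 0), (-1, 0)),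
   ((0, 0), (1, 0), (0, 0)), ((0, 0), (-1, 0), (0, 0)), ((-1, 0), (0, 0), (0, 0))]

/-- The vertices of the cube. -/
def cubeList : List ZVec :=
  [((1, 0), (1, 0), (1, 0)), ((1, 0), (1, 0), (-1, 0)), ((1, 0), (-1, 0), (1, 0)),
   ((-1, 0), (1, 0), (1, 0)), ((1, 0), (-1, 0), (-1, 0)), ((-1, 0), (1, 0), (-1, 0)),
   ((-1, 0), (-1, 0), (1, 0)), ((-1, 0), (-1, 0), (-1, 0))]

/-- The vertices of the rhombic dodecahedron. -/
def rhombicDodecahedronList : List ZVec :=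
  [((1, 0), (1, 0), (1, 0)), ((2, 0), (0, 0), (0, 0)), ((0, 0), (0, 0), (2, 0)),
   ((0, 0), (2, 0), (0, 0)), ((1, 0), (1, 0), (-1, 0)), ((1, 0), (-1, 0), (1, 0)),
   ((1, 0), (-1, 0), (-1, 0)), ((-1, 0), (1, 0), (1, 0)), ((-1, 0), (-1, 0), (1, 0)),
   ((-1, 0), (1, 0), (-1, 0)), ((0, 0), (0, 0), (-2, 0)), ((0, 0), (-2, 0), (0, 0)),
   ((-2, 0), (0, 0), (0, 0)), ((-1, 0), (-1, 0), (-1, 0))]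

/-- The vertices of the cuboctahedron. -/
def cuboctahedronList : List ZVec :=
  [((1, 0), (1, 0), (0, 0)), ((1, 0), (-1, 0), (0, 0)), ((-1, 0), (1, 0), (0, 0)),
   ((-1, 0), (-1, 0), (0, 0)), ((1, 0), (0, 0), (1, 0)), ((1, 0), (0, 0), (-1, 0)),
   ((-1, 0), (0, 0), (1, 0)), ((-1, 0), (0, 0), (-1, 0)), ((0, 0), (1, 0), (1, 0)),
   ((0, 0), (1, 0), (-1, 0)), ((0, 0), (-1, 0), (1, 0)), ((0, 0), (-1, 0), (-1, 0))]

/-- The vertices of the dodecahedron. -/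
def dodecahedronList : List ZVec :=
  [((1, 0), (1, 0), (1, 0)), ((0, 0), (-1, 1), (0, 1)), ((-1, 1), (0, 1), (0, 0)),
   ((0, 1), (0, 0), (-1, 1)), ((-1, 0), (1, 0), (1, 0)), ((0, 0), (1, -1), (0, 1)),
   ((1, 0), (1, 0), (-1, 0)), ((1, -1), (0, 1), (0, 0)), ((1, 0), (-1, 0), (1, 0)),
   ((0, 1), (0, 0), (1, -1)), ((0, -1), (0, 0), (-1, 1)), ((-1, 0), (-1, 0), (1, 0)),
   ((0, 0), (-1, 1), (0, -1)), ((-1, 0), (1, 0), (-1, 0)), ((-1, 1), (0, -1), (0, 0)),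
   ((1, 0), (-1, 0), (-1, 0)), ((0, -1), (0, 0), (1, -1)), ((1, -1), (0, -1), (0, 0)),
   ((0, 0), (1, -1), (0, -1)), ((-1, 0), (-1, 0), (-1, 0))]

/-- The vertices of the icosahedron. -/
def icosahedronList : List ZVec :=
  [((0, 1), (1, 0), (0, 0)), ((0, 1), (-1, 0), (0, 0)), ((1, 0), (0, 0), (0, 1)),
   ((1, 0), (0, 0), (0, -1)), ((0, 0), (0, 1), (1, 0)), ((0, 0), (0, 1), (-1, 0)),
   ((0, 0), (0, -1), (1, 0)), ((0, 0), (0, -1), (-1, 0)), ((-1, 0), (0, 0), (0, 1)),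
   ((-1, 0), (0, 0), (0, -1)), ((0, -1), (1, 0), (0, 0)), ((0, -1), (-1, 0), (0, 0))]

/-- The vertices of the rhombic triacontahedron. -/
def rhombicTriacontahedronList : List ZVec :=
  [((0, 1), (1, 0), (0, 0)), ((1, 0), (1, 0), (1, 0)), ((1, 0), (1, 0), (-1, 0)),
   ((-1, 1), (0, 1), (0, 0)), ((0, 1), (0, 0), (-1, 1)), ((0, 1), (0, 0), (1, -1)),
   ((1, 0), (0, 0), (0, 1)), ((0, 0), (0, 1), (1, 0)), ((1, 0), (0, 0), (0, -1)),
   ((0, 0), (0, 1), (-1, 0)), ((0, 1), (-1, 0), (0, 0)), ((1, 0), (-1, 0), (1, 0)),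
   ((0, 0), (-1, 1), (0, 1)), ((0, 0), (1, -1), (0, 1)), ((-1, 0), (1, 0), (1, 0)),
   ((1, -1), (0, 1), (0, 0)), ((1, 0), (-1, 0), (-1, 0)), ((0, 0), (-1, 1), (0, -1)),
   ((0, 0), (1, -1), (0, -1)), ((-1, 0), (1, 0), (-1, 0)), ((-1, 1), (0, -1), (0, 0)),
   ((0, 0), (0, -1), (1, 0)), ((-1, 0), (0, 0), (0, 1)), ((0, -1), (1, 0), (0, 0)),
   ((0, 0), (0, -1), (-1, 0)), ((-1, 0), (0, 0), (0, -1)), ((-1, 0), (-1, 0), (1, 0)),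
   ((1, -1), (0, -1), (0, 0)), ((0, -1), (0, 0), (-1, 1)), ((0, -1), (0, 0), (1, -1)),
   ((-1, 0), (-1, 0), (-1, 0)), ((0, -1), (-1, 0), (0, 0))]

/-- The vertices of the icosidodecahedron. -/
def icosidodecahedronList : List ZVec :=
  [((2, 0), (0, 0), (0, 0)), ((-2, 0), (0, 0), (0, 0)), ((0, 0), (0, 0), (2, 0)),
   ((0, 0), (0, 0), (-2, 0)), ((0, 0), (2, 0), (0, 0)), ((0, 0), (-2, 0), (0, 0)),
   ((1, 0), (0, 1), (-1, 1)), ((1, 0), (0, 1), (1, -1)), ((1, 0), (0, -1), (-1, 1)),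
   ((1, 0), (0, -1), (1, -1)), ((-1, 0), (0, 1), (-1, 1)), ((-1, 0), (0, 1), (1, -1)),
   ((-1, 0), (0, -1), (-1, 1)), ((-1, 0), (0, -1), (1, -1)), ((0, 1), (-1, 1), (1, 0)),
   ((0, 1), (-1, 1), (-1, 0)), ((0, 1), (1, -1), (1, 0)), ((0, 1), (1, -1), (-1, 0)),
   ((0, -1), (-1, 1), (1, 0)), ((0, -1), (-1, 1), (-1, 0)), ((0, -1), (1, -1), (1, 0)),
   ((0, -1), (1, -1), (-1, 0)), ((-1, 1), (1, 0), (0, 1)), ((-1, 1), (1, 0), (0, -1)),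
   ((-1, 1), (-1, 0), (0, 1)), ((-1, 1), (-1, 0), (0, -1)), ((1, -1), (1, 0), (0, 1)),
   ((1, -1), (1, 0), (0, -1)), ((1, -1), (-1, 0), (0, 1)), ((1, -1), (-1, 0), (0, -1))]

/-- The facets and the neighbours at each vertex of the tetrahedron. -/
def tetrahedronFan : List (List (ℕ × ℕ)) :=
  [[(1, 3), (2, 1), (3, 2)], [(0, 2), (3, 0), (2, 3)], [(0, 3), (1, 0), (3, 1)],
   [(0, 1), (2, 0), (1, 2)]]

/-- The parameters are the facet offset, the inner product of adjacent vertices, the ratio of the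
vertex sum of a facet to its normal, the number of vertices of a facet, and the squared norm of the
normals. -/
theorem isCertificate_tetrahedron :
    IsCertificate tetrahedronList tetrahedronDualList tetrahedronFan
      (1, 0) (-1, 0) (1, 0) 3 (3, 0) := by
  constructor <;> decide +kernel

/-- The facets and the neighbours at each vertex of the octahedron. -/
def octahedronFan : List (List (ℕ × ℕ)) :=
  [[(0, 1), (2, 4), (4, 2), (1, 3)], [(0, 3), (3, 5), (6, 4), (2, 0)],
   [(1, 0), (4, 4), (7, 5), (5, 3)], [(0, 0), (1, 2), (5, 5), (3, 1)],
   [(2, 1), (6, 5), (7, 2), (4, 0)], [(3, 3), (5, 2), (7, 4), (6, 1)]]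

theorem isCertificate_octahedron :
    IsCertificate octahedronList cubeList octahedronFan
      (1, 0) (0, 0) (1, 0) 3 (3, 0) := by
  constructor <;> decide +kernel

/-- The facets and the neighbours at each vertex of the cube. -/
def cubeFan : List (List (ℕ × ℕ)) :=
  [[(0, 1), (3, 3), (1, 2)], [(0, 4), (2, 5), (3, 0)], [(0, 0), (1, 6), (4, 4)],
   [(1, 0), (3, 5), (5, 6)], [(0, 2), (4, 7), (2, 1)], [(2, 7), (5, 3), (3, 1)],
   [(1, 3), (5, 7), (4, 2)], [(2, 4), (4, 6), (5, 5)]]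

theorem isCertificate_cube :
    IsCertificate cubeList octahedronList cubeFan
      (1, 0) (1, 0) (4, 0) 4 (1, 0) := by
  constructor <;> decide +kernel

/-- The facets and the neighbours at each vertex of the rhombic dodecahedron. -/
def rhombicDodecahedronFan : List (List (ℕ × ℕ)) :=
  [[(0, 3), (8, 2), (4, 1)], [(0, 0), (4, 5), (1, 6), (5, 4)], [(4, 0), (8, 7), (6, 8), (10, 5)],
   [(0, 4), (9, 9), (2, 7), (8, 0)], [(0, 1), (5, 10), (9, 3)], [(1, 1), (4, 2), (10, 11)],
   [(1, 11), (11, 10), (5, 1)], [(2, 12), (6, 2), (8, 3)], [(3, 11), (10, 2), (6, 12)],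
   [(2, 3), (9, 10), (7, 12)], [(5, 6), (11, 13), (7, 9), (9, 4)],
   [(1, 5), (10, 8), (3, 13), (11, 6)], [(2, 9), (7, 13), (3, 8), (6, 7)],
   [(3, 12), (7, 10), (11, 11)]]

theorem isCertificate_rhombicDodecahedron :
    IsCertificate rhombicDodecahedronList cuboctahedronList rhombicDodecahedronFan
      (2, 0) (2, 0) (4, 0) 4 (2, 0) := by
  constructor <;> decide +kernel

/-- The facets and the neighbours at each vertex of the dodecahedron. -/
def dodecahedronFan : List (List (ℕ × ℕ)) :=
  [[(0, 2), (4, 1), (2, 3)], [(2, 0), (4, 4), (8, 5)], [(0, 6), (5, 7), (4, 0)],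
   [(0, 0), (2, 8), (1, 9)], [(4, 7), (10, 10), (8, 1)], [(2, 1), (8, 11), (6, 8)],
   [(0, 9), (3, 12), (5, 2)], [(4, 2), (5, 13), (10, 4)], [(1, 3), (2, 5), (6, 14)],
   [(0, 3), (1, 15), (3, 6)], [(8, 4), (10, 16), (11, 11)], [(6, 5), (8, 10), (11, 17)],
   [(3, 18), (9, 13), (5, 6)], [(5, 12), (9, 16), (10, 7)], [(1, 8), (6, 17), (7, 15)],
   [(1, 14), (7, 18), (3, 9)], [(9, 19), (11, 10), (10, 13)], [(6, 11), (11, 19), (7, 14)],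
   [(3, 15), (7, 19), (9, 12)], [(7, 17), (11, 16), (9, 18)]]

/-- Read in ℝ, the parameters are φ², √5, φ + 2, 5 and φ + 2. -/
theorem isCertificate_dodecahedron :
    IsCertificate dodecahedronList icosahedronList dodecahedronFan
      (1, 1) (-1, 2) (2, 1) 5 (2, 1) := by
  constructor <;> decide +kernel

/-- The facets and the neighbours at each vertex of the icosahedron. -/
def icosahedronFan : List (List (ℕ × ℕ)) :=
  [[(0, 2), (3, 1), (9, 3), (6, 5), (2, 4)], [(3, 2), (8, 6), (14, 7), (15, 3), (9, 0)],
   [(0, 4), (1, 8), (5, 6), (8, 1), (3, 0)], [(6, 0), (9, 1), (15, 7), (18, 9), (12, 5)],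
   [(0, 0), (2, 5), (7, 10), (4, 8), (1, 2)], [(2, 0), (6, 3), (12, 9), (13, 10), (7, 4)],
   [(5, 8), (11, 11), (17, 7), (14, 1), (8, 2)], [(14, 6), (17, 11), (19, 9), (18, 3), (15, 1)],
   [(1, 4), (4, 10), (10, 11), (11, 6), (5, 2)], [(12, 3), (18, 7), (19, 11), (16, 10), (13, 5)],
   [(4, 4), (7, 5), (13, 9), (16, 11), (10, 8)], [(10, 10), (16, 9), (19, 7), (17, 6), (11, 8)]]

theorem isCertificate_icosahedron :
    IsCertificate icosahedronList dodecahedronList icosahedronFan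
      (1, 1) (0, 1) (1, 1) 3 (3, 0) := by
  constructor <;> decide +kernel

/-- The facets and the neighbours at each vertex of the rhombic triacontahedron. -/
def rhombicTriacontahedronFan : List (List (ℕ × ℕ)) :=
  [[(0, 5), (15, 2), (7, 3), (6, 1), (14, 4)], [(6, 7), (22, 6), (14, 0)],
   [(7, 0), (15, 8), (23, 9)], [(4, 7), (6, 0), (7, 9)], [(0, 0), (14, 6), (16, 10)],
   [(0, 10), (17, 8), (15, 0)], [(2, 13), (24, 11), (16, 4), (14, 1), (22, 12)],
   [(4, 15), (10, 14), (26, 12), (22, 1), (6, 3)], [(3, 17), (23, 2), (15, 5), (17, 16), (25, 18)],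
   [(4, 3), (7, 2), (23, 17), (27, 19), (11, 15)], [(0, 4), (16, 11), (8, 20), (9, 16), (17, 5)],
   [(8, 10), (16, 6), (24, 21)], [(2, 6), (22, 7), (26, 22)], [(2, 22), (28, 21), (24, 6)],
   [(10, 23), (18, 22), (26, 7)], [(4, 9), (11, 23), (10, 7)], [(9, 24), (25, 8), (17, 10)],
   [(3, 25), (27, 9), (23, 8)], [(3, 8), (25, 24), (29, 25)], [(11, 9), (27, 25), (19, 23)],
   [(5, 24), (9, 10), (8, 21)], [(5, 20), (8, 11), (24, 13), (28, 26), (12, 27)],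
   [(2, 12), (26, 14), (18, 28), (20, 26), (28, 13)],
   [(1, 28), (18, 14), (10, 15), (11, 19), (19, 29)],
   [(5, 27), (13, 30), (29, 18), (25, 16), (9, 20)],
   [(3, 18), (29, 30), (21, 29), (19, 19), (27, 17)], [(12, 21), (28, 22), (20, 31)],
   [(5, 21), (12, 31), (13, 24)], [(1, 31), (20, 22), (18, 23)], [(1, 23), (19, 25), (21, 31)],
   [(13, 31), (21, 25), (29, 24)], [(1, 29), (21, 30), (13, 27), (12, 26), (20, 28)]]

theorem isCertificate_rhombicTriacontahedron :
    IsCertificate rhombicTriacontahedronList icosidodecahedronList rhombicTriacontahedronFan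
      (0, 2) (1, 1) (0, 2) 4 (4, 0) := by
  constructor <;> decide +kernel


/-! ### Planar arcs -/

/-- The fundamental theorem of calculus on a great circle: κ is the constant part of f there and K a
primitive of the rest, expressed by the coordinates of the point, so that only the coordinates of
the ends enter. The condition `hpos` says that the short arc runs in the positive direction; the
expression in it is the sine of its length. -/
theorem arcIntegral_planar {f : C(E3, ℝ)} {e₁ e₂ : E3} (he₁ : ‖e₁‖ = 1) (he₂ : ‖e₂‖ = 1)
    (he : ⟪e₁, e₂⟫ = 0) {a₀ b₀ a₁ b₁ : ℝ} (h₀ : a₀ ^ 2 + b₀ ^ 2 = 1) (h₁ : a₁ ^ 2 + b₁ ^ 2 = 1)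
    (hpos : 0 < a₀ * b₁ - b₀ * a₁) {κ : ℝ} {K : ℝ → ℝ → ℝ}
    (hK : ∀ (a b : ℝ → ℝ) (t : ℝ), HasDerivAt a (-b t) t → HasDerivAt b (a t) t →
      a t ^ 2 + b t ^ 2 = 1 →
      HasDerivAt (fun τ => K (a τ) (b τ)) (f (a t • e₁ + b t • e₂) - κ) t) :
    arcIntegral f (a₀ • e₁ + b₀ • e₂) (a₁ • e₁ + b₁ • e₂) =
      κ * sphDist (a₀ • e₁ + b₀ • e₂) (a₁ • e₁ + b₁ • e₂) + K a₁ b₁ - K a₀ b₀ := by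
  set x := a₀ • e₁ + b₀ • e₂ with hx
  set y := a₁ • e₁ + b₁ • e₂ with hy
  have hc : ⟪x, y⟫ = a₀ * a₁ + b₀ * b₁ := by
    rw [hx, hy]
    simp only [inner_add_left, inner_add_right, inner_smul_left, inner_smul_right,
      real_inner_self_eq_norm_sq, real_inner_comm e₁ e₂, he, he₁, he₂]
    simp
    ring
  have hsq : (a₀ * a₁ + b₀ * b₁) ^ 2 + (a₀ * b₁ - b₀ * a₁) ^ 2 = 1 := by
    linear_combination (a₁ ^ 2 + b₁ ^ 2) * h₀ + h₁
  have hxy : |⟪x, y⟫| < 1 := by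
    rw [hc, ← sq_lt_one_iff_abs_lt_one]; nlinarith
  have hcos : Real.cos (sphDist x y) = a₀ * a₁ + b₀ * b₁ := by rw [cos_sphDist hxy, hc]
  have hsin : Real.sin (sphDist x y) = a₀ * b₁ - b₀ * a₁ := by
    have h1 := Real.sin_sq_add_cos_sq (sphDist x y)
    rw [hcos] at h1
    have h2 := sin_sphDist_pos hxy
    exact (pow_left_inj₀ h2.le hpos.le two_ne_zero).1 (by linarith)
  have hdir : arcDir x y = (-b₀) • e₁ + a₀ • e₂ := by
    have : y - ⟪x, y⟫ • x = (a₀ * b₁ - b₀ * a₁) • ((-b₀) • e₁ + a₀ • e₂) := by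
      rw [hc, hx, hy]
      match_scalars
      · linear_combination (-a₁) * h₀
      · linear_combination (-b₁) * h₀
    rw [arcDir, this, hsin, smul_smul, inv_mul_cancel₀ hpos.ne', one_smul]
  let a : ℝ → ℝ := fun t => a₀ * Real.cos t - b₀ * Real.sin t
  let b : ℝ → ℝ := fun t => b₀ * Real.cos t + a₀ * Real.sin t
  have harc (t : ℝ) : geodesicArc x y t = a t • e₁ + b t • e₂ := by
    rw [geodesicArc_eq hxy, hdir, hx]
    match_scalars <;> simp only [a, b] <;> ring
  have ha (t : ℝ) : HasDerivAt a (-b t) t := by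
    refine (((Real.hasDerivAt_cos t).const_mul a₀).sub
      ((Real.hasDerivAt_sin t).const_mul b₀)).congr_deriv ?_
    simp only [b]; ring
  have hb (t : ℝ) : HasDerivAt b (a t) t := by
    refine (((Real.hasDerivAt_cos t).const_mul b₀).add
      ((Real.hasDerivAt_sin t).const_mul a₀)).congr_deriv ?_
    simp only [a]; ring
  have hab (t : ℝ) : a t ^ 2 + b t ^ 2 = 1 := by
    have := Real.sin_sq_add_cos_sq t
    simp only [a, b]
    linear_combination (a₀ ^ 2 + b₀ ^ 2) * this + h₀
  have hcont : Continuous fun t => f (geodesicArc x y t) := by fun_prop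
  have hder (t : ℝ) : HasDerivAt (fun τ => K (a τ) (b τ) + κ * τ) (f (geodesicArc x y t)) t := by
    refine ((hK a b t (ha t) (hb t) (hab t)).add ((hasDerivAt_id t).const_mul κ)).congr_deriv ?_
    rw [harc]; ring
  rw [arcIntegral, intervalIntegral.integral_eq_sub_of_hasDerivAt (fun t _ => hder t)
    (hcont.intervalIntegrable _ _)]
  have ha0 : a 0 = a₀ := by simp [a]
  have hb0 : b 0 = b₀ := by simp [b]
  have ha1 : a (sphDist x y) = a₁ := by
    simp only [a, hcos, hsin]; linear_combination a₁ * h₀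
  have hb1 : b (sphDist x y) = b₁ := by
    simp only [b, hcos, hsin]; linear_combination b₁ * h₀
  rw [ha0, hb0, ha1, hb1]
  ring

/-! ### Binary forms -/

/-- The value at `(s, u)` of the binary form with the listed coefficients. -/
def evalForm : List ZPhi → ℝ → ℝ → ℝ
  | [], _, _ => 0
  | c :: l, s, u => c.toReal * s ^ l.length + u * evalForm l s u

/-- The product of a binary form with `a s + b u`, to which `b p` is added in the first
coefficient. -/
def mulLinear (a b : ZPhi) : ZPhi → List ZPhi → List ZPhi
  | p, [] => [b.mul p]
  | p, c :: l => ((a.mul c).add (b.mul p)) :: mulLinear a b c l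

theorem length_mulLinear (a b p : ZPhi) (l : List ZPhi) :
    (mulLinear a b p l).length = l.length + 1 := by
  induction l generalizing p with
  | nil => rfl
  | cons c l ih => simp [mulLinear, ih]

/-- The parameter `p` carries the preceding coefficient into the next one, which accounts for the
last summand. The induction needs it to be arbitrary; the product proper is the case p = 0. -/
theorem evalForm_mulLinear (a b p : ZPhi) (l : List ZPhi) (s u : ℝ) :
    evalForm (mulLinear a b p l) s u =
      (a.toReal * s + b.toReal * u) * evalForm l s u + b.toReal * p.toReal * s ^ l.length := by
  induction l generalizing p with
  | nil => simp [mulLinear, evalForm, ZPhi.toReal_mul]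
  | cons c l ih =>
    simp only [mulLinear, evalForm, ih, length_mulLinear, ZPhi.toReal_add, ZPhi.toReal_mul,
      List.length_cons]
    ring

/-- The product of the linear forms with the listed pairs of coefficients. -/
def linearProduct : List (ZPhi × ZPhi) → List ZPhi
  | [] => [(1, 0)]
  | x :: l => mulLinear x.1 x.2 (0, 0) (linearProduct l)

theorem length_linearProduct (l : List (ZPhi × ZPhi)) :
    (linearProduct l).length = l.length + 1 := by
  induction l with
  | nil => rfl
  | cons x l ih => simp [linearProduct, length_mulLinear, ih]

@[simp] theorem evalForm_linearProduct_nil (s u : ℝ) : evalForm (linearProduct []) s u = 1 := by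
  simp [linearProduct, evalForm, ZPhi.toReal]

@[simp] theorem evalForm_linearProduct_cons (x : ZPhi × ZPhi) (l : List (ZPhi × ZPhi)) (s u : ℝ) :
    evalForm (linearProduct (x :: l)) s u =
      (x.1.toReal * s + x.2.toReal * u) * evalForm (linearProduct l) s u := by
  rw [linearProduct, evalForm_mulLinear]
  simp [ZPhi.toReal]

/-- The sum of two binary forms. -/
def addForm (l l' : List ZPhi) : List ZPhi := List.zipWith ZPhi.add l l'

theorem evalForm_addForm {l l' : List ZPhi} (h : l.length = l'.length) (s u : ℝ) :
    evalForm (addForm l l') s u = evalForm l s u + evalForm l' s u := by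
  induction l generalizing l' with
  | nil =>
    rw [List.length_nil] at h
    rw [List.length_eq_zero_iff.1 h.symm]
    simp [addForm, evalForm]
  | cons c l ih =>
    cases l' with
    | nil => simp at h
    | cons c' l' =>
      have h' : l.length = l'.length := by simpa using h
      have := ih h'
      rw [addForm] at this
      simp only [addForm, List.zipWith_cons_cons, evalForm, this, List.length_zipWith, h',
        min_self, ZPhi.toReal_add]
      ring

/-- The form `form x y` is the restriction of `f` to the span of `x` and `y`. -/
def IsRestriction (f : C(E3, ℝ)) (form : ZVec → ZVec → List ZPhi) : Prop :=
  ∀ (x y : ZVec) (s u : ℝ), f (s • x.toE3 + u • y.toE3) = evalForm (form x y) s u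

/-- The product of the coordinates. -/
def tetForm (x y : ZVec) : List ZPhi := linearProduct [(x.1, y.1), (x.2.1, y.2.1), (x.2.2, y.2.2)]

theorem isRestriction_tetForm : IsRestriction (mono 1 1 1) tetForm := by
  intro x y s u
  simp [tetForm]
  ring

/-- The fourth power of a linear form. -/
def fourthForm (x : ZPhi × ZPhi) : List ZPhi := linearProduct [x, x, x, x]

/-- The sum of the fourth powers of the coordinates. -/
def octForm (x y : ZVec) : List ZPhi :=
  addForm (fourthForm (x.1, y.1)) (addForm (fourthForm (x.2.1, y.2.1)) (fourthForm (x.2.2, y.2.2)))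

theorem isRestriction_octForm : IsRestriction octInv octForm := by
  intro x y s u
  rw [octForm, evalForm_addForm (by simp [fourthForm, addForm, length_linearProduct]),
    evalForm_addForm (by simp [fourthForm, length_linearProduct])]
  simp [octInv, fourthForm]
  ring

/-- The icosahedral invariant. -/
def icoForm (x y : ZVec) : List ZPhi :=
  linearProduct (([(x, y), ((x.2.1, x.2.2, x.1), (y.2.1, y.2.2, y.1)),
    ((x.2.2, x.1, x.2.1), (y.2.2, y.1, y.2.1))] : List (ZVec × ZVec)).flatMap fun z =>
      [((ZPhi.mul (0, 1) z.1.1).add z.1.2.1, (ZPhi.mul (0, 1) z.2.1).add z.2.2.1),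
        ((ZPhi.mul (0, 1) z.1.1).sub z.1.2.1, (ZPhi.mul (0, 1) z.2.1).sub z.2.2.1)])

/-- Each factor φ²x² − y² of the invariant splits into (φx + y)(φx − y), so its restriction to a
plane is a product of six binary linear forms. -/
theorem isRestriction_icoForm : IsRestriction icoInv icoForm := by
  intro x y s u
  have h1 : ZPhi.toReal (0, 1) = Real.goldenRatio := by simp [ZPhi.toReal]
  simp only [icoInv, icoForm, List.flatMap_cons, List.flatMap_nil, List.cons_append,
    List.nil_append, evalForm_linearProduct_cons, evalForm_linearProduct_nil, ZPhi.toReal_add,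
    ZPhi.toReal_sub, ZPhi.toReal_mul, h1, ContinuousMap.coe_mk, PiLp.add_apply, PiLp.smul_apply,
    ZVec.toE3_zero, ZVec.toE3_one, ZVec.toE3_two, smul_eq_mul]
  ring

/-! ### Constancy on facet normals and edges -/

/-- The integral depends only on the inner products of the ends and on the restriction of f to their
span. Comparing coefficient lists thus replaces an argument by transitivity of the symmetry group on
the edges. -/
theorem arcIntegral_eq_of_restriction {f : E3 → ℝ} {x y x' y' : E3} (hx : ‖x‖ = ‖x'‖)
    (hy : ‖y‖ = ‖y'‖) (hxy : ⟪x, y⟫ = ⟪x', y'⟫)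
    (hf : ∀ s u : ℝ, f (s • x + u • y) = f (s • x' + u • y')) :
    arcIntegral f (proj x) (proj y) = arcIntegral f (proj x') (proj y') := by
  have hd : sphDist (proj x) (proj y) = sphDist (proj x') (proj y') := by
    simp only [sphDist, proj, inner_smul_left, inner_smul_right, hx, hy, hxy]
  have hp (s u : ℝ) : f (s • proj x + u • proj y) = f (s • proj x' + u • proj y') := by
    simp only [proj, smul_smul, hx, hy, hf]
  simp only [arcIntegral, geodesicArc, hd, hp]

namespace ZVec

theorem norm_toE3 (x : ZVec) : ‖x.toE3‖ = √(x.dot x).toReal := by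
  rw [norm_eq_sqrt_real_inner, inner_toE3]

/-- All edges are congruent to the reference edge, and the forms agree on them. -/
def EdgesUniform (V : List ZVec) (form : ZVec → ZVec → List ZPhi) (v w : ZVec) : Prop :=
  ∀ x ∈ V, ∀ y ∈ V, x.dot y = v.dot w →
    (x.dot x = v.dot v ∧ y.dot y = w.dot w ∧ form x y = form v w) ∨
    (y.dot y = v.dot v ∧ x.dot x = w.dot w ∧ form y x = form v w)

instance (V : List ZVec) (form : ZVec → ZVec → List ZPhi) (v w : ZVec) :
    Decidable (EdgesUniform V form v w) := by unfold EdgesUniform; infer_instance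

/-- All points have the norm of the reference point, and the forms agree on them. -/
def PointsUniform (N : List ZVec) (form : ZVec → ZVec → List ZPhi) (n : ZVec) : Prop :=
  ∀ x ∈ N, x.dot x = n.dot n ∧ form x x = form n n

instance (N : List ZVec) (form : ZVec → ZVec → List ZPhi) (n : ZVec) :
    Decidable (PointsUniform N form n) := by unfold PointsUniform; infer_instance

variable {f : C(E3, ℝ)} {form : ZVec → ZVec → List ZPhi} {V N : List ZVec} {v w n : ZVec}

theorem PointsUniform.eq (H : PointsUniform N form n) (hf : IsRestriction f form) {x : E3}
    (hx : x ∈ toFinset N) : f (proj x) = f (proj n.toE3) := by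
  obtain ⟨x, hx', rfl⟩ := mem_toFinset.1 hx
  obtain ⟨h1, h2⟩ := H x hx'
  have e (y : ZVec) (s : ℝ) : f (s • y.toE3) = evalForm (form y y) s 0 := by
    rw [← hf, zero_smul, add_zero]
  rw [proj, proj, norm_toE3, norm_toE3, h1, e, e, h2]

/-- Used twice: with the invariant itself for `g`, and with the constant one, for which the integral
is the length of the edge. -/
theorem EdgesUniform.edgeIntegral_eq (H : EdgesUniform V form v w) {g : E3 → ℝ}
    (hg : ∀ x y x' y' : ZVec, form x y = form x' y' → ∀ s u : ℝ,
      g (s • x.toE3 + u • y.toE3) = g (s • x'.toE3 + u • y'.toE3)) {e : Sym2 E3}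
    (he : e ∈ edgePairs (toFinset V) (v.dot w).toReal) :
    edgeIntegral g e = arcIntegral g (proj v.toE3) (proj w.toE3) := by
  induction e with | _ x y => ?_
  obtain ⟨hx, hy, hxy⟩ := mk_mem_edgePairs.1 he
  obtain ⟨x, hx', rfl⟩ := mem_toFinset.1 hx
  obtain ⟨y, hy', rfl⟩ := mem_toFinset.1 hy
  rw [inner_toE3, ZPhi.toReal_inj] at hxy
  rcases H x hx' y hy' hxy with ⟨h1, h2, h3⟩ | ⟨h1, h2, h3⟩
  · exact arcIntegral_eq_of_restriction (by rw [norm_toE3, norm_toE3, h1])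
      (by rw [norm_toE3, norm_toE3, h2]) (by rw [inner_toE3, inner_toE3, hxy]) (hg _ _ _ _ h3)
  · rw [edgeIntegral_mk, arcIntegral_comm]
    exact arcIntegral_eq_of_restriction (by rw [norm_toE3, norm_toE3, h1])
      (by rw [norm_toE3, norm_toE3, h2]) (by rw [real_inner_comm, inner_toE3, inner_toE3, hxy])
      (hg _ _ _ _ h3)

theorem hybridFunctional_eq (HN : PointsUniform N form n) (HV : EdgesUniform V form v w)
    (hf : IsRestriction f form) (hN : (toFinset N).Nonempty)
    (hV : (edgePairs (toFinset V) (v.dot w).toReal).Nonempty) (β : ℝ) :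
    hybridFunctional β (toFinset N) (edgePairs (toFinset V) (v.dot w).toReal) f =
      β * f (proj n.toE3) + (1 - β) / sphDist (proj v.toE3) (proj w.toE3) *
        arcIntegral f (proj v.toE3) (proj w.toE3) :=
  hybridFunctional_of_const hN hV (fun x hx => HN.eq hf hx)
    (fun e he => by
      rw [HV.edgeIntegral_eq (fun _ _ _ _ _ _ _ => rfl) he, arcIntegral_one])
    (fun e he => HV.edgeIntegral_eq (fun x y x' y' h s u => by rw [hf, hf, h]) he)

/-! ### Symmetries of lists of vectors -/

theorem cyc_mem_toFinset {l : List ZVec} (h : ∀ x ∈ l, ((x.2.1, x.2.2, x.1) : ZVec) ∈ l) :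
    ∀ v ∈ toFinset l, cyc v ∈ toFinset l := by
  intro v hv
  obtain ⟨x, hx, rfl⟩ := mem_toFinset.1 hv
  refine mem_toFinset.2 ⟨_, h x hx, ?_⟩
  ext i; fin_cases i <;> simp [cyc, toE3]

theorem flipX_mem_toFinset {l : List ZVec} (h : ∀ x ∈ l, ((x.1.neg, x.2.1, x.2.2) : ZVec) ∈ l) :
    ∀ v ∈ toFinset l, flipX v ∈ toFinset l := by
  intro v hv
  obtain ⟨x, hx, rfl⟩ := mem_toFinset.1 hv
  refine mem_toFinset.2 ⟨_, h x hx, ?_⟩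
  ext i; fin_cases i <;> simp [flipX, toE3, ZPhi.toReal_neg]

theorem flipYZ_mem_toFinset {l : List ZVec}
    (h : ∀ x ∈ l, ((x.1, x.2.1.neg, x.2.2.neg) : ZVec) ∈ l) :
    ∀ v ∈ toFinset l, flipYZ v ∈ toFinset l := by
  intro v hv
  obtain ⟨x, hx, rfl⟩ := mem_toFinset.1 hv
  refine mem_toFinset.2 ⟨_, h x hx, ?_⟩
  ext i; fin_cases i <;> simp [flipYZ, toE3, ZPhi.toReal_neg]

/-- Twice the image under the icosahedral reflection. -/
def twiceReflection (x : ZVec) : ZVec :=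
  (dot ((1, 0), (0, -1), (1, -1)) x, dot ((0, -1), (1, -1), (-1, 0)) x,
    dot ((1, -1), (-1, 0), (0, 1)) x)

/-- The matrix of the reflection has halves as entries; after doubling, the condition can be checked
in ℤ[φ]. -/
theorem icoReflection_mem_toFinset {l : List ZVec}
    (h : ∀ x ∈ l, ∃ y ∈ l, y.add y = twiceReflection x) :
    ∀ v ∈ toFinset l, icoReflection v ∈ toFinset l := by
  intro v hv
  obtain ⟨x, hx, rfl⟩ := mem_toFinset.1 hv
  obtain ⟨y, hy, hyx⟩ := h x hx
  refine mem_toFinset.2 ⟨y, hy, ?_⟩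
  have h1 := congrArg toE3 hyx
  rw [toE3_add, ← two_smul ℝ] at h1
  refine smul_right_injective E3 (two_ne_zero (α := ℝ)) (h1.trans ?_)
  ext i
  fin_cases i <;> simp [icoReflection, toE3, twiceReflection, dot, ZPhi.toReal_add,
    ZPhi.toReal_mul] <;> simp [ZPhi.toReal] <;> ring

/-- The vectors that arise from `(a, b, c)` by sign changes. -/
def signedList (a b c : ZPhi) : List ZVec :=
  [a, a.neg].product ([b, b.neg].product [c, c.neg])

/-- The vectors that arise from `(a, b, c)` by cyclic permutations and sign changes. -/
def cyclicSignedList (a b c : ZPhi) : List ZVec :=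
  signedList a b c ++ signedList b c a ++ signedList c a b

theorem mem_toFinset_append {l l' : List ZVec} {x : E3} :
    x ∈ toFinset (l ++ l') ↔ x ∈ toFinset l ∨ x ∈ toFinset l' := by
  simp only [mem_toFinset, List.mem_append, or_and_right, exists_or]

theorem mem_toFinset_signedList {a b c : ZPhi} (ha : 0 ≤ a.toReal) (hb : 0 ≤ b.toReal)
    (hc : 0 ≤ c.toReal) {x : E3} :
    x ∈ toFinset (signedList a b c) ↔ |x 0| = a.toReal ∧ |x 1| = b.toReal ∧ |x 2| = c.toReal := by
  rw [abs_eq ha, abs_eq hb, abs_eq hc, ← ZPhi.toReal_neg, ← ZPhi.toReal_neg, ← ZPhi.toReal_neg,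
    mem_toFinset]
  constructor
  · rintro ⟨⟨p, q, r⟩, hx, rfl⟩
    simp only [signedList, List.pair_mem_product, List.mem_cons, List.not_mem_nil, or_false] at hx
    simpa only [toE3_zero, toE3_one, toE3_two, ZPhi.toReal_inj] using hx
  · rintro ⟨h0, h1, h2⟩
    have key (d : ZPhi) (z : ℝ) (h : z = d.toReal ∨ z = d.neg.toReal) :
        ∃ e ∈ [d, d.neg], e.toReal = z := by
      rcases h with rfl | rfl <;> exact ⟨_, by simp, rfl⟩
    obtain ⟨p, hp, h0⟩ := key _ _ h0
    obtain ⟨q, hq, h1⟩ := key _ _ h1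
    obtain ⟨r, hr, h2⟩ := key _ _ h2
    refine ⟨(p, q, r), List.pair_mem_product.2 ⟨hp, List.pair_mem_product.2 ⟨hq, hr⟩⟩, ?_⟩
    ext i; fin_cases i <;> simp [toE3, h0, h1, h2]

theorem coe_toFinset_cyclicSignedList {a b c : ZPhi} (ha : 0 ≤ a.toReal) (hb : 0 ≤ b.toReal)
    (hc : 0 ≤ c.toReal) :
    (toFinset (cyclicSignedList a b c) : Set E3) = cyclicSigned a.toReal b.toReal c.toReal := by
  ext x
  rw [Finset.mem_coe, cyclicSignedList, mem_toFinset_append, mem_toFinset_append,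
    mem_toFinset_signedList ha hb hc, mem_toFinset_signedList hb hc ha,
    mem_toFinset_signedList hc ha hb, or_assoc]
  rfl

theorem toFinset_congr {l l' : List ZVec} (h : (∀ x ∈ l, x ∈ l') ∧ ∀ x ∈ l', x ∈ l) :
    toFinset l = toFinset l' := by
  ext x
  rw [mem_toFinset, mem_toFinset]
  exact exists_congr fun y => and_congr_left fun _ => ⟨h.1 y, h.2 y⟩

end ZVec

/-! ### From certificates to hybrid designs -/

namespace IsCertificate

open ZVec

variable {V N : List ZVec} {fan : List (List (ℕ × ℕ))} {h t μ ν : ZPhi} {m : ℕ}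

theorem normals_nonempty (C : IsCertificate V N fan h t μ m ν) : (toFinset N).Nonempty := by
  have h0 : 0 < V.length := by have := C.two_le; omega
  exact ⟨_, nth_mem_toFinset (C.fan_entry 0 h0 0 (C.fan_length 0 h0)).1⟩

/-- Let the values of `f` on the normals and its integrals along the edges be constant. Then the
hybrid design property follows if the mean of `f` is the correct one and a symmetric functional
with zeros at `1` and `f` vanishes on all polynomials of degree at most `s`. -/
theorem edgesVerticesHybrid (C : IsCertificate V N fan h t μ m ν) {v w n : ZVec}
    (ht : v.dot w = t) {f : C(E3, ℝ)} {form : ZVec → ZVec → List ZPhi} (hf : IsRestriction f form)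
    (HN : PointsUniform N form n) (HV : EdgesUniform V form v w) {s : ℕ}
    (hvan : ∀ D : C(E3, ℝ) →ₗ[ℝ] ℝ, IsSpherical D →
      (∀ O : E3 ≃ₗᵢ[ℝ] E3, (∀ x ∈ toFinset V, O x ∈ toFinset V) →
        (∀ x ∈ toFinset N, O x ∈ toFinset N) → IsInvariant D O) →
      D (mono 0 0 0) = 0 → D f = 0 → ∀ a b c : ℕ, a + b + c ≤ s → D (mono a b c) = 0)
    {β : ℝ} (h0 : 0 ≤ β) (h1 : β ≤ 1)
    (hβ : β * f (proj n.toE3) + (1 - β) / sphDist (proj v.toE3) (proj w.toE3) *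
      arcIntegral f (proj v.toE3) (proj w.toE3) = meanFunctional f)
    {P : Set E3} (hP : IsCopyOf (convexHull ℝ (toFinset V : Set E3)) P) :
    IsCopyOf (convexHull ℝ (toFinset N : Set E3)) (dualPolytope P) ∧
      EdgesVerticesHybrid P (dualPolytope P) s β := by
  have D := C.isHybridData
  refine D.isCopyOf_dualPolytope_and_hybrid h0 h1 (fun g hg => ?_) hP
  refine sub_eq_zero.1 (vanish_of_monomials (D := hybridFunctional β (toFinset N)
    (edgePairs (toFinset V) t.toReal) - meanFunctional) (hvan _ ?_ ?_ ?_ ?_) hg)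
  · intro p q hpq
    rw [LinearMap.sub_apply, LinearMap.sub_apply, meanFunctional_isSpherical p q hpq,
      hybridFunctional_isSpherical D.normal_ne_zero D.isGoodEdge p q hpq]
  · intro O hV hN p
    rw [LinearMap.sub_apply, LinearMap.sub_apply, meanFunctional_isInvariant O p,
      hybridFunctional_isInvariant hN (fun e he => map_mem_edgePairs hV he) p]
  · have h1 : mono 0 0 0 = 1 := by ext; simp
    rw [LinearMap.sub_apply, h1, meanFunctional_one, ← h1,
      hybridFunctional_one C.normals_nonempty D.edgePairs_nonempty D.isGoodEdge, sub_self]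
  · subst ht
    rw [LinearMap.sub_apply, hybridFunctional_eq HN HV hf C.normals_nonempty D.edgePairs_nonempty,
      hβ, sub_self]

end IsCertificate

/-! ### Integrals of the invariants along arcs -/

theorem proj_eq_planar {e₁ e₂ : E3} (he₁ : ‖e₁‖ = 1) (he₂ : ‖e₂‖ = 1) (he : ⟪e₁, e₂⟫ = 0)
    {v : E3} {a b r : ℝ} (hv : v = a • e₁ + b • e₂) (hr : 0 < r) (hab : a ^ 2 + b ^ 2 = r ^ 2) :
    proj v = (a / r) • e₁ + (b / r) • e₂ := by
  have hn : ‖v‖ = r := by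
    have : ‖v‖ ^ 2 = r ^ 2 := by
      rw [hv, @norm_add_sq_real, norm_smul, norm_smul, inner_smul_left, inner_smul_right, he, he₁,
        he₂]
      simpa using hab
    exact (pow_left_inj₀ (norm_nonneg _) hr.le two_ne_zero).1 this
  rw [proj, hn, hv, smul_add, smul_smul, smul_smul]
  simp only [div_eq_inv_mul]

theorem arcIntegral_proj_planar {f : C(E3, ℝ)} {e₁ e₂ : E3} (he₁ : ‖e₁‖ = 1) (he₂ : ‖e₂‖ = 1)
    (he : ⟪e₁, e₂⟫ = 0) {v w : E3} {a₀ b₀ r₀ a₁ b₁ r₁ : ℝ} (hv : v = a₀ • e₁ + b₀ • e₂)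
    (hw : w = a₁ • e₁ + b₁ • e₂) (hr₀ : 0 < r₀) (hr₁ : 0 < r₁) (h₀ : a₀ ^ 2 + b₀ ^ 2 = r₀ ^ 2)
    (h₁ : a₁ ^ 2 + b₁ ^ 2 = r₁ ^ 2) (hpos : 0 < a₀ * b₁ - b₀ * a₁) {κ : ℝ} {K : ℝ → ℝ → ℝ}
    (hK : ∀ (a b : ℝ → ℝ) (t : ℝ), HasDerivAt a (-b t) t → HasDerivAt b (a t) t →
      a t ^ 2 + b t ^ 2 = 1 →
      HasDerivAt (fun τ => K (a τ) (b τ)) (f (a t • e₁ + b t • e₂) - κ) t) :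
    arcIntegral f (proj v) (proj w) =
      κ * sphDist (proj v) (proj w) + K (a₁ / r₁) (b₁ / r₁) - K (a₀ / r₀) (b₀ / r₀) := by
  rw [proj_eq_planar he₁ he₂ he hv hr₀ h₀, proj_eq_planar he₁ he₂ he hw hr₁ h₁]
  refine arcIntegral_planar he₁ he₂ he ?_ ?_ ?_ hK
  · field_simp; exact h₀
  · field_simp; exact h₁
  · have : a₀ / r₀ * (b₁ / r₁) - b₀ / r₀ * (a₁ / r₁) = (a₀ * b₁ - b₀ * a₁) / (r₀ * r₁) := by
      field_simp
    rw [this]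
    positivity

theorem hasDerivAt_circle_monomial {a b : ℝ → ℝ} {t : ℝ} (ha : HasDerivAt a (-b t) t)
    (hb : HasDerivAt b (a t) t) (i j : ℕ) :
    HasDerivAt (fun τ => a τ ^ (i + 1) * b τ ^ (j + 1))
      ((j + 1) * (a t ^ (i + 2) * b t ^ j) - (i + 1) * (a t ^ i * b t ^ (j + 2))) t := by
  refine ((ha.pow (i + 1)).mul (hb.pow (j + 1))).congr_deriv ?_
  simp only [Nat.add_sub_cancel, Pi.pow_apply]
  push_cast
  ring

/-- The first coordinate vector. -/
def xAxis : E3 := !₂[1, 0, 0]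

/-- The second coordinate vector. -/
def yAxis : E3 := !₂[0, 1, 0]

/-- The unit vector on the diagonal between the second and the third coordinate vector. -/
def yzDiagonal : E3 := !₂[0, √2 / 2, √2 / 2]

theorem norm_xAxis : ‖xAxis‖ = 1 := by
  rw [EuclideanSpace.norm_eq, Fin.sum_univ_three]; simp [xAxis]

theorem norm_yAxis : ‖yAxis‖ = 1 := by
  rw [EuclideanSpace.norm_eq, Fin.sum_univ_three]; simp [yAxis]

theorem norm_yzDiagonal : ‖yzDiagonal‖ = 1 := by
  have h : √2 ^ 2 = 2 := Real.sq_sqrt (by norm_num)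
  rw [EuclideanSpace.norm_eq, Fin.sum_univ_three]
  simp [yzDiagonal, div_pow, h]
  norm_num

theorem inner_xAxis_yAxis : ⟪xAxis, yAxis⟫ = 0 := by simp [inner_E3, xAxis, yAxis]

theorem inner_xAxis_yzDiagonal : ⟪xAxis, yzDiagonal⟫ = 0 := by simp [inner_E3, xAxis, yzDiagonal]

/-- On this circle the invariant is 3/4 + cos(4θ)/4, and sin(4θ)/16 is the stated form in cos θ and
sin θ. -/
theorem hasDerivAt_octInv_xy (a b : ℝ → ℝ) (t : ℝ) (ha : HasDerivAt a (-b t) t)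
    (hb : HasDerivAt b (a t) t) (hab : a t ^ 2 + b t ^ 2 = 1) :
    HasDerivAt (fun τ => (a τ ^ 3 * b τ ^ 1 - a τ ^ 1 * b τ ^ 3) / 4)
      (octInv (a t • xAxis + b t • yAxis) - 3 / 4) t := by
  refine (((hasDerivAt_circle_monomial ha hb 2 0).sub
    (hasDerivAt_circle_monomial ha hb 0 2)).div_const 4).congr_deriv ?_
  simp [octInv, xAxis, yAxis]
  linear_combination (-3 / 4) * (a t ^ 2 + b t ^ 2 + 1) * hab

/-- Here the invariant is a⁴ + b⁴/2, whose mean over the circle is 9/16. -/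
theorem hasDerivAt_octInv_diagonal (a b : ℝ → ℝ) (t : ℝ) (ha : HasDerivAt a (-b t) t)
    (hb : HasDerivAt b (a t) t) (hab : a t ^ 2 + b t ^ 2 = 1) :
    HasDerivAt (fun τ => 7 / 16 * (a τ ^ 3 * b τ ^ 1) + 1 / 16 * (a τ ^ 1 * b τ ^ 3))
      (octInv (a t • xAxis + b t • yzDiagonal) - 9 / 16) t := by
  have h : √2 ^ 2 = 2 := Real.sq_sqrt (by norm_num)
  have h4 : √2 ^ 4 = 4 := by linear_combination (√2 ^ 2 + 2) * h
  refine (((hasDerivAt_circle_monomial ha hb 2 0).const_mul _).add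
    ((hasDerivAt_circle_monomial ha hb 0 2).const_mul _)).congr_deriv ?_
  simp [octInv, xAxis, yzDiagonal, mul_pow, div_pow, h4]
  linear_combination (-9 / 16) * (a t ^ 2 + b t ^ 2 + 1) * hab

theorem hasDerivAt_mono_diagonal (a b : ℝ → ℝ) (t : ℝ) (_ha : HasDerivAt a (-b t) t)
    (hb : HasDerivAt b (a t) t) (_hab : a t ^ 2 + b t ^ 2 = 1) :
    HasDerivAt (fun τ => b τ ^ 3 / 6) (mono 1 1 1 (a t • xAxis + b t • yzDiagonal) - 0) t := by
  have h : √2 ^ 2 = 2 := Real.sq_sqrt (by norm_num)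
  refine ((hb.pow 3).div_const 6).congr_deriv ?_
  simp [xAxis, yzDiagonal]
  linear_combination (-(a t * b t ^ 2) / 4) * h

/-- For z = 0 the invariant is φ²a²b⁴ − φ⁴a⁴b². Both monomials have mean 1/16 over the circle, and
φ⁴ − φ² = 2φ + 1. -/
theorem hasDerivAt_icoInv_xy (a b : ℝ → ℝ) (t : ℝ) (ha : HasDerivAt a (-b t) t)
    (hb : HasDerivAt b (a t) t) (hab : a t ^ 2 + b t ^ 2 = 1) :
    HasDerivAt (fun τ => (2 * Real.goldenRatio + 1) / 16 * (a τ ^ 5 * b τ ^ 1 - a τ ^ 1 * b τ ^ 5) -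
        (4 * Real.goldenRatio + 3) / 6 * (a τ ^ 3 * b τ ^ 3))
      (icoInv (a t • xAxis + b t • yAxis) - -(2 * Real.goldenRatio + 1) / 16) t := by
  have h : Real.goldenRatio ^ 2 = Real.goldenRatio + 1 := Real.goldenRatio_sq
  refine ((((hasDerivAt_circle_monomial ha hb 4 0).sub
    (hasDerivAt_circle_monomial ha hb 0 4)).const_mul _).sub
    ((hasDerivAt_circle_monomial ha hb 2 2).const_mul _)).congr_deriv ?_
  simp [icoInv, xAxis, yAxis]
  generalize Real.goldenRatio = p at *
  generalize a t = x at *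
  generalize b t = y at *
  linear_combination ((2 * p + 1) / 16) * ((x ^ 2 + y ^ 2) ^ 2 + (x ^ 2 + y ^ 2) + 1) * hab +
    x ^ 4 * y ^ 2 * h

/-! ### The vertex sets -/

namespace ZVec

theorem coe_toFinset_append (l l' : List ZVec) :
    (toFinset (l ++ l') : Set E3) = (toFinset l : Set E3) ∪ (toFinset l' : Set E3) :=
  Set.ext fun _ => mem_toFinset_append

theorem cyclicSigned_eq (a b c : ZPhi) {A B C : ℝ} (hA : a.toReal = A) (hB : b.toReal = B)
    (hC : c.toReal = C) (ha : 0 ≤ A) (hb : 0 ≤ B) (hc : 0 ≤ C) :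
    cyclicSigned A B C = toFinset (cyclicSignedList a b c) := by
  subst hA hB hC
  exact (coe_toFinset_cyclicSignedList ha hb hc).symm

end ZVec

open ZVec

theorem toReal_goldenRatio_inv : ZPhi.toReal (-1, 1) = Real.goldenRatio⁻¹ := by
  have h : Real.goldenRatio ^ 2 = Real.goldenRatio + 1 := Real.goldenRatio_sq
  refine eq_inv_of_mul_eq_one_left ?_
  simp only [ZPhi.toReal]
  push_cast
  linear_combination h

theorem vertexSet_octahedron : cyclicSigned 1 0 0 = toFinset octahedronList := by
  rw [cyclicSigned_eq (1, 0) (0, 0) (0, 0) (by simp [ZPhi.toReal]) (by simp [ZPhi.toReal])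
    (by simp [ZPhi.toReal]) zero_le_one le_rfl le_rfl]
  exact congrArg _ (toFinset_congr (by decide +kernel))

theorem cyclicSigned_one_one_one :
    cyclicSigned 1 1 1 = toFinset (cyclicSignedList (1, 0) (1, 0) (1, 0)) :=
  cyclicSigned_eq (1, 0) (1, 0) (1, 0) (by simp [ZPhi.toReal]) (by simp [ZPhi.toReal])
    (by simp [ZPhi.toReal]) zero_le_one zero_le_one zero_le_one

theorem cyclicSigned_two_zero_zero :
    cyclicSigned 2 0 0 = toFinset (cyclicSignedList (2, 0) (0, 0) (0, 0)) :=
  cyclicSigned_eq (2, 0) (0, 0) (0, 0) (by simp [ZPhi.toReal]) (by simp [ZPhi.toReal])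
    (by simp [ZPhi.toReal]) zero_le_two le_rfl le_rfl

theorem cyclicSigned_goldenRatio_one_zero :
    cyclicSigned Real.goldenRatio 1 0 = toFinset (cyclicSignedList (0, 1) (1, 0) (0, 0)) :=
  cyclicSigned_eq (0, 1) (1, 0) (0, 0) (by simp [ZPhi.toReal]) (by simp [ZPhi.toReal])
    (by simp [ZPhi.toReal]) Real.goldenRatio_pos.le zero_le_one le_rfl

theorem cyclicSigned_zero_inv_goldenRatio : cyclicSigned 0 Real.goldenRatio⁻¹ Real.goldenRatio =
    toFinset (cyclicSignedList (0, 0) (-1, 1) (0, 1)) :=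
  cyclicSigned_eq (0, 0) (-1, 1) (0, 1) (by simp [ZPhi.toReal]) toReal_goldenRatio_inv
    (by simp [ZPhi.toReal]) le_rfl (inv_nonneg.2 Real.goldenRatio_pos.le) Real.goldenRatio_pos.le

theorem cyclicSigned_one_goldenRatio_inv : cyclicSigned 1 Real.goldenRatio Real.goldenRatio⁻¹ =
    toFinset (cyclicSignedList (1, 0) (0, 1) (-1, 1)) :=
  cyclicSigned_eq (1, 0) (0, 1) (-1, 1) (by simp [ZPhi.toReal]) (by simp [ZPhi.toReal])
    toReal_goldenRatio_inv zero_le_one Real.goldenRatio_pos.le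
    (inv_nonneg.2 Real.goldenRatio_pos.le)

theorem vertexSet_cube : cyclicSigned 1 1 1 = toFinset cubeList := by
  rw [cyclicSigned_one_one_one]
  exact congrArg _ (toFinset_congr (by decide +kernel))

theorem vertexSet_cuboctahedron : cyclicSigned 1 1 0 = toFinset cuboctahedronList := by
  rw [cyclicSigned_eq (1, 0) (1, 0) (0, 0) (by simp [ZPhi.toReal]) (by simp [ZPhi.toReal])
    (by simp [ZPhi.toReal]) zero_le_one zero_le_one le_rfl]
  exact congrArg _ (toFinset_congr (by decide +kernel))

theorem vertexSet_rhombicDodecahedron :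
    cyclicSigned 1 1 1 ∪ cyclicSigned 2 0 0 = toFinset rhombicDodecahedronList := by
  rw [cyclicSigned_one_one_one, cyclicSigned_two_zero_zero, ← coe_toFinset_append]
  exact congrArg _ (toFinset_congr (by decide +kernel))

theorem vertexSet_icosahedron :
    cyclicSigned Real.goldenRatio 1 0 = toFinset icosahedronList := by
  rw [cyclicSigned_goldenRatio_one_zero]
  exact congrArg _ (toFinset_congr (by decide +kernel))

theorem vertexSet_dodecahedron :
    cyclicSigned 1 1 1 ∪ cyclicSigned 0 Real.goldenRatio⁻¹ Real.goldenRatio =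
      toFinset dodecahedronList := by
  rw [cyclicSigned_one_one_one, cyclicSigned_zero_inv_goldenRatio, ← coe_toFinset_append]
  exact congrArg _ (toFinset_congr (by decide +kernel))

theorem vertexSet_icosidodecahedron :
    cyclicSigned 2 0 0 ∪ cyclicSigned 1 Real.goldenRatio Real.goldenRatio⁻¹ =
      toFinset icosidodecahedronList := by
  rw [cyclicSigned_two_zero_zero, cyclicSigned_one_goldenRatio_inv, ← coe_toFinset_append]
  exact congrArg _ (toFinset_congr (by decide +kernel))

theorem vertexSet_rhombicTriacontahedron :
    cyclicSigned Real.goldenRatio 1 0 ∪ cyclicSigned 1 1 1 ∪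
      cyclicSigned 0 Real.goldenRatio⁻¹ Real.goldenRatio =
      toFinset rhombicTriacontahedronList := by
  rw [cyclicSigned_goldenRatio_one_zero, cyclicSigned_one_one_one,
    cyclicSigned_zero_inv_goldenRatio, ← coe_toFinset_append, ← coe_toFinset_append]
  exact congrArg _ (toFinset_congr (by decide +kernel))

theorem vertexSet_tetrahedron :
    ({!₂[1, 1, 1], !₂[1, -1, -1], !₂[-1, 1, -1], !₂[-1, -1, 1]} : Set E3) =
      toFinset tetrahedronList := by
  ext x
  rw [Finset.mem_coe, mem_toFinset]
  simp [tetrahedronList, toE3, ZPhi.toReal, eq_comm]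

/-- The dual list consists of the negatives of the vertices, and −1 is absorbed by the orthogonal
map. -/
theorem isTetrahedron_of_isCopyOf {P : Set E3}
    (h : IsCopyOf (convexHull ℝ (toFinset tetrahedronDualList : Set E3)) P) :
    IsTetrahedron P := by
  obtain ⟨r, O, hr, rfl⟩ := h
  refine ⟨r, (LinearIsometryEquiv.neg ℝ).trans O, hr, ?_⟩
  have : (toFinset tetrahedronDualList : Set E3) =
      (LinearEquiv.neg ℝ : E3 ≃ₗ[ℝ] E3).toLinearMap '' (toFinset tetrahedronList : Set E3) := by
    ext x
    simp only [Finset.mem_coe, mem_toFinset, Set.mem_image, exists_exists_and_eq_and]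
    simp [tetrahedronDualList, tetrahedronList, toE3, ZPhi.toReal, ← WithLp.toLp_neg]
  rw [vertexSet_tetrahedron, this, ← LinearMap.image_convexHull, Set.image_image]
  rfl

/-! ### The seven pairs of polytopes -/

section Families

variable {V N : List ZVec} {fan : List (List (ℕ × ℕ))} {h t μ ν : ZPhi} {m : ℕ} {v w n : ZVec}
  {β : ℝ} {P : Set E3}

/-- The closure of a list under the symmetries that generate the group of the cube. -/
def IsOctSymmetric (l : List ZVec) : Prop :=
  (∀ x ∈ l, ((x.2.1, x.2.2, x.1) : ZVec) ∈ l) ∧ ∀ x ∈ l, ((x.1.neg, x.2.1, x.2.2) : ZVec) ∈ l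

instance (l : List ZVec) : Decidable (IsOctSymmetric l) := by unfold IsOctSymmetric; infer_instance

theorem IsCertificate.octahedral (C : IsCertificate V N fan h t μ m ν) (ht : v.dot w = t)
    (hVs : IsOctSymmetric V) (hNs : IsOctSymmetric N) (HN : PointsUniform N octForm n)
    (HV : EdgesUniform V octForm v w) (h0 : 0 ≤ β) (h1 : β ≤ 1)
    (hβ : β * octInv (proj n.toE3) + (1 - β) / sphDist (proj v.toE3) (proj w.toE3) *
      arcIntegral octInv (proj v.toE3) (proj w.toE3) = 3 / 5)
    (hP : IsCopyOf (convexHull ℝ (toFinset V : Set E3)) P) :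
    IsCopyOf (convexHull ℝ (toFinset N : Set E3)) (dualPolytope P) ∧
      EdgesVerticesHybrid P (dualPolytope P) 5 β :=
  C.edgesVerticesHybrid ht isRestriction_octForm HN HV (fun _ hs hi h1 h4 =>
    octahedral_vanishing hs (hi cyc (cyc_mem_toFinset hVs.1) (cyc_mem_toFinset hNs.1))
      (hi flipX (flipX_mem_toFinset hVs.2) (flipX_mem_toFinset hNs.2)) h1 h4) h0 h1
    (hβ.trans meanFunctional_octInv.symm) hP

/-- The closure of a list under the symmetries that generate the group of the icosahedron. -/
def IsIcoSymmetric (l : List ZVec) : Prop :=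
  IsOctSymmetric l ∧ ∀ x ∈ l, ∃ y ∈ l, y.add y = twiceReflection x

instance (l : List ZVec) : Decidable (IsIcoSymmetric l) := by unfold IsIcoSymmetric; infer_instance

theorem IsCertificate.icosahedral (C : IsCertificate V N fan h t μ m ν) (ht : v.dot w = t)
    (hVs : IsIcoSymmetric V) (hNs : IsIcoSymmetric N) (HN : PointsUniform N icoForm n)
    (HV : EdgesUniform V icoForm v w) (h0 : 0 ≤ β) (h1 : β ≤ 1)
    (hβ : β * icoInv (proj n.toE3) + (1 - β) / sphDist (proj v.toE3) (proj w.toE3) *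
      arcIntegral icoInv (proj v.toE3) (proj w.toE3) = -(2 * Real.goldenRatio + 1) / 21)
    (hP : IsCopyOf (convexHull ℝ (toFinset V : Set E3)) P) :
    IsCopyOf (convexHull ℝ (toFinset N : Set E3)) (dualPolytope P) ∧
      EdgesVerticesHybrid P (dualPolytope P) 9 β :=
  C.edgesVerticesHybrid ht isRestriction_icoForm HN HV (fun _ hs hi h1 h4 =>
    icosahedral_vanishing hs (hi cyc (cyc_mem_toFinset hVs.1.1) (cyc_mem_toFinset hNs.1.1))
      (hi flipX (flipX_mem_toFinset hVs.1.2) (flipX_mem_toFinset hNs.1.2))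
      (hi icoReflection (icoReflection_mem_toFinset hVs.2) (icoReflection_mem_toFinset hNs.2))
      h1 h4) h0 h1 (hβ.trans meanFunctional_icoInv.symm) hP

end Families

theorem isOctSymmetric_lists : IsOctSymmetric octahedronList ∧ IsOctSymmetric cubeList ∧
    IsOctSymmetric rhombicDodecahedronList ∧ IsOctSymmetric cuboctahedronList := by
  refine ⟨?_, ?_, ?_, ?_⟩ <;> decide +kernel

theorem isIcoSymmetric_lists : IsIcoSymmetric dodecahedronList ∧ IsIcoSymmetric icosahedronList ∧
    IsIcoSymmetric rhombicTriacontahedronList ∧ IsIcoSymmetric icosidodecahedronList := by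
  refine ⟨?_, ?_, ?_, ?_⟩ <;> decide +kernel

/-! ### Lengths of the projected edges and integrals along reference arcs. -/

theorem ZVec.sphDist_proj (v w : ZVec) : sphDist (proj v.toE3) (proj w.toE3) =
    Real.arccos ((v.dot w).toReal / (√(v.dot v).toReal * √(w.dot w).toReal)) := by
  rw [sphDist, proj, proj, inner_smul_left, inner_smul_right, inner_toE3, norm_toE3, norm_toE3]
  congr 1
  simp only [conj_trivial]
  ring

/-- The primitive is homogeneous of degree four, so normalizing the ends only divides by squares of
their squared norms and no root remains. -/
theorem arcIntegral_octInv_diagonal {v w : E3} {a₀ b₀ p₀ a₁ b₁ p₁ : ℝ}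
    (hv : v = a₀ • xAxis + b₀ • yzDiagonal) (hw : w = a₁ • xAxis + b₁ • yzDiagonal)
    (hp₀ : 0 < p₀) (hp₁ : 0 < p₁) (h₀ : a₀ ^ 2 + b₀ ^ 2 = p₀) (h₁ : a₁ ^ 2 + b₁ ^ 2 = p₁)
    (hpos : 0 < a₀ * b₁ - b₀ * a₁) :
    arcIntegral octInv (proj v) (proj w) = 9 / 16 * sphDist (proj v) (proj w) +
      (7 * (a₁ ^ 3 * b₁) + a₁ * b₁ ^ 3) / (16 * p₁ ^ 2) -
      (7 * (a₀ ^ 3 * b₀) + a₀ * b₀ ^ 3) / (16 * p₀ ^ 2) := by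
  have key := arcIntegral_proj_planar norm_xAxis norm_yzDiagonal inner_xAxis_yzDiagonal hv hw
    (Real.sqrt_pos.2 hp₀) (Real.sqrt_pos.2 hp₁) (by rw [h₀, Real.sq_sqrt hp₀.le])
    (by rw [h₁, Real.sq_sqrt hp₁.le]) hpos
    (K := fun a b => 7 / 16 * (a ^ 3 * b ^ 1) + 1 / 16 * (a ^ 1 * b ^ 3))
    hasDerivAt_octInv_diagonal
  have e {a b p : ℝ} (hp : 0 < p) :
      7 / 16 * ((a / √p) ^ 3 * (b / √p) ^ 1) + 1 / 16 * ((a / √p) ^ 1 * (b / √p) ^ 3) =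
        (7 * (a ^ 3 * b) + a * b ^ 3) / (16 * p ^ 2) := by
    have hs : √p ≠ 0 := (Real.sqrt_pos.2 hp).ne'
    nth_rewrite 5 [← Real.sq_sqrt hp.le]
    field_simp
  rw [key, ← e hp₀, ← e hp₁]

theorem arcIntegral_icoInv_xy {v w : E3} {a₀ b₀ p₀ a₁ b₁ p₁ : ℝ}
    (hv : v = a₀ • xAxis + b₀ • yAxis) (hw : w = a₁ • xAxis + b₁ • yAxis)
    (hp₀ : 0 < p₀) (hp₁ : 0 < p₁) (h₀ : a₀ ^ 2 + b₀ ^ 2 = p₀) (h₁ : a₁ ^ 2 + b₁ ^ 2 = p₁)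
    (hpos : 0 < a₀ * b₁ - b₀ * a₁) :
    arcIntegral icoInv (proj v) (proj w) =
      -(2 * Real.goldenRatio + 1) / 16 * sphDist (proj v) (proj w) +
      ((2 * Real.goldenRatio + 1) / 16 * (a₁ ^ 5 * b₁ - a₁ * b₁ ^ 5) -
        (4 * Real.goldenRatio + 3) / 6 * (a₁ ^ 3 * b₁ ^ 3)) / p₁ ^ 3 -
      ((2 * Real.goldenRatio + 1) / 16 * (a₀ ^ 5 * b₀ - a₀ * b₀ ^ 5) -
        (4 * Real.goldenRatio + 3) / 6 * (a₀ ^ 3 * b₀ ^ 3)) / p₀ ^ 3 := by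
  have key := arcIntegral_proj_planar norm_xAxis norm_yAxis inner_xAxis_yAxis hv hw
    (Real.sqrt_pos.2 hp₀) (Real.sqrt_pos.2 hp₁) (by rw [h₀, Real.sq_sqrt hp₀.le])
    (by rw [h₁, Real.sq_sqrt hp₁.le]) hpos
    (K := fun a b => (2 * Real.goldenRatio + 1) / 16 * (a ^ 5 * b ^ 1 - a ^ 1 * b ^ 5) -
        (4 * Real.goldenRatio + 3) / 6 * (a ^ 3 * b ^ 3))
    hasDerivAt_icoInv_xy
  have e (q₁ q₂ : ℝ) {a b p : ℝ} (hp : 0 < p) :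
      q₁ * ((a / √p) ^ 5 * (b / √p) ^ 1 - (a / √p) ^ 1 * (b / √p) ^ 5) -
        q₂ * ((a / √p) ^ 3 * (b / √p) ^ 3) =
        (q₁ * (a ^ 5 * b - a * b ^ 5) - q₂ * (a ^ 3 * b ^ 3)) / p ^ 3 := by
    obtain ⟨r, hr, rfl⟩ : ∃ r : ℝ, 0 < r ∧ p = r ^ 2 :=
      ⟨√p, Real.sqrt_pos.2 hp, (Real.sq_sqrt hp.le).symm⟩
    rw [Real.sqrt_sq hr.le]
    field_simp
  rw [key, ← e _ _ hp₀, ← e _ _ hp₁]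

theorem octInv_proj (x : ZVec) :
    octInv (proj x.toE3) = octInv x.toE3 / (x.dot x).toReal ^ 2 := by
  rw [← inner_toE3, real_inner_self_eq_norm_sq]
  simp [octInv, proj]
  ring

theorem icoInv_proj (x : ZVec) :
    icoInv (proj x.toE3) = icoInv x.toE3 / (x.dot x).toReal ^ 3 := by
  rw [← inner_toE3, real_inner_self_eq_norm_sq]
  simp [icoInv, proj]
  ring

/-! ### The balancing factors -/

theorem sqrt_two_sq : √(2 : ℝ) ^ 2 = 2 := Real.sq_sqrt (by norm_num)

theorem factor_mem_unit {A B : ℝ} (hA : 0 ≤ A) (hAB : A ≤ B) (hB : 0 < B) :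
    0 ≤ A / B ∧ A / B ≤ 1 :=
  ⟨div_nonneg hA hB.le, (div_le_one hB).2 hAB⟩

/-- The equation for the balancing factor, multiplied by Bθ. The length θ of the arc can then be
treated as an indeterminate. -/
theorem factor_identity {A B θ a κ δ M : ℝ} (hB : B ≠ 0) (hθ : θ ≠ 0)
    (h : A * a * θ + (B - A) * (κ * θ + δ) = M * B * θ) :
    A / B * a + (1 - A / B) / θ * (κ * θ + δ) = M := by
  field_simp
  linear_combination h

/-- An icosahedron and a dodecahedron. -/
theorem icosahedron_hybrid {P : Set E3} (hP : IsIcosahedron P) : IsDodecahedron (dualPolytope P) ∧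
    EdgesVerticesHybrid P (dualPolytope P) 9
      ((126 + 45 * Real.arccos (1 / √5)) / (126 + 301 * Real.arccos (1 / √5))) := by
  rw [IsIcosahedron, vertexSet_icosahedron] at hP
  rw [IsDodecahedron, vertexSet_dodecahedron]
  have hq : Real.goldenRatio ^ 2 = Real.goldenRatio + 1 := Real.goldenRatio_sq
  have hq0 := Real.goldenRatio_pos
  have h5 : √5 = 2 * Real.goldenRatio - 1 := by unfold Real.goldenRatio; ring
  have hd : sphDist (proj (toE3 ((0, 1), (-1, 0), (0, 0)))) (proj (toE3 ((0, 1), (1, 0), (0, 0)))) =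
      Real.arccos (1 / √5) := by
    rw [ZVec.sphDist_proj]
    simp only [dot, ZPhi.mul, ZPhi.add, ZPhi.toReal]
    norm_num
    rw [Real.mul_self_sqrt (by positivity), h5]
    congr 1
    have h1 := Real.one_lt_goldenRatio
    generalize Real.goldenRatio = p at *
    rw [div_eq_iff (by positivity), inv_mul_eq_div, eq_div_iff (by linarith)]
    linear_combination 2 * hq
  have hθ : 0 < Real.arccos (1 / √5) := by
    rw [Real.arccos_pos, div_lt_one (by positivity)]
    exact Real.lt_sqrt_of_sq_lt (by norm_num)
  obtain ⟨h0, h1⟩ := factor_mem_unit (A := 126 + 45 * Real.arccos (1 / √5))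
    (B := 126 + 301 * Real.arccos (1 / √5)) (by positivity) (by linarith) (by positivity)
  -- The reference edge is chosen in the plane z = 0, where the primitive of the invariant is
  -- available.
  refine isCertificate_icosahedron.icosahedral (v := ((0, 1), (-1, 0), (0, 0)))
    (w := ((0, 1), (1, 0), (0, 0))) (n := ((1, 0), (1, 0), (1, 0))) (by decide)
    isIcoSymmetric_lists.2.1 isIcoSymmetric_lists.1 (by decide +kernel) (by decide +kernel)
    h0 h1 ?_ hP
  rw [arcIntegral_icoInv_xy (a₀ := Real.goldenRatio) (b₀ := -1) (a₁ := Real.goldenRatio) (b₁ := 1)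
    (p₀ := Real.goldenRatio + 2) (p₁ := Real.goldenRatio + 2)
    (by ext i; fin_cases i <;> simp [toE3, ZPhi.toReal, xAxis, yAxis])
    (by ext i; fin_cases i <;> simp [toE3, ZPhi.toReal, xAxis, yAxis])
    (by positivity) (by positivity) (by linear_combination hq) (by linear_combination hq)
    (by linarith), hd, add_sub_assoc]
  generalize Real.arccos (1 / √5) = θ at *
  have hn : icoInv (proj (toE3 ((1, 0), (1, 0), (1, 0)))) = (2 * Real.goldenRatio + 1) / 27 := by
    rw [icoInv_proj]
    simp [icoInv, dot, ZPhi.mul, ZPhi.add, ZPhi.toReal]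
    norm_num
    generalize Real.goldenRatio = p at *
    linear_combination (p + 1) * hq
  have hδ : ((2 * Real.goldenRatio + 1) / 16 * (Real.goldenRatio ^ 5 * 1 - Real.goldenRatio * 1 ^ 5) -
        (4 * Real.goldenRatio + 3) / 6 * (Real.goldenRatio ^ 3 * 1 ^ 3)) / (Real.goldenRatio + 2) ^ 3 -
      ((2 * Real.goldenRatio + 1) / 16 * (Real.goldenRatio ^ 5 * (-1) - Real.goldenRatio * (-1) ^ 5) -
        (4 * Real.goldenRatio + 3) / 6 * (Real.goldenRatio ^ 3 * (-1) ^ 3)) /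
          (Real.goldenRatio + 2) ^ 3 = -(2 * Real.goldenRatio + 1) / 24 := by
    generalize Real.goldenRatio = p at *
    have h3 : p ^ 3 = 2 * p + 1 := by linear_combination (p + 1) * hq
    have hp5 : p ^ 5 = 5 * p + 3 := by linear_combination p ^ 2 * h3 + 2 * h3 + hq
    have hc : (p + 2) ^ 3 = 5 * (4 * p + 3) := by linear_combination h3 + 6 * hq
    rw [h3, hp5, hc]
    field_simp
    ring
  rw [hn, hδ]
  exact factor_identity (by positivity) hθ.ne' (by ring)

/-- The primitive at the projected vertex (φ, 1, 0) of the icosahedron, which is one end of an edge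
of the rhombic triacontahedron. -/
theorem icoInv_primitive_icosahedron :
    ((2 * Real.goldenRatio + 1) / 16 * (Real.goldenRatio ^ 5 * 1 - Real.goldenRatio * 1 ^ 5) -
      (4 * Real.goldenRatio + 3) / 6 * (Real.goldenRatio ^ 3 * 1 ^ 3)) /
        (Real.goldenRatio + 2) ^ 3 = -(2 * Real.goldenRatio + 1) / 48 := by
  have hq : Real.goldenRatio ^ 2 = Real.goldenRatio + 1 := Real.goldenRatio_sq
  have hq0 := Real.goldenRatio_pos
  generalize Real.goldenRatio = p at *
  have h3 : p ^ 3 = 2 * p + 1 := by linear_combination (p + 1) * hq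
  have hp5 : p ^ 5 = 5 * p + 3 := by linear_combination p ^ 2 * h3 + 2 * h3 + hq
  have hc : (p + 2) ^ 3 = 5 * (4 * p + 3) := by linear_combination h3 + 6 * hq
  rw [h3, hp5, hc]
  field_simp
  ring

/-- The primitive at the vertex (φ − 1, φ, 0) of the dodecahedron, before the division by 3³. At the
reflected vertex (1 − φ, φ, 0) it has the opposite value, being odd in the first coordinate. -/
theorem icoInv_primitive_dodecahedron :
    (2 * Real.goldenRatio + 1) / 16 * ((Real.goldenRatio - 1) ^ 5 * Real.goldenRatio -
        (Real.goldenRatio - 1) * Real.goldenRatio ^ 5) - (4 * Real.goldenRatio + 3) / 6 *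
        ((Real.goldenRatio - 1) ^ 3 * Real.goldenRatio ^ 3) =
      -17 / 48 * ((2 * Real.goldenRatio + 1) * (2 * Real.goldenRatio - 1)) := by
  have hq : Real.goldenRatio ^ 2 = Real.goldenRatio + 1 := Real.goldenRatio_sq
  generalize Real.goldenRatio = p at *
  have h1 : (p - 1) * p = 1 := by linear_combination hq
  have e5 : (p - 1) ^ 5 * p = (p - 1) ^ 4 := by linear_combination (p - 1) ^ 4 * h1
  have e5' : (p - 1) * p ^ 5 = p ^ 4 := by linear_combination p ^ 4 * h1
  have e3 : (p - 1) ^ 3 * p ^ 3 = 1 := by rw [← mul_pow, h1, one_pow]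
  have h4 : p ^ 4 = 3 * p + 2 := by linear_combination (p ^ 2 + p + 2) * hq
  have h4' : (p - 1) ^ 4 = 5 - 3 * p := by
    linear_combination (p ^ 2 - 3 * p + 4) * hq
  linear_combination ((2 * p + 1) / 16) * (e5 - e5' + h4' - h4) - (4 * p + 3) / 6 * e3 +
    (2 / 3) * hq

/-- A dodecahedron and an icosahedron. -/
theorem dodecahedron_hybrid {P : Set E3} (hP : IsDodecahedron P) :
    IsIcosahedron (dualPolytope P) ∧ EdgesVerticesHybrid P (dualPolytope P) 9
      ((1190 * √5 - 675 * Real.arccos (√5 / 3)) / (1190 * √5 + 6237 * Real.arccos (√5 / 3))) := by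
  rw [IsDodecahedron, vertexSet_dodecahedron] at hP
  rw [IsIcosahedron, vertexSet_icosahedron]
  have hq : Real.goldenRatio ^ 2 = Real.goldenRatio + 1 := Real.goldenRatio_sq
  have hq0 := Real.goldenRatio_pos
  have h5 : √5 = 2 * Real.goldenRatio - 1 := by unfold Real.goldenRatio; ring
  have hd : sphDist (proj (toE3 ((-1, 1), (0, 1), (0, 0))))
      (proj (toE3 ((1, -1), (0, 1), (0, 0)))) = Real.arccos (√5 / 3) := by
    rw [ZVec.sphDist_proj, h5]
    simp only [dot, ZPhi.mul, ZPhi.add, ZPhi.toReal]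
    norm_num
    ring_nf
  have hs : 2 < √5 ∧ √5 < 3 :=
    ⟨Real.lt_sqrt_of_sq_lt (by norm_num), (Real.sqrt_lt' (by norm_num)).2 (by norm_num)⟩
  have hθ : 0 < Real.arccos (√5 / 3) := by
    rw [Real.arccos_pos]; linarith
  -- Needed for β ≥ 0, since the length of the arc enters the numerator with a negative sign.
  have hθ' : Real.arccos (√5 / 3) ≤ Real.pi / 2 := Real.arccos_le_pi_div_two.2 (by positivity)
  have hpi := Real.pi_lt_d2
  obtain ⟨h0, h1⟩ := factor_mem_unit (A := 1190 * √5 - 675 * Real.arccos (√5 / 3))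
    (B := 1190 * √5 + 6237 * Real.arccos (√5 / 3)) (by linarith) (by linarith) (by positivity)
  refine isCertificate_dodecahedron.icosahedral (v := ((-1, 1), (0, 1), (0, 0)))
    (w := ((1, -1), (0, 1), (0, 0))) (n := ((0, 1), (1, 0), (0, 0))) (by decide)
    isIcoSymmetric_lists.1 isIcoSymmetric_lists.2.1 (by decide +kernel) (by decide +kernel)
    h0 h1 ?_ hP
  rw [arcIntegral_icoInv_xy (a₀ := Real.goldenRatio - 1) (b₀ := Real.goldenRatio)
    (a₁ := 1 - Real.goldenRatio) (b₁ := Real.goldenRatio) (p₀ := 3) (p₁ := 3)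
    (by ext i; fin_cases i <;> simp [toE3, ZPhi.toReal, xAxis, yAxis]; ring)
    (by ext i; fin_cases i <;> simp [toE3, ZPhi.toReal, xAxis, yAxis]; ring)
    (by positivity) (by positivity) (by linear_combination 2 * hq) (by linear_combination 2 * hq)
    (by nlinarith), hd, add_sub_assoc]
  generalize Real.arccos (√5 / 3) = θ at *
  have hn : icoInv (proj (toE3 ((0, 1), (1, 0), (0, 0)))) = -(2 * Real.goldenRatio + 1) / 5 := by
    rw [icoInv_proj]
    simp [icoInv, dot, ZPhi.mul, ZPhi.add, ZPhi.toReal]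
    generalize Real.goldenRatio = p at *
    rw [div_eq_iff (by positivity)]
    have hc : (2 + p) ^ 3 = 5 * (4 * p + 3) := by linear_combination (p + 7) * hq
    rw [hc]
    linear_combination (-(p ^ 2 + 5 * p + 3)) * hq
  have hδ : ((2 * Real.goldenRatio + 1) / 16 * ((1 - Real.goldenRatio) ^ 5 * Real.goldenRatio -
        (1 - Real.goldenRatio) * Real.goldenRatio ^ 5) - (4 * Real.goldenRatio + 3) / 6 *
        ((1 - Real.goldenRatio) ^ 3 * Real.goldenRatio ^ 3)) / 3 ^ 3 -
      ((2 * Real.goldenRatio + 1) / 16 * ((Real.goldenRatio - 1) ^ 5 * Real.goldenRatio -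
        (Real.goldenRatio - 1) * Real.goldenRatio ^ 5) - (4 * Real.goldenRatio + 3) / 6 *
        ((Real.goldenRatio - 1) ^ 3 * Real.goldenRatio ^ 3)) / 3 ^ 3 =
      (2 * Real.goldenRatio + 1) * (17 * √5 / 648) := by
    have e := icoInv_primitive_dodecahedron
    generalize Real.goldenRatio = p at *
    rw [h5]
    linear_combination (-2 / 27) * e
  rw [hn, hδ]
  exact factor_identity (by positivity) hθ.ne' (by ring)

/-- A rhombic triacontahedron and an icosidodecahedron. -/
theorem rhombicTriacontahedron_hybrid {P : Set E3} (hP : IsRhombicTriacontahedron P) :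
    IsIcosidodecahedron (dualPolytope P) ∧ EdgesVerticesHybrid P (dualPolytope P) 9
      ((7 * (17 * √5 - 27) + 135 * Real.arccos √(1 / 3 + 2 / (3 * √5))) /
        (7 * (17 * √5 - 27) + 567 * Real.arccos √(1 / 3 + 2 / (3 * √5)))) := by
  rw [IsRhombicTriacontahedron, vertexSet_rhombicTriacontahedron] at hP
  rw [IsIcosidodecahedron, vertexSet_icosidodecahedron]
  have hq : Real.goldenRatio ^ 2 = Real.goldenRatio + 1 := Real.goldenRatio_sq
  have hq0 := Real.goldenRatio_pos
  have h5 : √5 = 2 * Real.goldenRatio - 1 := by unfold Real.goldenRatio; ring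
  have hs : 2 < √5 := Real.lt_sqrt_of_sq_lt (by norm_num)
  have hd : sphDist (proj (toE3 ((0, 1), (1, 0), (0, 0))))
      (proj (toE3 ((-1, 1), (0, 1), (0, 0)))) = Real.arccos √(1 / 3 + 2 / (3 * √5)) := by
    rw [ZVec.sphDist_proj]
    have e1 : (dot ((0, 1), (1, 0), (0, 0)) ((-1, 1), (0, 1), (0, 0))).toReal =
        Real.goldenRatio + 1 := by
      simp only [dot, ZPhi.mul, ZPhi.add, ZPhi.toReal]; norm_num; ring
    have e2 : (dot ((0, 1), (1, 0), (0, 0)) ((0, 1), (1, 0), (0, 0))).toReal =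
        Real.goldenRatio + 2 := by
      simp only [dot, ZPhi.mul, ZPhi.add, ZPhi.toReal]; norm_num; ring
    have e3 : (dot ((-1, 1), (0, 1), (0, 0)) ((-1, 1), (0, 1), (0, 0))).toReal = 3 := by
      simp only [dot, ZPhi.mul, ZPhi.add, ZPhi.toReal]; norm_num
    rw [e1, e2, e3, ← Real.sqrt_mul (by positivity), h5]
    congr 1
    have h2 : 0 < 2 * Real.goldenRatio - 1 := by linarith
    generalize Real.goldenRatio = p at *
    -- Both sides are nonnegative, so their squares are compared: (φ + 1)² / (3(φ + 2)) and 1/3 +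
    -- 2/(3√5).
    rw [← Real.sqrt_sq (by positivity : 0 ≤ (p + 1) / √((p + 2) * 3)), div_pow,
      Real.sq_sqrt (by positivity)]
    congr 1
    have h2' : p * 2 - 1 ≠ 0 := by linarith
    field_simp
    linear_combination (2 * p + 3) * hq
  have hθ : 0 < Real.arccos √(1 / 3 + 2 / (3 * √5)) := by
    rw [Real.arccos_pos, Real.sqrt_lt' one_pos]
    have : 2 / (3 * √5) < 1 / 3 := by rw [div_lt_div_iff₀ (by positivity) (by positivity)]; linarith
    linarith
  obtain ⟨h0, h1⟩ := factor_mem_unit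
    (A := 7 * (17 * √5 - 27) + 135 * Real.arccos √(1 / 3 + 2 / (3 * √5)))
    (B := 7 * (17 * √5 - 27) + 567 * Real.arccos √(1 / 3 + 2 / (3 * √5)))
    (by linarith) (by linarith) (by linarith)
  refine isCertificate_rhombicTriacontahedron.icosahedral (v := ((0, 1), (1, 0), (0, 0)))
    (w := ((-1, 1), (0, 1), (0, 0))) (n := ((2, 0), (0, 0), (0, 0))) (by decide)
    isIcoSymmetric_lists.2.2.1 isIcoSymmetric_lists.2.2.2 (by decide +kernel) (by decide +kernel)
    h0 h1 ?_ hP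
  rw [arcIntegral_icoInv_xy (a₀ := Real.goldenRatio) (b₀ := 1)
    (a₁ := Real.goldenRatio - 1) (b₁ := Real.goldenRatio) (p₀ := Real.goldenRatio + 2) (p₁ := 3)
    (by ext i; fin_cases i <;> simp [toE3, ZPhi.toReal, xAxis, yAxis])
    (by ext i; fin_cases i <;> simp [toE3, ZPhi.toReal, xAxis, yAxis]; ring)
    (by positivity) (by positivity) (by linear_combination hq) (by linear_combination 2 * hq)
    (by nlinarith), hd, add_sub_assoc]
  generalize Real.arccos √(1 / 3 + 2 / (3 * √5)) = θ at *
  -- The factor φ²y² − z² vanishes on the first axis, so the points do not contribute to the average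
  -- of the invariant.
  have hn : icoInv (proj (toE3 ((2, 0), (0, 0), (0, 0)))) = 0 := by
    rw [icoInv_proj]
    simp [icoInv, ZPhi.toReal]
  have hδ : ((2 * Real.goldenRatio + 1) / 16 * ((Real.goldenRatio - 1) ^ 5 * Real.goldenRatio -
        (Real.goldenRatio - 1) * Real.goldenRatio ^ 5) - (4 * Real.goldenRatio + 3) / 6 *
        ((Real.goldenRatio - 1) ^ 3 * Real.goldenRatio ^ 3)) / 3 ^ 3 -
      ((2 * Real.goldenRatio + 1) / 16 * (Real.goldenRatio ^ 5 * 1 - Real.goldenRatio * 1 ^ 5) -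
        (4 * Real.goldenRatio + 3) / 6 * (Real.goldenRatio ^ 3 * 1 ^ 3)) /
          (Real.goldenRatio + 2) ^ 3 =
      (2 * Real.goldenRatio + 1) * ((27 - 17 * √5) / 1296) := by
    have e := icoInv_primitive_dodecahedron
    have e' := icoInv_primitive_icosahedron
    generalize Real.goldenRatio = p at *
    rw [h5]
    linear_combination (1 / 27) * e - e'
  rw [hn, hδ]
  exact factor_identity (by nlinarith) hθ.ne' (by ring)

/-- A cube and an octahedron. -/
theorem cube_hybrid {P : Set E3} (hP : IsCube P) :
    IsOctahedron (dualPolytope P) ∧ EdgesVerticesHybrid P (dualPolytope P) 5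
      ((10 * √2 + 3 * Real.arccos (1 / 3)) / (10 * √2 + 35 * Real.arccos (1 / 3))) := by
  rw [IsCube, vertexSet_cube] at hP
  rw [IsOctahedron, vertexSet_octahedron]
  have h2 := sqrt_two_sq
  have hd : sphDist (proj (toE3 ((1, 0), (1, 0), (1, 0))))
      (proj (toE3 ((-1, 0), (1, 0), (1, 0)))) = Real.arccos (1 / 3) := by
    rw [ZVec.sphDist_proj]
    simp only [dot, ZPhi.mul, ZPhi.add, ZPhi.toReal]
    norm_num
  have hθ : 0 < Real.arccos (1 / 3) := by rw [Real.arccos_pos]; norm_num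
  obtain ⟨h0, h1⟩ := factor_mem_unit (A := 10 * √2 + 3 * Real.arccos (1 / 3))
    (B := 10 * √2 + 35 * Real.arccos (1 / 3)) (by positivity) (by linarith) (by positivity)
  refine isCertificate_cube.octahedral (v := ((1, 0), (1, 0), (1, 0)))
    (w := ((-1, 0), (1, 0), (1, 0))) (n := ((1, 0), (0, 0), (0, 0))) (by decide)
    isOctSymmetric_lists.2.1 isOctSymmetric_lists.1 (by decide +kernel) (by decide +kernel)
    h0 h1 ?_ hP
  -- The edge lies in the plane y = z, where (±1, 1, 1) has the coordinates ±1 and √2.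
  rw [arcIntegral_octInv_diagonal (a₀ := 1) (b₀ := √2) (a₁ := -1) (b₁ := √2) (p₀ := 3) (p₁ := 3)
    (by ext i; fin_cases i <;> simp [toE3, ZPhi.toReal, xAxis, yzDiagonal] <;> linarith)
    (by ext i; fin_cases i <;> simp [toE3, ZPhi.toReal, xAxis, yzDiagonal] <;> linarith)
    (by positivity) (by positivity) (by linarith) (by linarith)
    (by have : 0 < √(2 : ℝ) := by positivity
        linarith), hd, add_sub_assoc]
  generalize Real.arccos (1 / 3) = θ at *
  have hn : octInv (proj (toE3 ((1, 0), (0, 0), (0, 0)))) = 1 := by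
    rw [octInv_proj]
    simp [octInv, dot, ZPhi.mul, ZPhi.add, ZPhi.toReal]
  have hδ : (7 * ((-1) ^ 3 * √2) + -1 * √2 ^ 3) / (16 * 3 ^ 2) -
      (7 * (1 ^ 3 * √2) + 1 * √2 ^ 3) / (16 * 3 ^ 2) = -√2 / 8 := by
    linear_combination (-√2 / 72) * h2
  rw [hn, hδ]
  exact factor_identity (by positivity) hθ.ne' (by ring)

/-- A rhombic dodecahedron and a cuboctahedron. -/
theorem rhombicDodecahedron_hybrid {P : Set E3} (hP : IsRhombicDodecahedron P) :
    IsCuboctahedron (dualPolytope P) ∧ EdgesVerticesHybrid P (dualPolytope P) 5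
      ((10 - 3 * √2 * Real.arccos (1 / √3)) / (10 + 5 * √2 * Real.arccos (1 / √3))) := by
  rw [IsRhombicDodecahedron, vertexSet_rhombicDodecahedron] at hP
  rw [IsCuboctahedron, vertexSet_cuboctahedron]
  have h2 := sqrt_two_sq
  have hd : sphDist (proj (toE3 ((2, 0), (0, 0), (0, 0))))
      (proj (toE3 ((1, 0), (1, 0), (1, 0)))) = Real.arccos (1 / √3) := by
    rw [ZVec.sphDist_proj]
    simp only [dot, ZPhi.mul, ZPhi.add, ZPhi.toReal]
    norm_num
    congr 1
    field_simp
  have hθ : 0 < Real.arccos (1 / √3) := by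
    rw [Real.arccos_pos, div_lt_one (by positivity)]
    exact Real.lt_sqrt_of_sq_lt (by norm_num)
  -- With √2 < 3/2 this bounds 3√2 θ by 10, which gives β ≥ 0.
  have hθ' : Real.arccos (1 / √3) ≤ Real.pi / 2 := Real.arccos_le_pi_div_two.2 (by positivity)
  have hpi := Real.pi_lt_d2
  have hs : √2 < 1.5 := (Real.sqrt_lt' (by norm_num)).2 (by norm_num)
  have hs0 : 0 < √(2 : ℝ) := by positivity
  obtain ⟨h0, h1⟩ := factor_mem_unit (A := 10 - 3 * √2 * Real.arccos (1 / √3))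
    (B := 10 + 5 * √2 * Real.arccos (1 / √3)) (by nlinarith) (by nlinarith [mul_pos hs0 hθ])
    (by positivity)
  refine isCertificate_rhombicDodecahedron.octahedral (v := ((2, 0), (0, 0), (0, 0)))
    (w := ((1, 0), (1, 0), (1, 0))) (n := ((1, 0), (1, 0), (0, 0))) (by decide)
    isOctSymmetric_lists.2.2.1 isOctSymmetric_lists.2.2.2 (by decide +kernel) (by decide +kernel)
    h0 h1 ?_ hP
  rw [arcIntegral_octInv_diagonal (a₀ := 2) (b₀ := 0) (a₁ := 1) (b₁ := √2) (p₀ := 4) (p₁ := 3)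
    (by ext i; fin_cases i <;> simp [toE3, ZPhi.toReal, xAxis, yzDiagonal])
    (by ext i; fin_cases i <;> simp [toE3, ZPhi.toReal, xAxis, yzDiagonal] <;> linarith)
    (by positivity) (by positivity) (by norm_num) (by linarith) (by linarith), hd, add_sub_assoc]
  generalize Real.arccos (1 / √3) = θ at *
  have hn : octInv (proj (toE3 ((1, 0), (1, 0), (0, 0)))) = 1 / 2 := by
    rw [octInv_proj]
    simp [octInv, dot, ZPhi.mul, ZPhi.add, ZPhi.toReal]
    norm_num
  have hδ : (7 * (1 ^ 3 * √2) + 1 * √2 ^ 3) / (16 * 3 ^ 2) -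
      (7 * (2 ^ 3 * 0) + 2 * 0 ^ 3) / (16 * 4 ^ 2) = √2 / 16 := by
    linear_combination (√2 / 144) * h2
  rw [hn, hδ]
  exact factor_identity (by positivity) hθ.ne' (by linear_combination θ / 2 * h2)

/-- An octahedron and a cube. -/
theorem octahedron_hybrid {P : Set E3} (hP : IsOctahedron P) :
    IsCube (dualPolytope P) ∧ EdgesVerticesHybrid P (dualPolytope P) 5 (9 / 25) := by
  rw [IsOctahedron, vertexSet_octahedron] at hP
  rw [IsCube, vertexSet_cube]
  refine isCertificate_octahedron.octahedral (v := ((1, 0), (0, 0), (0, 0)))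
    (w := ((0, 0), (1, 0), (0, 0))) (n := ((1, 0), (1, 0), (1, 0))) (by decide)
    isOctSymmetric_lists.1 isOctSymmetric_lists.2.1 (by decide +kernel) (by decide +kernel)
    (by norm_num) (by norm_num) ?_ hP
  have hd : sphDist (proj (toE3 ((1, 0), (0, 0), (0, 0))))
      (proj (toE3 ((0, 0), (1, 0), (0, 0)))) = Real.pi / 2 := by
    rw [ZVec.sphDist_proj]
    simp [dot, ZPhi.mul, ZPhi.add, ZPhi.toReal]
  -- The primitive vanishes at both ends of this quarter circle, so the mean along the edge is 3/4
  -- and β is rational: β/3 + 3(1 − β)/4 = 3/5.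
  rw [arcIntegral_proj_planar norm_xAxis norm_yAxis inner_xAxis_yAxis
    (a₀ := 1) (b₀ := 0) (r₀ := 1) (a₁ := 0) (b₁ := 1) (r₁ := 1)
    (by ext i; fin_cases i <;> simp [toE3, ZPhi.toReal, xAxis, yAxis])
    (by ext i; fin_cases i <;> simp [toE3, ZPhi.toReal, xAxis, yAxis])
    one_pos one_pos (by norm_num) (by norm_num) (by norm_num)
    (K := fun a b => (a ^ 3 * b ^ 1 - a ^ 1 * b ^ 3) / 4) hasDerivAt_octInv_xy, hd]
  have hn : octInv (proj (toE3 ((1, 0), (1, 0), (1, 0)))) = 1 / 3 := by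
    rw [octInv_proj]
    simp [octInv, dot, ZPhi.mul, ZPhi.add, ZPhi.toReal]
    norm_num
  rw [hn]
  have hpi := Real.pi_ne_zero
  norm_num
  field_simp
  norm_num

/-- A tetrahedron and a tetrahedron. -/
theorem tetrahedron_hybrid {P : Set E3} (hP : IsTetrahedron P) :
    IsTetrahedron (dualPolytope P) ∧ EdgesVerticesHybrid P (dualPolytope P) 3
      (4 / (4 + 3 * √2 * Real.arccos (-(1 / 3)))) := by
  rw [IsTetrahedron, vertexSet_tetrahedron] at hP
  have h2 := sqrt_two_sq
  have h3 : √(3 : ℝ) ^ 2 = 3 := Real.sq_sqrt (by norm_num)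
  have hd : sphDist (proj (toE3 ((1, 0), (-1, 0), (-1, 0))))
      (proj (toE3 ((1, 0), (1, 0), (1, 0)))) = Real.arccos (-(1 / 3)) := by
    rw [ZVec.sphDist_proj]
    simp only [dot, ZPhi.mul, ZPhi.add, ZPhi.toReal]
    norm_num
  have hθ : 0 < Real.arccos (-(1 / 3)) := by rw [Real.arccos_pos]; norm_num
  have hs0 : 0 < √(2 : ℝ) := by positivity
  obtain ⟨h0, h1⟩ := factor_mem_unit (A := 4) (B := 4 + 3 * √2 * Real.arccos (-(1 / 3)))
    (by positivity) (by nlinarith [mul_pos hs0 hθ]) (by positivity)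
  have hl : (∀ x ∈ tetrahedronList, ((x.2.1, x.2.2, x.1) : ZVec) ∈ tetrahedronList) ∧
      (∀ x ∈ tetrahedronDualList, ((x.2.1, x.2.2, x.1) : ZVec) ∈ tetrahedronDualList) ∧
      (∀ x ∈ tetrahedronList, ((x.1, x.2.1.neg, x.2.2.neg) : ZVec) ∈ tetrahedronList) ∧
      ∀ x ∈ tetrahedronDualList, ((x.1, x.2.1.neg, x.2.2.neg) : ZVec) ∈ tetrahedronDualList := by
    decide
  refine (isCertificate_tetrahedron.edgesVerticesHybrid (v := ((1, 0), (-1, 0), (-1, 0)))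
    (w := ((1, 0), (1, 0), (1, 0))) (n := ((-1, 0), (-1, 0), (-1, 0))) (by decide)
    isRestriction_tetForm (by decide) (by decide) (s := 3) (fun D hs hi e1 e3 =>
      tetrahedral_vanishing hs (hi cyc (cyc_mem_toFinset hl.1) (cyc_mem_toFinset hl.2.1))
        (hi flipYZ (flipYZ_mem_toFinset hl.2.2.1) (flipYZ_mem_toFinset hl.2.2.2)) e1 e3)
    h0 h1 ?_ hP).imp_left isTetrahedron_of_isCopyOf
  have hr : 0 < √(3 : ℝ) := by positivity
  -- The edge from (1, −1, −1) to (1, 1, 1) lies in the plane y = z. There xyz equals ab²/2, which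
  -- has the primitive b³/6 and no constant part.
  rw [meanFunctional_mono_flip 1 1 1 (by decide),
    arcIntegral_proj_planar norm_xAxis norm_yzDiagonal inner_xAxis_yzDiagonal
    (a₀ := 1) (b₀ := -√2) (r₀ := √3) (a₁ := 1) (b₁ := √2) (r₁ := √3)
    (by ext i; fin_cases i <;> simp [toE3, ZPhi.toReal, xAxis, yzDiagonal] <;> linarith)
    (by ext i; fin_cases i <;> simp [toE3, ZPhi.toReal, xAxis, yzDiagonal] <;> linarith)
    hr hr (by linarith) (by linarith) (by linarith)
    (K := fun _ b => b ^ 3 / 6) hasDerivAt_mono_diagonal, hd, add_sub_assoc]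
  generalize Real.arccos (-(1 / 3)) = θ at *
  have hn : mono 1 1 1 (proj (toE3 ((-1, 0), (-1, 0), (-1, 0)))) = -1 / √3 ^ 3 := by
    rw [proj, norm_toE3]
    simp [dot, ZPhi.mul, ZPhi.add, ZPhi.toReal]
    ring
  rw [hn]
  refine factor_identity (by positivity) hθ.ne' ?_
  field_simp
  linear_combination 6 * θ * (√2 ^ 2 + 2) * h2

end HybridDesigns

end

theorem mainTheorem2 :
    (∀ P : Set E3, IsTetrahedron P → IsTetrahedron (dualPolytope P) ∧
      EdgesVerticesHybrid P (dualPolytope P) 3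
        (4 / (4 + 3 * √2 * Real.arccos (-(1 / 3))))) ∧
    (∀ P : Set E3, IsOctahedron P → IsCube (dualPolytope P) ∧
      EdgesVerticesHybrid P (dualPolytope P) 5 (9 / 25)) ∧
    (∀ P : Set E3, IsCube P → IsOctahedron (dualPolytope P) ∧
      EdgesVerticesHybrid P (dualPolytope P) 5
        ((10 * √2 + 3 * Real.arccos (1 / 3)) / (10 * √2 + 35 * Real.arccos (1 / 3)))) ∧
    (∀ P : Set E3, IsRhombicDodecahedron P → IsCuboctahedron (dualPolytope P) ∧
      EdgesVerticesHybrid P (dualPolytope P) 5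
        ((10 - 3 * √2 * Real.arccos (1 / √3)) / (10 + 5 * √2 * Real.arccos (1 / √3)))) ∧
    (∀ P : Set E3, IsDodecahedron P → IsIcosahedron (dualPolytope P) ∧
      EdgesVerticesHybrid P (dualPolytope P) 9
        ((1190 * √5 - 675 * Real.arccos (√5 / 3)) /
          (1190 * √5 + 6237 * Real.arccos (√5 / 3)))) ∧
    (∀ P : Set E3, IsIcosahedron P → IsDodecahedron (dualPolytope P) ∧
      EdgesVerticesHybrid P (dualPolytope P) 9
        ((126 + 45 * Real.arccos (1 / √5)) / (126 + 301 * Real.arccos (1 / √5)))) ∧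
    (∀ P : Set E3, IsRhombicTriacontahedron P → IsIcosidodecahedron (dualPolytope P) ∧
      EdgesVerticesHybrid P (dualPolytope P) 9
        ((7 * (17 * √5 - 27) + 135 * Real.arccos √(1 / 3 + 2 / (3 * √5))) /
          (7 * (17 * √5 - 27) + 567 * Real.arccos √(1 / 3 + 2 / (3 * √5))))) := by
  exact ⟨fun _ => tetrahedron_hybrid, fun _ => octahedron_hybrid, fun _ => cube_hybrid,
    fun _ => rhombicDodecahedron_hybrid, fun _ => dodecahedron_hybrid,
    fun _ => icosahedron_hybrid, fun _ => rhombicTriacontahedron_hybrid⟩
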